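/- There is a universal constant $C>0$ such that the following holds. For integers $d\ge 1$, $L\ge 0$ let $\Lambda_L^d=\{-L,\dots,L\}^d$. Let $\psi:\mathbb Z^d\to[0,\infty)$ satisfy $\psi(-r)=\psi(r)$. A Gaussian random matrix $H_L$ with domain $\Lambda_L^d$ and shape function $\psi$ is a random Hermitian matrix of the form $H_L=(X_L+X_L^*)/\sqrt2$, with rows and columns indexed by $\Lambda_L^d$, where the entries of $X_L$ are independent centred Gaussian variables with $\mathbb E|X_L(x,y)|^2=\psi(x-y)$; they are all real Gaussian (orthogonal case) or all complex Gaussian, i.e. with independent real and imaginary parts of equal variance (unitary case). Write $\mathcal N(H,I)$ for the number of eigenvalues of $H$ in $I$, counted with multiplicity, and $|I|$ for the length of $I$. (i) Let $H_L$ be a Gaussian random matrix with domain $\Lambda_L^d$ and shape function $\psi$, in either the orthogonal or the unitary case, and suppose that for some integer $0\le W\le 2L$ $$\psi(r)\ge\frac1{(W+1)^d}\quad\text{whenever}\quad\|r\|_\infty\le 2\min(W,L).\qquad(*)$$ Then for every interval $I\subset\mathbb R$, $$\mathbb E\,\mathcal N(H_L,I)\le C(2L+1)^d|I|.$$ (ii)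 Suppose that, for some integer $W\ge0$, condition $(*)$ holds for all $L\ge 0$, and for every $L$ let $H_L$ be as above (in the same symmetry class for all $L$). If a locally finite measure $\rho$ on $\mathbb R$ is the vague limit $$\rho(\cdot)=\lim_{L\to\infty}\frac{\mathbb E\,\mathcal N(H_L,\cdot)}{(2L+1)^d}$$ (i.e. the values on compact intervals whose endpoints are not atoms of $\rho$ converge), then $\rho$ has a density with respect to Lebesgue measure (the density of states) which is bounded by $C$. If moreover $\sum_{r\in\mathbb Z^d}\psi(r)<\infty$, then this limit exists: there is a probability measure $\rho$ on $\mathbb R$ with $\mathbb E\,\mathcal N(H_L,I)/(2L+1)^d\to\rho(I)$ for every interval $I\subset\mathbb R$. The constant $C$ does not depend on $d$, $L$, $W$, $\psi$ or the symmetry class. -/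

import Mathlib

open MeasureTheory ProbabilityTheory Filter Topology
open scoped NNReal ENNReal

noncomputable section

namespace BandMatrix

/-- The two symmetry classes of Gaussian random matrices. -/
inductive SymmetryClass where
  | orthogonal
  | unitary

/-- The centred Gaussian law with `𝔼 |Z|² = v`. In the orthogonal class `Z` is real Gaussian
(regarded as a complex number); in the unitary class the real and imaginary parts are independent
real Gaussian variables of equal variance `v / 2`. Variance `0` gives the point mass at `0`. -/
def entryLaw (σ : SymmetryClass) (v : ℝ≥0) : Measure ℂ :=
  match σ with
  | .orthogonal => (gaussianReal 0 v).map (fun t : ℝ => (t : ℂ))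
  | .unitary => ((gaussianReal 0 (v / 2)).prod (gaussianReal 0 (v / 2))).map
      (fun p : ℝ × ℝ => (⟨p.1, p.2⟩ : ℂ))

/-- The box `{-L, …, L}^d`. -/
def box (d L : ℕ) : Finset (Fin d → ℤ) :=
  Fintype.piFinset fun _ => Finset.Icc (-(L : ℤ)) (L : ℤ)

/-- `X` is a random matrix indexed by the box, with independent centred Gaussian entries of the
given symmetry class and `𝔼 |X (x, y)|² = ψ (x - y)`. -/
structure IsGaussianMatrix {d L : ℕ} (σ : SymmetryClass) (ψ : (Fin d → ℤ) → ℝ≥0)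
    {Ω : Type*} [MeasurableSpace Ω] (P : Measure Ω)
    (X : Ω → Matrix (box d L) (box d L) ℂ) : Prop where
  hasLaw : ∀ x y : box d L,
    HasLaw (fun ω => X ω x y) (entryLaw σ (ψ ((x : Fin d → ℤ) - (y : Fin d → ℤ)))) P
  indep : iIndepFun (fun (p : box d L × box d L) (ω : Ω) => X ω p.1 p.2) P

/-- `(X + X*) / √2`. -/
def hermitize {n : Type*} (X : Matrix n n ℂ) : Matrix n n ℂ :=
  (1 / Real.sqrt 2 : ℝ) • (X + X.conjTranspose)

theorem hermitize_isHermitian {n : Type*} (X : Matrix n n ℂ) : (hermitize X).IsHermitian := by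
  ext i j
  simp [hermitize, Matrix.conjTranspose_apply, add_comm]

open Classical in
/-- The number of eigenvalues of a Hermitian matrix in `I`, counted with multiplicity. -/
def eigenvalueCount {n : Type*} [Fintype n] {A : Matrix n n ℂ} (hA : A.IsHermitian)
    (I : Set ℝ) : ℕ :=
  (Finset.univ.filter fun i : n => hA.eigenvalues i ∈ I).card

/-- `𝔼 𝒩(H, I)` for `H = (X + X*) / √2`. -/
def meanCount {n Ω : Type*} [Fintype n] [MeasurableSpace Ω] (P : Measure Ω)
    (X : Ω → Matrix n n ℂ) (I : Set ℝ) : ℝ≥0∞ :=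
  ∫⁻ ω, (eigenvalueCount (hermitize_isHermitian (X ω)) I : ℝ≥0∞) ∂P

/-- `ψ r ≥ (W + 1)^(-d)` whenever `‖r‖_∞ ≤ 2 min (W, L)`; the norm on `Fin d → ℤ` is the
sup norm. -/
def LowerBound {d : ℕ} (ψ : (Fin d → ℤ) → ℝ≥0) (W L : ℕ) : Prop :=
  ∀ r : Fin d → ℤ, ‖r‖ ≤ ((2 * min W L : ℕ) : ℝ) → 1 / ((W : ℝ≥0) + 1) ^ d ≤ ψ r

/-- The measures `m L` (given through their values on sets) converge vaguely to `ρ`: the values on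
compact intervals whose endpoints are not atoms of `ρ` converge. -/
def VagueLimit (m : ℕ → Set ℝ → ℝ≥0∞) (ρ : Measure ℝ) : Prop :=
  ∀ a b : ℝ, a ≤ b → ρ {a} = 0 → ρ {b} = 0 →
    Tendsto (fun L => m L (Set.Icc a b)) atTop (𝓝 (ρ (Set.Icc a b)))

end BandMatrix

end

/-! The constant is `64`. The count in `[E - ε, E + ε]` is at most `2ε` times the trace of `Im (H -
E - iε)⁻¹`, so the finite-volume estimate reduces to bounding the mean of this trace by `64` per
site, uniformly in `E` and `ε`. The box is cut into product blocks whose sides have between `W + 1`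
and `2W + 1` sites. A block `B` of `n` sites then has `n ≥ (W + 1)^d`, while its diameter keeps all
its variances above `1/n`.

For one block there are two steps. Regularization (`lintegral_sum_im_inv_le_regularized`): the
diagonal of `B` contains an independent Gaussian multiple of the identity on `B`, of standard
deviation `1/n`. Up to a constant the Gaussian law is dominated by its average over
Cauchy-distributed shifts, and averaging an analytic function with non-negative imaginary part over
the Cauchy law evaluates it at a point of the half plane (`lintegral_im_inv_shift_le`). This
replaces `ε` by `ε + 1/n` on `B`.

Self-consistency (`lintegral_im_inv_of_decouple_large`): by Schur's formula `Im G_ii` is at most the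
inverse of a quadratic form in column `i`, taken with the resolvent of the matrix decoupled at `i`.
If that resolvent has imaginary trace at least `4n` over the rest of `B`, the Gaussian column makes
the inverse have mean at most `2` (`lintegral_inv_norm_sq_le`). If the trace is below `4n` for some
`i`, decoupling costs at most `2n` (`sum_im_inv_le_decouple`), so the full trace is at most `6n`
deterministically. Together these give `8n`, and regularization costs another factor at most `8`.

For the infinite volume, the bound per unit length passes to any vague limit and yields a density
(`exists_density_of_measure_Icc_le`). If `ψ` is summable, the second moments of the mean spectral
measures are bounded, which gives tightness. Their integrals against a bounded Lipschitz function
form a Cauchy sequence: a large box is tiled by translates of a smaller one, the entries between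
different tiles are dropped at a cost controlled in Hilbert–Schmidt norm, and by translation
invariance of the variances each full tile contributes like the smaller box
(`abs_integral_specSum_box_sub_le`). The uniform density bound rules out atoms of the weak limit, so
convergence holds on every interval. -/

noncomputable section

namespace BandMatrix

/-! ### Deterministic resolvent identities for Hermitian matrices with site-dependent dissipation -/

section Dissipative

set_option linter.unusedSectionVars false

open Matrix

variable {ι : Type*} [Fintype ι] [DecidableEq ι]

/-- The dissipative matrix `A - i diag γ`. -/
def dissip (A : Matrix ι ι ℂ) (γ : ι → ℝ) : Matrix ι ι ℂ :=
  A - diagonal (fun j => (γ j : ℂ) * Complex.I)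

/-- A Hermitian matrix has a real quadratic form, so only the dissipation contributes. Invertibility
and all Ward-type identities below come from this. -/
theorem im_star_dotProduct_dissip_mulVec {A : Matrix ι ι ℂ} (hA : A.IsHermitian) (γ : ι → ℝ)
    (x : ι → ℂ) : (star x ⬝ᵥ (dissip A γ *ᵥ x)).im = -∑ j, γ j * ‖x j‖ ^ 2 := by
  have h1 : (star x ⬝ᵥ (A *ᵥ x)).im = 0 := hA.im_star_dotProduct_mulVec_self x
  rw [dissip, sub_mulVec, dotProduct_sub, Complex.sub_im, h1, zero_sub, dotProduct]
  congr 1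
  rw [Complex.im_sum]
  refine Finset.sum_congr rfl fun j _ => ?_
  rw [mulVec_diagonal, Pi.star_apply, ← Complex.normSq_eq_norm_sq, Complex.normSq_apply]
  simp
  ring

theorem isUnit_dissip {A : Matrix ι ι ℂ} (hA : A.IsHermitian) {γ : ι → ℝ} (hγ : ∀ j, 0 < γ j) :
    IsUnit (dissip A γ).det := by
  rw [isUnit_iff_ne_zero]
  intro h
  obtain ⟨v, hv, h0⟩ := Matrix.exists_mulVec_eq_zero_iff.2 h
  have h1 := im_star_dotProduct_dissip_mulVec hA γ v
  rw [h0] at h1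
  simp only [dotProduct_zero, Complex.zero_im, zero_eq_neg] at h1
  rw [Finset.sum_eq_zero_iff_of_nonneg (fun j _ => by have := hγ j; positivity)] at h1
  apply hv
  ext j
  have := h1 j (Finset.mem_univ j)
  simpa [(hγ j).ne'] using this

/-- `Im ⟨φ, G φ⟩ = ∑ γ |G φ|²` for `G = (A - i diag γ)⁻¹`. -/
theorem im_star_dotProduct_inv_mulVec {A : Matrix ι ι ℂ} (hA : A.IsHermitian) {γ : ι → ℝ}
    (hγ : ∀ j, 0 < γ j) (φ : ι → ℂ) :
    (star φ ⬝ᵥ ((dissip A γ)⁻¹ *ᵥ φ)).im = ∑ j, γ j * ‖((dissip A γ)⁻¹ *ᵥ φ) j‖ ^ 2 := by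
  have hu := isUnit_dissip hA hγ
  set u := (dissip A γ)⁻¹ *ᵥ φ with hu'
  have hφ : φ = dissip A γ *ᵥ u := by
    rw [hu', mulVec_mulVec, mul_nonsing_inv _ hu, one_mulVec]
  have h1 := im_star_dotProduct_dissip_mulVec hA γ u
  rw [← hφ] at h1
  have h2 : star φ ⬝ᵥ u = star (star u ⬝ᵥ φ) := star_dotProduct _ _
  rw [h2]
  simp only [Complex.star_def, Complex.conj_im, h1, neg_neg]

/-- `Im G_ii = ∑ γ_j |G_ji|²`. -/
theorem im_inv_apply_self {A : Matrix ι ι ℂ} (hA : A.IsHermitian) {γ : ι → ℝ}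
    (hγ : ∀ j, 0 < γ j) (i : ι) :
    ((dissip A γ)⁻¹ i i).im = ∑ j, γ j * ‖(dissip A γ)⁻¹ j i‖ ^ 2 := by
  have := im_star_dotProduct_inv_mulVec hA hγ (Pi.single i 1)
  simpa [Pi.star_single] using this

theorem im_inv_apply_self_nonneg {A : Matrix ι ι ℂ} (hA : A.IsHermitian) {γ : ι → ℝ}
    (hγ : ∀ j, 0 < γ j) (i : ι) : 0 ≤ ((dissip A γ)⁻¹ i i).im := by
  rw [im_inv_apply_self hA hγ]
  exact Finset.sum_nonneg fun j _ => by have := hγ j; positivity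

/-- `Im G_ii = ∑ γ_j |G_ij|²`. -/
theorem im_inv_apply_self' {A : Matrix ι ι ℂ} (hA : A.IsHermitian) {γ : ι → ℝ}
    (hγ : ∀ j, 0 < γ j) (i : ι) :
    ((dissip A γ)⁻¹ i i).im = ∑ j, γ j * ‖(dissip A γ)⁻¹ i j‖ ^ 2 := by
  have hT : (dissip Aᵀ γ) = (dissip A γ)ᵀ := by
    simp [dissip, transpose_sub]
  have hA' : (Aᵀ).IsHermitian := hA.transpose
  have := im_inv_apply_self hA' hγ i
  rw [hT, ← transpose_nonsing_inv] at this
  simpa using this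

/-- Keeping only the term `j = i` of the Ward identity gives `γ_i |G_ii|² ≤ Im G_ii ≤ |G_ii|`. -/
theorem im_inv_apply_self_le {A : Matrix ι ι ℂ} (hA : A.IsHermitian) {γ : ι → ℝ}
    (hγ : ∀ j, 0 < γ j) (i : ι) : ((dissip A γ)⁻¹ i i).im ≤ (γ i)⁻¹ := by
  have h1 := im_inv_apply_self hA hγ i
  have h2 : γ i * ‖(dissip A γ)⁻¹ i i‖ ^ 2 ≤ ((dissip A γ)⁻¹ i i).im := by
    rw [h1]
    exact Finset.single_le_sum (f := fun j => γ j * ‖(dissip A γ)⁻¹ j i‖ ^ 2)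
      (fun j _ => by have := hγ j; positivity) (Finset.mem_univ i)
  have h3 : ((dissip A γ)⁻¹ i i).im ≤ ‖(dissip A γ)⁻¹ i i‖ :=
    (le_abs_self _).trans (Complex.abs_im_le_norm _)
  set t := ‖(dissip A γ)⁻¹ i i‖
  refine h3.trans ?_
  rw [← one_div, le_div_iff₀ (hγ i)]
  by_contra! hlt
  have ht : 0 < t := by
    by_contra! h0
    have : t * γ i ≤ 0 := mul_nonpos_of_nonpos_of_nonneg h0 (hγ i).le
    linarith
  nlinarith

/-- The matrix `A` with the row and column `i` decoupled from the others. -/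
def decouple (i : ι) (A : Matrix ι ι ℂ) : Matrix ι ι ℂ :=
  of fun j k => if j = i ↔ k = i then A j k else 0

theorem decouple_isHermitian (i : ι) {A : Matrix ι ι ℂ} (hA : A.IsHermitian) :
    (decouple i A).IsHermitian := by
  ext j k
  simp only [decouple, conjTranspose_apply, of_apply]
  have := hA.apply j k
  by_cases h : (j = i ↔ k = i)
  · rw [if_pos h, if_pos h.symm, this]
  · rw [if_neg h, if_neg (fun h' => h h'.symm), star_zero]

theorem dissip_decouple_apply (i : ι) (A : Matrix ι ι ℂ) (γ : ι → ℝ) (j k : ι) :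
    dissip (decouple i A) γ j k = if j = i ↔ k = i then dissip A γ j k else 0 := by
  by_cases h : j = k
  · subst h; simp [dissip, decouple]
  · simp only [dissip, decouple, Matrix.sub_apply, of_apply, diagonal_apply_ne _ h, sub_zero]

/-- The `i`-th column of `A` without its diagonal entry. -/
def offCol (i : ι) (A : Matrix ι ι ℂ) : ι → ℂ := fun j => if j = i then 0 else A j i

theorem dissip_apply_ne (A : Matrix ι ι ℂ) (γ : ι → ℝ) {j k : ι} (h : j ≠ k) :
    dissip A γ j k = A j k := by
  simp [dissip, diagonal_apply_ne _ h]

/-- Otherwise the Ward identity would make the whole column `i` of an invertible matrix vanish. -/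
theorem inv_apply_self_ne_zero {A : Matrix ι ι ℂ} (hA : A.IsHermitian) {γ : ι → ℝ}
    (hγ : ∀ j, 0 < γ j) (i : ι) : (dissip A γ)⁻¹ i i ≠ 0 := by
  intro h
  have h1 := im_inv_apply_self hA hγ i
  rw [h, Complex.zero_im, eq_comm,
    Finset.sum_eq_zero_iff_of_nonneg (fun j _ => by have := hγ j; positivity)] at h1
  have h2 : ∀ j, (dissip A γ)⁻¹ j i = 0 := fun j => by
    simpa [(hγ j).ne'] using h1 j (Finset.mem_univ j)
  have h3 := congrFun (congrFun (mul_nonsing_inv _ (isUnit_dissip hA hγ)) i) i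
  simp [mul_apply, h2] at h3

/-- The resolvent of the decoupled matrix. -/
theorem inv_dissip_decouple_apply {A : Matrix ι ι ℂ} (hA : A.IsHermitian) {γ : ι → ℝ}
    (hγ : ∀ j, 0 < γ j) {i j : ι} (hj : j ≠ i) :
    (dissip (decouple i A) γ)⁻¹ j j =
      (dissip A γ)⁻¹ j j - (dissip A γ)⁻¹ j i * (dissip A γ)⁻¹ i j / (dissip A γ)⁻¹ i i := by
  have hG0 := inv_apply_self_ne_zero hA hγ i
  have hTG := mul_nonsing_inv _ (isUnit_dissip hA hγ)
  -- A zero here would make row `i` of the decoupled matrix vanish, against its invertibility.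
  have hii : dissip A γ i i ≠ 0 := by
    have h := (isUnit_dissip (decouple_isHermitian i hA) hγ).ne_zero
    intro h0
    apply h
    apply det_eq_zero_of_row_eq_zero i
    intro k
    rw [dissip_decouple_apply]
    by_cases hk : k = i
    · subst hk; simpa using h0
    · simp [hk]
  set T := dissip A γ with hT
  set G := T⁻¹ with hG
  -- The rank-one correction clears row and column `i` of `G`; the isolated site then gets back its
  -- own inverse.
  let N : Matrix ι ι ℂ := of fun j k =>
    (G j k - G j i * G i k / G i i) + if j = i ∧ k = i then (T i i)⁻¹ else 0
  have hN : dissip (decouple i A) γ * N = 1 := by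
    ext j k
    have hjk : ∀ k, ∑ l, T j l * G l k = (1 : Matrix ι ι ℂ) j k := fun k => by
      rw [← hTG, mul_apply]
    rw [mul_apply]
    have hNi : ∀ k, N i k = if k = i then (T i i)⁻¹ else 0 := fun k => by
      simp only [N, of_apply, true_and]
      rw [mul_div_assoc, mul_div_cancel₀ _ hG0]; simp
    have hNi' : ∀ j ≠ i, N j i = 0 := fun j h => by
      simp [N, of_apply, h, hG0]
    by_cases hj : j = i
    · subst hj
      rw [Finset.sum_eq_single j]
      · rw [hNi, dissip_decouple_apply]
        by_cases hk : k = j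
        · subst hk; simp [hT.symm, hii]
        · simp [hk, one_apply_ne' hk]
      · intro l _ hl
        rw [dissip_decouple_apply]; simp [hl]
      · simp
    · have : ∀ l, dissip (decouple i A) γ j l * N l k
          = T j l * (G l k - G l i * G i k / G i i) := by
        intro l
        rw [dissip_decouple_apply]
        by_cases hl : l = i
        · subst hl
          simp [hj, hG0]
        · simp [hj, hl, N]
          left; trivial
      rw [Finset.sum_congr rfl fun l _ => this l]
      have h2 : ∀ l, T j l * (G l k - G l i * G i k / G i i)
          = T j l * G l k - T j l * G l i * (G i k / G i i) := fun l => by ring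
      rw [Finset.sum_congr rfl fun l _ => h2 l, Finset.sum_sub_distrib, ← Finset.sum_mul,
        hjk, hjk, one_apply_ne hj]
      simp
  rw [inv_eq_right_inv hN]
  simp [N, hj]

/-- Schur's formula for the diagonal entry of the resolvent. -/
theorem inv_apply_self_mul_schur {A : Matrix ι ι ℂ} (hA : A.IsHermitian) {γ : ι → ℝ}
    (hγ : ∀ j, 0 < γ j) (i : ι) :
    (dissip A γ)⁻¹ i i * (dissip A γ i i
      - star (offCol i A) ⬝ᵥ ((dissip (decouple i A) γ)⁻¹ *ᵥ offCol i A)) = 1 := by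
  have hTG := mul_nonsing_inv _ (isUnit_dissip hA hγ)
  have hu0 := isUnit_dissip (decouple_isHermitian i hA) hγ
  set T := dissip A γ with hT
  set G := T⁻¹ with hG
  set T0 := dissip (decouple i A) γ with hT0
  -- Column `i` of `G` away from `i` solves the decoupled system with right-hand side `-G_ii` times
  -- the off-diagonal column.
  let w : ι → ℂ := fun j => if j = i then 0 else G j i
  have hw : T0 *ᵥ w = -(G i i • offCol i A) := by
    ext j
    have hjk : ∑ l, T j l * G l i = (1 : Matrix ι ι ℂ) j i := by rw [← hTG, mul_apply]
    simp only [mulVec, dotProduct, Pi.neg_apply, Pi.smul_apply, offCol, smul_eq_mul]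
    by_cases hj : j = i
    · subst hj
      simp only [if_true, mul_zero, neg_zero]
      refine Finset.sum_eq_zero fun l _ => ?_
      by_cases hl : l = j
      · simp [w, hl]
      · rw [hT0, dissip_decouple_apply]; simp [hl]
    · rw [← Finset.add_sum_erase _ _ (Finset.mem_univ i)] at hjk ⊢
      rw [one_apply_ne hj, hT, dissip_apply_ne _ _ hj, ← hT] at hjk
      have : ∑ l ∈ Finset.univ.erase i, T0 j l * w l = ∑ l ∈ Finset.univ.erase i, T j l * G l i := by
        refine Finset.sum_congr rfl fun l hl => ?_
        have hl := Finset.ne_of_mem_erase hl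
        rw [hT0, dissip_decouple_apply]
        simp [hj, hl, w, hT]
      rw [this]
      simp only [w, if_true, mul_zero, zero_add, hj, if_false]
      linear_combination hjk
  have hw2 : w = -(G i i • (T0⁻¹ *ᵥ offCol i A)) := by
    have : T0⁻¹ *ᵥ (T0 *ᵥ w) = w := by
      rw [mulVec_mulVec, nonsing_inv_mul _ hu0, one_mulVec]
    rw [← this, hw, mulVec_neg, mulVec_smul]
  have hrow : ∑ l, T i l * G l i = 1 := by
    have := congrFun (congrFun hTG i) i
    simpa [mul_apply] using this
  have hrow2 : T i i * G i i + star (offCol i A) ⬝ᵥ w = 1 := by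
    rw [← hrow, ← Finset.add_sum_erase _ _ (Finset.mem_univ i), dotProduct,
      ← Finset.add_sum_erase (a := i) _ _ (Finset.mem_univ i)]
    simp only [offCol, Pi.star_apply, if_true, star_zero, zero_mul, zero_add]
    congr 1
    refine Finset.sum_congr rfl fun l hl => ?_
    have hl := Finset.ne_of_mem_erase hl
    rw [if_neg hl, hA.apply, hT, dissip_apply_ne _ _ hl.symm]
    simp [w, hl]
  rw [hw2, dotProduct_neg, dotProduct_smul, smul_eq_mul] at hrow2
  linear_combination hrow2

/-- In Schur's formula the denominator has imaginary part `-γ_i - Im ⟨φ, R φ⟩`, two terms of the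
same sign, so its modulus is at least `Im ⟨φ, R φ⟩`. Working in `ℝ≥0∞` covers the case where this
form vanishes. -/
theorem ofReal_im_inv_apply_self_le {A : Matrix ι ι ℂ} (hA : A.IsHermitian) {γ : ι → ℝ}
    (hγ : ∀ j, 0 < γ j) (i : ι) :
    ENNReal.ofReal ((dissip A γ)⁻¹ i i).im ≤ (ENNReal.ofReal (∑ j, γ j *
      ‖((dissip (decouple i A) γ)⁻¹ *ᵥ offCol i A) j‖ ^ 2))⁻¹ := by
  have h1 := inv_apply_self_mul_schur hA hγ i
  have h2 := im_star_dotProduct_inv_mulVec (decouple_isHermitian i hA) hγ (offCol i A)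
  rw [← h2]
  have h2' : 0 ≤ (star (offCol i A) ⬝ᵥ ((dissip (decouple i A) γ)⁻¹ *ᵥ offCol i A)).im := by
    rw [h2]; exact Finset.sum_nonneg fun j _ => by have := hγ j; positivity
  set y := star (offCol i A) ⬝ᵥ ((dissip (decouple i A) γ)⁻¹ *ᵥ offCol i A)
  set G := (dissip A γ)⁻¹ i i
  have hAii : (A i i).im = 0 := by
    have := hA.apply i i
    exact Complex.conj_eq_iff_im.1 this
  have him : (dissip A γ i i - y).im = -(γ i) - y.im := by
    simp [dissip, hAii]
  have hnorm : y.im ≤ ‖dissip A γ i i - y‖ := by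
    have := Complex.abs_im_le_norm (dissip A γ i i - y)
    rw [him] at this
    have h3 := neg_abs_le (-(γ i) - y.im)
    have := hγ i
    linarith
  rcases h2'.eq_or_lt with h0 | h0
  · rw [← h0]; simp
  · rw [← ENNReal.ofReal_inv_of_pos h0]
    apply ENNReal.ofReal_le_ofReal
    have h4 : ‖G‖ * ‖dissip A γ i i - y‖ = 1 := by rw [← norm_mul, h1, norm_one]
    have h5 : G.im ≤ ‖G‖ := (le_abs_self _).trans (Complex.abs_im_le_norm _)
    rw [← one_div, le_div_iff₀ h0]
    calc G.im * y.im ≤ ‖G‖ * y.im := by gcongr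
      _ ≤ ‖G‖ * ‖dissip A γ i i - y‖ := by gcongr
      _ = 1 := h4

/-- Decoupling one index of a block changes the trace over the block by a bounded amount. -/
theorem sum_im_inv_le_decouple {A : Matrix ι ι ℂ} (hA : A.IsHermitian) {γ : ι → ℝ}
    (hγ : ∀ j, 0 < γ j) {B : Finset ι} {η : ℝ} (hη : 0 < η) (hB : ∀ j ∈ B, η ≤ γ j) {i : ι}
    (hi : i ∈ B) :
    ∑ j ∈ B, ((dissip A γ)⁻¹ j j).im ≤
      ∑ j ∈ B.erase i, ((dissip (decouple i A) γ)⁻¹ j j).im + 2 * η⁻¹ := by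
  rw [← Finset.add_sum_erase _ _ hi]
  have h1 : ((dissip A γ)⁻¹ i i).im ≤ η⁻¹ :=
    (im_inv_apply_self_le hA hγ i).trans (inv_anti₀ hη (hB i hi))
  have h2 : ∑ j ∈ B.erase i, ((dissip A γ)⁻¹ j j).im
      - ∑ j ∈ B.erase i, ((dissip (decouple i A) γ)⁻¹ j j).im ≤ η⁻¹ := by
    rw [← Finset.sum_sub_distrib]
    set G := (dissip A γ)⁻¹ with hG
    have hGi : 0 < ‖G i i‖ := norm_pos_iff.2 (inv_apply_self_ne_zero hA hγ i)
    -- The difference is `G_ji G_ij / G_ii`. The arithmetic-geometric mean inequality separates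
    -- column and row; each is summed by a Ward identity to at most `|G_ii|`, which cancels the
    -- denominator.
    have h3 : ∀ j ∈ B.erase i, (G j j).im - ((dissip (decouple i A) γ)⁻¹ j j).im
        ≤ (2 * η * ‖G i i‖)⁻¹ * (γ j * ‖G j i‖ ^ 2 + γ j * ‖G i j‖ ^ 2) := by
      intro j hj
      obtain ⟨hji, hjB⟩ := Finset.mem_erase.1 hj
      rw [inv_dissip_decouple_apply hA hγ hji, ← hG, Complex.sub_im, sub_sub_cancel]
      refine ((le_abs_self _).trans (Complex.abs_im_le_norm _)).trans ?_
      rw [norm_div, norm_mul, inv_mul_eq_div, div_le_div_iff₀ hGi (by positivity)]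
      have h5 := hB j hjB
      have h6 : 2 * η * (‖G j i‖ * ‖G i j‖) ≤ γ j * ‖G j i‖ ^ 2 + γ j * ‖G i j‖ ^ 2 := by
        calc 2 * η * (‖G j i‖ * ‖G i j‖) = η * (2 * ‖G j i‖ * ‖G i j‖) := by ring
          _ ≤ η * (‖G j i‖ ^ 2 + ‖G i j‖ ^ 2) := by
            gcongr; exact two_mul_le_add_sq _ _
          _ ≤ γ j * (‖G j i‖ ^ 2 + ‖G i j‖ ^ 2) := by gcongr
          _ = _ := by ring
      nlinarith
    refine (Finset.sum_le_sum h3).trans ?_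
    rw [← Finset.mul_sum, Finset.sum_add_distrib]
    have h7 : ∑ j ∈ B.erase i, γ j * ‖G j i‖ ^ 2 ≤ ‖G i i‖ := by
      refine (Finset.sum_le_univ_sum_of_nonneg (fun j => by have := hγ j; positivity)).trans ?_
      rw [← im_inv_apply_self hA hγ i]
      exact (le_abs_self _).trans (Complex.abs_im_le_norm _)
    have h8 : ∑ j ∈ B.erase i, γ j * ‖G i j‖ ^ 2 ≤ ‖G i i‖ := by
      refine (Finset.sum_le_univ_sum_of_nonneg (fun j => by have := hγ j; positivity)).trans ?_
      rw [← im_inv_apply_self' hA hγ i]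
      exact (le_abs_self _).trans (Complex.abs_im_le_norm _)
    calc (2 * η * ‖G i i‖)⁻¹ * (∑ j ∈ B.erase i, γ j * ‖G j i‖ ^ 2
          + ∑ j ∈ B.erase i, γ j * ‖G i j‖ ^ 2)
        ≤ (2 * η * ‖G i i‖)⁻¹ * (‖G i i‖ + ‖G i i‖) := by gcongr
      _ = η⁻¹ := by field_simp; norm_num
  linarith

/-- For `φ` supported on a block where `γ ≥ η`, `⟨φ, (Im G) φ⟩ ≤ ‖φ‖² / η`. -/
theorem sum_gamma_norm_sq_inv_mulVec_le {A : Matrix ι ι ℂ} (hA : A.IsHermitian) {γ : ι → ℝ}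
    (hγ : ∀ j, 0 < γ j) {η : ℝ} (hη : 0 < η) (φ : ι → ℂ) (hφ : ∀ j, φ j ≠ 0 → η ≤ γ j) :
    ∑ j, γ j * ‖((dissip A γ)⁻¹ *ᵥ φ) j‖ ^ 2 ≤ η⁻¹ * ∑ j, ‖φ j‖ ^ 2 := by
  have h1 := im_star_dotProduct_inv_mulVec hA hγ φ
  set u := (dissip A γ)⁻¹ *ᵥ φ
  -- The weights are such that the second half is exactly half of the left side by `h1` and can be
  -- absorbed.
  have h2 : (star φ ⬝ᵥ u).im ≤ ∑ j, (η⁻¹ * ‖φ j‖ ^ 2 / 2 + γ j * ‖u j‖ ^ 2 / 2) := by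
    rw [dotProduct, Complex.im_sum]
    refine Finset.sum_le_sum fun j _ => ?_
    refine ((le_abs_self _).trans (Complex.abs_im_le_norm _)).trans ?_
    rw [norm_mul, Pi.star_apply, norm_star]
    by_cases h0 : φ j = 0
    · have := hγ j; simp only [h0, norm_zero, zero_mul]; positivity
    · have h5 := hφ j h0
      calc ‖φ j‖ * ‖u j‖ = η⁻¹ * (2 * ‖φ j‖ * (η * ‖u j‖)) / 2 := by field_simp
        _ ≤ η⁻¹ * (‖φ j‖ ^ 2 + (η * ‖u j‖) ^ 2) / 2 := by
          gcongr; exact two_mul_le_add_sq _ _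
        _ = η⁻¹ * ‖φ j‖ ^ 2 / 2 + η * ‖u j‖ ^ 2 / 2 := by field_simp
        _ ≤ _ := by gcongr
  rw [Finset.sum_add_distrib, ← Finset.sum_div, ← Finset.sum_div, ← Finset.mul_sum] at h2
  rw [h1] at h2
  linarith

end Dissipative

end BandMatrix

end

noncomputable section

namespace BandMatrix

/-! ### Cauchy averages through the mean value property on the disc -/

section Poisson

open Matrix

/-- Mean value inequality for analytic functions with non-negative imaginary part in the disc,
in terms of the boundary values. -/
theorem lintegral_im_circle_le {F : ℂ → ℂ} (hF : DifferentiableOn ℂ F (Metric.ball 0 1))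
    (hpos : ∀ w ∈ Metric.ball (0 : ℂ) 1, 0 ≤ (F w).im) {g : ℝ → ℂ}
    (hg : ∀ᵐ θ : ℝ, Tendsto (fun r : ℝ => F (circleMap 0 r θ)) (𝓝[<] 1) (𝓝 (g θ))) :
    ∫⁻ θ in Set.Ioc 0 (2 * Real.pi), ENNReal.ofReal (g θ).im
      ≤ ENNReal.ofReal (2 * Real.pi * (F 0).im) := by
  -- Boundary values exist only almost everywhere: the mean value property is used on circles of
  -- radius `r n < 1`, and Fatou's lemma passes to the unit circle at the price of an inequality.
  obtain ⟨r, -, hr1, hr⟩ := exists_seq_strictMono_tendsto' (show (0 : ℝ) < 1 by norm_num)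
  have hr' : Tendsto r atTop (𝓝[<] 1) :=
    tendsto_nhdsWithin_iff.2 ⟨hr, Eventually.of_forall fun n => (hr1 n).2⟩
  have hball : ∀ n θ, circleMap 0 (r n) θ ∈ Metric.ball (0 : ℂ) 1 := fun n θ => by
    have h1 := hr1 n
    simp only [Metric.mem_ball, dist_zero_right, norm_circleMap_zero, abs_of_pos h1.1]
    exact h1.2
  have hcont : ∀ n, Continuous fun θ => F (circleMap 0 (r n) θ) := fun n =>
    hF.continuousOn.comp_continuous (continuous_circleMap 0 (r n)) (hball n)
  have hmean : ∀ n, ∫⁻ θ in Set.Ioc 0 (2 * Real.pi), ENNReal.ofReal (F (circleMap 0 (r n) θ)).im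
      = ENNReal.ofReal (2 * Real.pi * (F 0).im) := by
    intro n
    have h1 := hr1 n
    have hd : DiffContOnCl ℂ F (Metric.ball 0 |r n|) := by
      apply DifferentiableOn.diffContOnCl_ball (U := Metric.ball 0 1) hF
      rw [abs_of_pos h1.1]
      exact Metric.closedBall_subset_ball h1.2
    have h2 := hd.circleAverage
    rw [Real.circleAverage_def, inv_smul_eq_iff₀ (by positivity)] at h2
    have h3 : ∫ θ in (0 : ℝ)..2 * Real.pi, (F (circleMap 0 (r n) θ)).im
        = 2 * Real.pi * (F 0).im := by
      have := Complex.imCLM.intervalIntegral_comp_comm (μ := volume)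
        ((hcont n).intervalIntegrable 0 (2 * Real.pi))
      simp only [Complex.imCLM_apply] at this
      rw [this, h2]
      simp
    rw [← ofReal_integral_eq_lintegral_ofReal, ← intervalIntegral.integral_of_le (by positivity),
      h3]
    · exact ((Complex.continuous_im.comp (hcont n)).integrableOn_Icc).mono_set
        Set.Ioc_subset_Icc_self
    · exact Eventually.of_forall fun θ => hpos _ (hball n θ)
  calc ∫⁻ θ in Set.Ioc 0 (2 * Real.pi), ENNReal.ofReal (g θ).im
      = ∫⁻ θ in Set.Ioc 0 (2 * Real.pi),
          liminf (fun n => ENNReal.ofReal (F (circleMap 0 (r n) θ)).im) atTop := by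
        apply lintegral_congr_ae
        filter_upwards [ae_restrict_of_ae hg] with θ hθ
        refine (Tendsto.liminf_eq ?_).symm
        exact (ENNReal.continuous_ofReal.tendsto _).comp
          ((Complex.continuous_im.tendsto _).comp (hθ.comp hr'))
    _ ≤ liminf (fun n => ∫⁻ θ in Set.Ioc 0 (2 * Real.pi),
          ENNReal.ofReal (F (circleMap 0 (r n) θ)).im) atTop :=
        lintegral_liminf_le fun n =>
          ENNReal.measurable_ofReal.comp (Complex.continuous_im.comp (hcont n)).measurable
    _ = ENNReal.ofReal (2 * Real.pi * (F 0).im) := by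
        simp only [hmean, liminf_const]

/-- The Cayley transform from the unit disc to the lower half plane. -/
def cayley (w : ℂ) : ℂ := Complex.I * (w - 1) / (w + 1)

theorem one_add_ne_zero_of_mem_ball {w : ℂ} (hw : w ∈ Metric.ball (0 : ℂ) 1) : w + 1 ≠ 0 := by
  intro h
  rw [add_eq_zero_iff_eq_neg] at h
  simp [h] at hw

theorem cayley_im_neg {w : ℂ} (hw : w ∈ Metric.ball (0 : ℂ) 1) : (cayley w).im ≤ 0 := by
  have h0 := one_add_ne_zero_of_mem_ball hw
  have h1 : ‖w‖ ^ 2 < 1 := by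
    have : ‖w‖ < 1 := by simpa using hw
    nlinarith [norm_nonneg w]
  rw [← Complex.normSq_eq_norm_sq, Complex.normSq_apply] at h1
  have h2 : 0 < Complex.normSq (w + 1) := Complex.normSq_pos.2 h0
  rw [cayley, Complex.div_im]
  simp only [Complex.mul_re, Complex.mul_im, Complex.I_re, Complex.I_im, Complex.sub_re,
    Complex.sub_im, Complex.add_re, Complex.add_im, Complex.one_re, Complex.one_im]
  rw [← sub_div]
  apply div_nonpos_of_nonpos_of_nonneg _ h2.le
  nlinarith

/-- Uniform `θ` thus corresponds to a Cauchy-distributed real shift. At the point `-1` both sides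
are divisions by zero, hence `0`. -/
theorem cayley_circleMap (θ : ℝ) : cayley (circleMap 0 1 θ) = ((-Real.tan (θ / 2) : ℝ) : ℂ) := by
  have h1 : circleMap 0 1 θ = Complex.exp ((θ / 2 : ℂ) * Complex.I) ^ 2 := by
    rw [← Complex.exp_nat_mul, circleMap]
    push_cast
    simp
    ring_nf
  rw [cayley, h1, Complex.ofReal_neg, Complex.ofReal_tan, Complex.tan_eq_sin_div_cos,
    Complex.sin, Complex.cos]
  have h2 : Complex.exp (-((θ / 2 : ℂ)) * Complex.I) = (Complex.exp ((θ / 2 : ℂ) * Complex.I))⁻¹ := by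
    rw [← Complex.exp_neg]; ring_nf
  push_cast
  rw [h2]
  have h3 : Complex.exp ((θ / 2 : ℂ) * Complex.I) ≠ 0 := Complex.exp_ne_zero _
  set e := Complex.exp ((θ / 2 : ℂ) * Complex.I)
  by_cases h4 : e ^ 2 + 1 = 0
  · have : e + e⁻¹ = 0 := by
      field_simp; linear_combination h4
    rw [h4, this]; simp
  · have : e + e⁻¹ ≠ 0 := by
      intro h; apply h4; field_simp at h; linear_combination h
    field_simp
    ring

theorem circleMap_add_one_ne_zero {θ : ℝ} (h : Real.cos (θ / 2) ≠ 0) :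
    circleMap 0 1 θ + 1 ≠ 0 := by
  intro h0
  apply h
  have h1 : circleMap 0 1 θ = Complex.exp ((θ / 2 : ℂ) * Complex.I) ^ 2 := by
    rw [← Complex.exp_nat_mul, circleMap]
    push_cast
    simp
    ring_nf
  have h2 : Complex.exp (-((θ / 2 : ℂ)) * Complex.I) = (Complex.exp ((θ / 2 : ℂ) * Complex.I))⁻¹ := by
    rw [← Complex.exp_neg]; ring_nf
  have h3 : Complex.exp ((θ / 2 : ℂ) * Complex.I) ≠ 0 := Complex.exp_ne_zero _
  have : Complex.cos ((θ / 2 : ℝ) : ℂ) = 0 := by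
    rw [Complex.cos]
    push_cast
    rw [h2]
    rw [h1] at h0
    set e := Complex.exp ((θ / 2 : ℂ) * Complex.I)
    field_simp
    linear_combination h0
  rw [← Complex.ofReal_cos] at this
  exact_mod_cast this

theorem ae_cos_half_ne_zero : ∀ᵐ θ : ℝ, Real.cos (θ / 2) ≠ 0 := by
  have : {θ : ℝ | Real.cos (θ / 2) = 0} ⊆ Set.range fun k : ℤ => (2 * k + 1) * Real.pi := by
    intro θ hθ
    obtain ⟨k, hk⟩ := Real.cos_eq_zero_iff.1 hθ
    exact ⟨k, by simp only; linarith⟩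
  rw [ae_iff]
  simp only [not_not]
  exact measure_mono_null this ((Set.countable_range _).measure_zero _)

variable {ι : Type*} [Fintype ι] [DecidableEq ι]

/-- The indicator function of a block. -/
def blockInd (B : Finset ι) : ι → ℝ := fun j => if j ∈ B then 1 else 0

theorem differentiable_det {A : ℂ → Matrix ι ι ℂ} (hA : ∀ i j, Differentiable ℂ fun w => A w i j) :
    Differentiable ℂ fun w => (A w).det := by
  simp only [det_apply]
  fun_prop

theorem differentiable_adjugate {A : ℂ → Matrix ι ι ℂ}
    (hA : ∀ i j, Differentiable ℂ fun w => A w i j) (i j : ι) :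
    Differentiable ℂ fun w => (A w).adjugate i j := by
  simp only [adjugate_apply]
  apply differentiable_det
  intro k l
  by_cases hk : k = j
  · subst hk; simp
  · simp [updateRow_ne hk, hA]

theorem differentiableAt_inv_apply {A : ℂ → Matrix ι ι ℂ}
    (hA : ∀ i j, Differentiable ℂ fun w => A w i j) {w : ℂ} (hw : IsUnit (A w).det) (i j : ι) :
    DifferentiableAt ℂ (fun w => (A w)⁻¹ i j) w := by
  have : (fun w => (A w)⁻¹ i j) = fun w => (A w).det⁻¹ * (A w).adjugate i j := by
    ext w
    rw [inv_def, Ring.inverse_eq_inv', Matrix.smul_apply, smul_eq_mul]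
  rw [this]
  exact ((differentiable_det hA w).inv hw.ne_zero).mul (differentiable_adjugate hA i j w)

/-- For `Im τ ≤ 0` the shift by `τ η` on `B` adds a Hermitian part and further dissipation, so the
block trace is analytic in `τ` with non-negative imaginary part. The disc is mapped to the lower
half plane, real `τ` is the boundary, and the centre `τ = -i` turns the shift into extra dissipation
`η` on `B`. -/
theorem lintegral_im_inv_shift_le {A : Matrix ι ι ℂ} (hA : A.IsHermitian) {ε η : ℝ} (hε : 0 < ε)
    (hη : 0 ≤ η) (B : Finset ι) :
    ∫⁻ θ in Set.Ioc 0 (2 * Real.pi), ENNReal.ofReal (∑ i ∈ B,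
        ((dissip (A + diagonal fun j => ((-Real.tan (θ / 2) * (η * blockInd B j) : ℝ) : ℂ))
          fun _ => ε)⁻¹ i i).im)
      ≤ ENNReal.ofReal (2 * Real.pi * ∑ i ∈ B,
          ((dissip A fun j => ε + η * blockInd B j)⁻¹ i i).im) := by
  set N : ℂ → Matrix ι ι ℂ := fun τ =>
    A + diagonal (fun j => τ * (η * blockInd B j : ℝ)) - diagonal fun _ => (ε : ℂ) * Complex.I
  have hNd : ∀ i j, Differentiable ℂ fun τ => N τ i j := by
    intro i j
    by_cases h : i = j
    · subst h; simp only [N, Matrix.sub_apply, Matrix.add_apply, diagonal_apply_eq]; fun_prop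
    · simp only [N, Matrix.sub_apply, Matrix.add_apply, diagonal_apply_ne _ h]; fun_prop
  have hNeq : ∀ τ : ℂ, N τ = dissip (A + diagonal fun j => ((τ.re * (η * blockInd B j) : ℝ) : ℂ))
      fun j => ε - τ.im * (η * blockInd B j) := by
    intro τ
    simp only [N, dissip, add_sub_assoc, diagonal_sub]
    congr 2
    ext j
    conv_lhs => rw [← Complex.re_add_im τ]
    push_cast
    ring
  have hH : ∀ t : ℝ, (A + diagonal fun j => ((t * (η * blockInd B j) : ℝ) : ℂ)).IsHermitian := by
    intro t
    refine hA.add (isHermitian_diagonal_of_self_adjoint _ ?_)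
    ext j
    simp
  have hind : ∀ j, 0 ≤ blockInd B j := fun j => by unfold blockInd; split_ifs <;> norm_num
  have hγ : ∀ τ : ℂ, τ.im ≤ 0 → ∀ j, 0 < ε - τ.im * (η * blockInd B j) := by
    intro τ hτ j
    have := mul_nonneg hη (hind j)
    nlinarith
  have hunit : ∀ τ : ℂ, τ.im ≤ 0 → IsUnit (N τ).det := by
    intro τ hτ
    rw [hNeq]
    exact isUnit_dissip (hH _) (hγ τ hτ)
  have hdiff : ∀ τ : ℂ, τ.im ≤ 0 → DifferentiableAt ℂ (fun τ => ∑ i ∈ B, (N τ)⁻¹ i i) τ := by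
    intro τ hτ
    apply DifferentiableAt.fun_sum
    intro i _
    exact differentiableAt_inv_apply hNd (hunit τ hτ) i i
  have hcay : ∀ w : ℂ, w + 1 ≠ 0 → DifferentiableAt ℂ cayley w := by
    intro w hw
    unfold cayley
    exact DifferentiableAt.div (by fun_prop) (by fun_prop) hw
  have key := lintegral_im_circle_le (F := fun w => ∑ i ∈ B, (N (cayley w))⁻¹ i i)
    (g := fun θ => ∑ i ∈ B, (N ((-Real.tan (θ / 2) : ℝ) : ℂ))⁻¹ i i) ?_ ?_ ?_
  · have h0 : cayley 0 = -Complex.I := by simp [cayley]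
    convert key using 1
    · refine lintegral_congr fun θ => ?_
      rw [Complex.im_sum, hNeq]
      simp only [Complex.ofReal_re, Complex.ofReal_im, zero_mul, sub_zero]
    · rw [Complex.im_sum, h0, hNeq]
      simp
  · intro w hw
    exact ((hdiff _ (cayley_im_neg hw)).comp w
      (hcay w (one_add_ne_zero_of_mem_ball hw))).differentiableWithinAt
  · intro w hw
    rw [Complex.im_sum]
    refine Finset.sum_nonneg fun i _ => ?_
    rw [hNeq]
    exact im_inv_apply_self_nonneg (hH _) (hγ _ (cayley_im_neg hw)) i
  · filter_upwards [ae_cos_half_ne_zero] with θ hθ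
    rw [← cayley_circleMap]
    have h1 : ContinuousAt (fun w => ∑ i ∈ B, (N (cayley w))⁻¹ i i) (circleMap 0 1 θ) := by
      refine ContinuousAt.comp (f := cayley) (g := fun τ => ∑ i ∈ B, (N τ)⁻¹ i i) ?_ ?_
      · apply (hdiff _ _).continuousAt
        rw [cayley_circleMap, Complex.ofReal_im]
      · exact (hcay _ (circleMap_add_one_ne_zero hθ)).continuousAt
    have h2 : Tendsto (fun r : ℝ => circleMap 0 r θ) (𝓝[<] 1) (𝓝 (circleMap 0 1 θ)) := by
      have : Continuous fun r : ℝ => circleMap 0 r θ := by unfold circleMap; fun_prop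
      exact (this.tendsto 1).mono_left nhdsWithin_le_nhds
    exact h1.tendsto.comp h2

end Poisson

end BandMatrix

end

noncomputable section

namespace BandMatrix

/-! ### Gaussian measures: Cauchy shifts, conditioning on a direction, inverse quadratic forms -/

section Gaussian

/-- Averaging over the shifts `tan (θ / 2)` dominates the standard Gaussian measure. -/
theorem lintegral_gaussianReal_le_shift {h : ℝ → ℝ≥0∞} (hh : Measurable h) :
    ∫⁻ t, h t ∂gaussianReal 0 1 ≤ ENNReal.ofReal (2 * Real.exp (1 / 2) / Real.pi) *
      ∫⁻ t, (∫⁻ θ in Set.Ioc 0 (2 * Real.pi), h (t - Real.tan (θ / 2))) ∂gaussianReal 0 1 := by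
  have hpi := Real.pi_pos
  have hg : gaussianReal 0 1 = volume.withDensity (gaussianPDF 0 1) :=
    gaussianReal_of_var_ne_zero 0 one_ne_zero
  have hm : Measurable (gaussianPDF 0 1) := measurable_gaussianPDF 0 1
  have htan : Measurable fun θ : ℝ => Real.tan (θ / 2) := by
    simp only [Real.tan_eq_sin_div_cos]
    fun_prop
  have hm2 : Measurable (Function.uncurry fun (t θ : ℝ) => h (t - Real.tan (θ / 2))) :=
    hh.comp (measurable_fst.sub (htan.comp measurable_snd))
  have hm3 : Measurable (Function.uncurry fun (y θ : ℝ) =>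
      gaussianPDF 0 1 (y + Real.tan (θ / 2)) * h y) :=
    (hm.comp (measurable_fst.add (htan.comp measurable_snd))).mul (hh.comp measurable_fst)
  have hR : ∫⁻ t, (∫⁻ θ in Set.Ioc 0 (2 * Real.pi), h (t - Real.tan (θ / 2))) ∂gaussianReal 0 1
      = ∫⁻ y, (∫⁻ θ in Set.Ioc 0 (2 * Real.pi), gaussianPDF 0 1 (y + Real.tan (θ / 2))) * h y := by
    rw [lintegral_lintegral_swap hm2.aemeasurable]
    have : ∀ θ : ℝ, ∫⁻ t, h (t - Real.tan (θ / 2)) ∂gaussianReal 0 1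
        = ∫⁻ y, gaussianPDF 0 1 (y + Real.tan (θ / 2)) * h y := by
      intro θ
      rw [hg, lintegral_withDensity_eq_lintegral_mul _ hm
        (g := fun t => h (t - Real.tan (θ / 2))) (hh.comp (by fun_prop))]
      rw [← lintegral_add_right_eq_self _ (Real.tan (θ / 2))]
      simp
    simp only [this]
    rw [← lintegral_lintegral_swap hm3.aemeasurable]
    refine lintegral_congr fun y => ?_
    rw [lintegral_mul_const]
    exact hm.comp (htan.const_add y)
  rw [hR, ← lintegral_const_mul]
  swap
  · apply Measurable.mul _ hh
    exact Measurable.lintegral_prod_right' (f := fun p : ℝ × ℝ => gaussianPDF 0 1 (p.1 + Real.tan (p.2 / 2)))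
      (hm.comp (measurable_fst.add (htan.comp measurable_snd)))
  rw [hg, lintegral_withDensity_eq_lintegral_mul _ hm hh]
  refine lintegral_mono fun y => ?_
  rw [Pi.mul_apply, ← mul_assoc]
  gcongr
  -- On a quarter circle chosen by the sign of `y`, the shift `τ = tan (θ / 2)` satisfies `yτ ≤ 0`
  -- and `τ² ≤ 1`, so `(y + τ)² ≤ y² + 1`: the density drops by at most `exp (-1/2)`. The arc length
  -- `π / 2` and this factor give the constant of the lemma.
  have key : ∃ a : ℝ, 0 ≤ a ∧ a + Real.pi / 2 ≤ 2 * Real.pi ∧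
      ∀ θ ∈ Set.Ioc a (a + Real.pi / 2), θ ≠ 2 * Real.pi →
        y * Real.tan (θ / 2) ≤ 0 ∧ Real.tan (θ / 2) ^ 2 ≤ 1 := by
    have htb : ∀ x : ℝ, 0 ≤ x → x ≤ Real.pi / 4 → 0 ≤ Real.tan x ∧ Real.tan x ≤ 1 := by
      intro x hx0 hx1
      refine ⟨Real.tan_nonneg_of_nonneg_of_le_pi_div_two hx0 (by linarith), ?_⟩
      rw [← Real.tan_pi_div_four]
      rcases hx1.eq_or_lt with h | h
      · rw [h]
      · exact (Real.tan_lt_tan_of_lt_of_lt_pi_div_two (by linarith) (by linarith) h).le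
    rcases le_total y 0 with hy | hy
    · refine ⟨0, le_rfl, by linarith, fun θ hθ _ => ?_⟩
      obtain ⟨h1, h2⟩ := htb (θ / 2) (by linarith [hθ.1]) (by linarith [hθ.2])
      exact ⟨mul_nonpos_of_nonpos_of_nonneg hy h1, by nlinarith⟩
    · refine ⟨3 * Real.pi / 2, by linarith, by linarith, fun θ hθ _ => ?_⟩
      obtain ⟨h1, h2⟩ := htb (Real.pi - θ / 2) (by linarith [hθ.2]) (by linarith [hθ.1])
      rw [Real.tan_pi_sub] at h1 h2
      exact ⟨mul_nonpos_of_nonneg_of_nonpos hy (by linarith), by nlinarith⟩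
  obtain ⟨a, ha0, ha1, ha⟩ := key
  have hsub : Set.Ioo a (a + Real.pi / 2) ⊆ Set.Ioc 0 (2 * Real.pi) := fun θ hθ =>
    ⟨lt_of_le_of_lt ha0 hθ.1, hθ.2.le.trans ha1⟩
  calc gaussianPDF 0 1 y
      = ENNReal.ofReal (2 * Real.exp (1 / 2) / Real.pi) *
          (ENNReal.ofReal (Real.exp (-(1 / 2)) * gaussianPDFReal 0 1 y)
            * ENNReal.ofReal (Real.pi / 2)) := by
        rw [gaussianPDF, ← ENNReal.ofReal_mul, ← ENNReal.ofReal_mul]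
        · congr 1
          rw [Real.exp_neg]
          field_simp
        · positivity
        · exact mul_nonneg (Real.exp_pos _).le (gaussianPDFReal_nonneg _ _ _)
    _ = ENNReal.ofReal (2 * Real.exp (1 / 2) / Real.pi) *
          ∫⁻ θ in Set.Ioo a (a + Real.pi / 2),
            ENNReal.ofReal (Real.exp (-(1 / 2)) * gaussianPDFReal 0 1 y) := by
        rw [setLIntegral_const, Real.volume_Ioo, add_sub_cancel_left]
    _ ≤ ENNReal.ofReal (2 * Real.exp (1 / 2) / Real.pi) *
          ∫⁻ θ in Set.Ioo a (a + Real.pi / 2), gaussianPDF 0 1 (y + Real.tan (θ / 2)) := by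
        refine mul_le_mul' le_rfl (setLIntegral_mono (hm.comp (htan.const_add y)) fun θ hθ => ?_)
        obtain ⟨h1, h2⟩ := ha θ ⟨hθ.1, hθ.2.le⟩ (by linarith [hθ.2])
        rw [gaussianPDF]
        apply ENNReal.ofReal_le_ofReal
        rw [gaussianPDFReal, gaussianPDFReal, mul_left_comm, ← Real.exp_add]
        gcongr
        simp only [sub_zero, NNReal.coe_one, mul_one]
        nlinarith
    _ ≤ _ := by
        gcongr

/-- Splitting off the component of a standard Gaussian vector along a unit vector. -/
theorem lintegral_stdGaussian_eq {E : Type*} [NormedAddCommGroup E] [InnerProductSpace ℝ E]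
    [FiniteDimensional ℝ E] [MeasurableSpace E] [BorelSpace E] {v : E} (hv : ‖v‖ = 1)
    {F : E → ℝ≥0∞} (hF : Measurable F) :
    ∫⁻ x, F x ∂stdGaussian E =
      ∫⁻ x, ∫⁻ t, F ((x - inner ℝ v x • v) + t • v) ∂gaussianReal 0 1 ∂stdGaussian E := by
  have hm1 : Measurable fun x : E => x - inner ℝ v x • v := by fun_prop
  have hm2 : Measurable fun t : ℝ => t • v := by fun_prop
  have : IsProbabilityMeasure ((stdGaussian E).map fun x => x - inner ℝ v x • v) :=
    Measure.isProbabilityMeasure_map hm1.aemeasurable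
  have : IsProbabilityMeasure ((gaussianReal 0 1).map fun t => t • v) :=
    Measure.isProbabilityMeasure_map hm2.aemeasurable
  -- Equality of characteristic functions, by Pythagoras: `‖t‖² = ‖t - ⟨v, t⟩ v‖² + ⟨v, t⟩²`.
  have key : stdGaussian E = ((stdGaussian E).map fun x => x - inner ℝ v x • v)
      ∗ ((gaussianReal 0 1).map fun t => t • v) := by
    apply Measure.ext_of_charFun
    ext t
    rw [charFun_conv]
    have h1 : charFun ((stdGaussian E).map fun x => x - inner ℝ v x • v) t
        = charFun (stdGaussian E) (t - inner ℝ v t • v) := by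
      rw [charFun_apply, charFun_apply, integral_map hm1.aemeasurable (by fun_prop)]
      congr 1
      ext x
      congr 3
      rw [inner_sub_left, inner_sub_right, inner_smul_left, inner_smul_right]
      simp only [conj_trivial]
      rw [real_inner_comm v x]
      ring
    have h2 : charFun ((gaussianReal 0 1).map fun t => t • v) t
        = charFun (gaussianReal 0 1) (inner ℝ v t) := by
      rw [charFun_apply, charFun_apply_real, integral_map hm2.aemeasurable (by fun_prop)]
      congr 1
      ext x
      rw [inner_smul_left]
      simp only [conj_trivial]
      push_cast
      ring_nf
    rw [h1, h2, charFun_stdGaussian, charFun_stdGaussian, charFun_gaussianReal, ← Complex.exp_add]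
    congr 1
    have h3 : ‖t - inner ℝ v t • v‖ ^ 2 = ‖t‖ ^ 2 - (inner ℝ v t) ^ 2 := by
      rw [norm_sub_sq_real, norm_smul, inner_smul_right, hv, real_inner_comm v t]
      simp only [Real.norm_eq_abs, mul_one, sq_abs]
      ring
    have h4 : ((‖t - inner ℝ v t • v‖ : ℂ)) ^ 2 = (‖t‖ : ℂ) ^ 2 - (inner ℝ v t : ℂ) ^ 2 := by
      exact_mod_cast h3
    rw [h4]
    push_cast
    ring
  conv_lhs => rw [key]
  rw [Measure.lintegral_conv hF, lintegral_map _ hm1]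
  · refine lintegral_congr fun x => ?_
    rw [lintegral_map _ hm2]
    exact hF.comp (by fun_prop)
  · exact Measurable.lintegral_prod_right' (f := fun p : E × E => F (p.1 + p.2))
      (hF.comp measurable_add)

/-- Completing the square leaves a factor `exp (-a c² / (2b)) ≤ 1` with `b = a + 1/2`: an offset
only decreases the centred integral. -/
theorem integral_exp_neg_mul_sq_gaussianReal_le {a : ℝ} (ha : 0 ≤ a) (c : ℝ) :
    ∫ x, Real.exp (-(a * (x + c) ^ 2)) ∂gaussianReal 0 1 ≤ (1 + 2 * a) ^ (-(1 / 2) : ℝ) := by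
  rw [integral_gaussianReal_eq_integral_smul one_ne_zero]
  set b := a + 1 / 2 with hb
  have hb0 : 0 < b := by positivity
  have hint : Integrable fun x : ℝ => (√(2 * Real.pi))⁻¹ * Real.exp (-b * (x + a * c / b) ^ 2) :=
    ((integrable_exp_neg_mul_sq hb0).comp_add_right (a * c / b)).const_mul _
  calc ∫ x, gaussianPDFReal 0 1 x • Real.exp (-(a * (x + c) ^ 2))
      ≤ ∫ x, (√(2 * Real.pi))⁻¹ * Real.exp (-b * (x + a * c / b) ^ 2) := by
        apply integral_mono_of_nonneg _ hint
        · refine Eventually.of_forall fun x => ?_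
          simp only [gaussianPDFReal, sub_zero, NNReal.coe_one, mul_one, smul_eq_mul]
          rw [mul_assoc, ← Real.exp_add]
          gcongr
          have : a * (x + c) ^ 2 + x ^ 2 / 2 - b * (x + a * c / b) ^ 2 = a * c ^ 2 / (2 * b) := by
            field_simp
            rw [hb]
            ring
          have h2 : 0 ≤ a * c ^ 2 / (2 * b) := by positivity
          nlinarith
        · refine Eventually.of_forall fun x => ?_
          exact mul_nonneg (gaussianPDFReal_nonneg _ _ _) (Real.exp_pos _).le
    _ = (√(2 * Real.pi))⁻¹ * √(Real.pi / b) := by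
        rw [integral_const_mul, integral_add_right_eq_self (fun x => Real.exp (-b * x ^ 2)),
          integral_gaussian]
    _ = (1 + 2 * a) ^ (-(1 / 2) : ℝ) := by
        rw [Real.rpow_neg (by positivity), ← Real.sqrt_eq_rpow, ← Real.sqrt_inv, ← Real.sqrt_inv,
          ← Real.sqrt_mul (by positivity)]
        congr 1
        have := Real.pi_pos
        rw [hb]
        field_simp
        ring

section Laplace

set_option linter.unusedSectionVars false

variable {E F : Type*} [NormedAddCommGroup E] [InnerProductSpace ℝ E]
    [FiniteDimensional ℝ E] [MeasurableSpace E] [BorelSpace E]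
    [NormedAddCommGroup F] [InnerProductSpace ℝ F] [FiniteDimensional ℝ F]

/-- An orthonormal basis whose image under `M` is orthogonal. -/
theorem exists_orthonormalBasis_inner_map (M : E →ₗ[ℝ] F) :
    ∃ v : OrthonormalBasis (Fin (Module.finrank ℝ E)) ℝ E,
      ∀ i j, i ≠ j → inner ℝ (M (v i)) (M (v j)) = 0 := by
  have hS : (M.adjoint ∘ₗ M).IsSymmetric := M.isPositive_adjoint_comp_self.isSymmetric
  refine ⟨hS.eigenvectorBasis rfl, fun i j hij => ?_⟩
  have h1 := hS.apply_eigenvectorBasis rfl i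
  rw [← LinearMap.adjoint_inner_left, ← LinearMap.comp_apply, h1, inner_smul_left,
    (hS.eigenvectorBasis rfl).orthonormal.2 hij, mul_zero]

/-- Both sums are the trace of `M* M`. This permits checking the trace hypothesis in a coordinate
basis while computing in a diagonalizing one. -/
theorem sum_norm_sq_map_eq {m n : Type*} [Fintype m] [Fintype n] (M : E →ₗ[ℝ] F)
    (v : OrthonormalBasis m ℝ E) (w : OrthonormalBasis n ℝ E) :
    ∑ i, ‖M (v i)‖ ^ 2 = ∑ i, ‖M (w i)‖ ^ 2 := by
  have h : ∀ x : E, ‖M x‖ ^ 2 = inner ℝ x ((M.adjoint ∘ₗ M) x) := fun x => by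
    rw [LinearMap.comp_apply, LinearMap.adjoint_inner_right, real_inner_self_eq_norm_sq]
  simp only [h]
  rw [← LinearMap.trace_eq_sum_inner, ← LinearMap.trace_eq_sum_inner]

/-- The part of `m` orthogonal to all `w i` is discarded and the square is completed along each `w
i`. If `w i = 0`, the quotient is `0` and the term vanishes. -/
theorem sum_norm_sq_mul_add_sq_le {n : Type*} [Fintype n] (w : n → F)
    (hw : ∀ i j, i ≠ j → inner ℝ (w i) (w j) = 0) (m : F) (t : n → ℝ) :
    ∑ i, ‖w i‖ ^ 2 * (t i + inner ℝ (w i) m / ‖w i‖ ^ 2) ^ 2 ≤ ‖∑ i, t i • w i + m‖ ^ 2 := by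
  classical
  have hsum : ∀ s : n → ℝ, ‖∑ i, s i • w i‖ ^ 2 = ∑ i, s i ^ 2 * ‖w i‖ ^ 2 := by
    intro s
    rw [← real_inner_self_eq_norm_sq, sum_inner]
    refine Finset.sum_congr rfl fun i _ => ?_
    rw [inner_sum, Finset.sum_eq_single i]
    · rw [inner_smul_left, inner_smul_right, real_inner_self_eq_norm_sq]
      simp only [conj_trivial]; ring
    · intro j _ hj
      rw [inner_smul_left, inner_smul_right, hw i j hj.symm]; simp
    · simp
  have hin : ∀ s : n → ℝ, inner ℝ (∑ i, s i • w i) m = ∑ i, s i * inner ℝ (w i) m := by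
    intro s
    rw [sum_inner]
    simp only [inner_smul_left, conj_trivial]
  set p : n → ℝ := fun i => inner ℝ (w i) m / ‖w i‖ ^ 2 with hp
  have hpw : ∀ i, p i * ‖w i‖ ^ 2 = inner ℝ (w i) m := by
    intro i
    by_cases h : w i = 0
    · simp [h]
    · have : ‖w i‖ ^ 2 ≠ 0 := by simpa using h
      simp only [hp]; field_simp
  have h1 := sq_nonneg ‖m - ∑ i, p i • w i‖
  rw [norm_sub_sq_real, hsum, real_inner_comm, hin] at h1
  rw [norm_add_sq_real, hsum, hin]
  have h2 : ∑ i, ‖w i‖ ^ 2 * (t i + p i) ^ 2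
      = ∑ i, t i ^ 2 * ‖w i‖ ^ 2 + 2 * ∑ i, t i * inner ℝ (w i) m + ∑ i, p i ^ 2 * ‖w i‖ ^ 2 := by
    rw [Finset.mul_sum, ← Finset.sum_add_distrib, ← Finset.sum_add_distrib]
    refine Finset.sum_congr rfl fun i _ => ?_
    rw [← hpw i]; ring
  have h3 : ∑ i, p i * inner ℝ (w i) m = ∑ i, p i ^ 2 * ‖w i‖ ^ 2 := by
    refine Finset.sum_congr rfl fun i _ => ?_
    rw [← hpw i]; ring
  change ∑ i, ‖w i‖ ^ 2 * (t i + p i) ^ 2 ≤ _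
  linarith

/-- Laplace transform of a quadratic form of a Gaussian vector. -/
theorem lintegral_exp_neg_norm_sq_le (M : E →ₗ[ℝ] F) (m : F) {κ : ℝ} (hκ : 0 < κ)
    (hM : ∀ x, ‖M x‖ ^ 2 ≤ κ * ‖x‖ ^ 2) {n : Type*} [Fintype n] (b : OrthonormalBasis n ℝ E)
    (hb : 4 * κ ≤ ∑ i, ‖M (b i)‖ ^ 2) {s : ℝ} (hs : 0 ≤ s) :
    ∫⁻ x, ENNReal.ofReal (Real.exp (-(s * ‖M x + m‖ ^ 2))) ∂stdGaussian E
      ≤ ENNReal.ofReal (((1 + 2 * s * κ) ^ 2)⁻¹) := by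
  obtain ⟨v, hv⟩ := exists_orthonormalBasis_inner_map M
  have hcont : Continuous fun x => M x := M.continuous_of_finiteDimensional
  rw [stdGaussian_eq_map_pi_orthonormalBasis v, lintegral_map (Continuous.measurable (by fun_prop)).ennreal_ofReal (by fun_prop)]
  set p : Fin (Module.finrank ℝ E) → ℝ := fun i => inner ℝ (M (v i)) m / ‖M (v i)‖ ^ 2
  have h1 : ∀ x : Fin (Module.finrank ℝ E) → ℝ,
      Real.exp (-(s * ‖M (∑ i, x i • v i) + m‖ ^ 2))
        ≤ ∏ i, Real.exp (-(s * ‖M (v i)‖ ^ 2 * (x i + p i) ^ 2)) := by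
    intro x
    rw [← Real.exp_sum, Real.exp_le_exp, Finset.sum_neg_distrib, neg_le_neg_iff, map_sum]
    simp only [map_smul]
    have := sum_norm_sq_mul_add_sq_le (fun i => M (v i)) hv m x
    calc _ = s * ∑ i, ‖M (v i)‖ ^ 2 * (x i + p i) ^ 2 := by
          rw [Finset.mul_sum]; simp only [mul_assoc]
      _ ≤ _ := by gcongr
  have hint : Integrable (fun x : Fin (Module.finrank ℝ E) → ℝ =>
      ∏ i, Real.exp (-(s * ‖M (v i)‖ ^ 2 * (x i + p i) ^ 2)))
      (Measure.pi fun _ => gaussianReal 0 1) := by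
    refine Integrable.of_bound (C := 1) (Continuous.aestronglyMeasurable (by fun_prop)) (Eventually.of_forall fun x => ?_)
    rw [Real.norm_of_nonneg (Finset.prod_nonneg fun i _ => (Real.exp_pos _).le)]
    refine Finset.prod_le_one (fun i _ => (Real.exp_pos _).le) fun i _ => ?_
    rw [Real.exp_le_one_iff]
    have : 0 ≤ s * ‖M (v i)‖ ^ 2 * (x i + p i) ^ 2 := by positivity
    linarith
  refine (lintegral_mono fun x => ENNReal.ofReal_le_ofReal (h1 x)).trans ?_
  rw [← ofReal_integral_eq_lintegral_ofReal hint
    (Eventually.of_forall fun x => Finset.prod_nonneg fun i _ => (Real.exp_pos _).le)]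
  apply ENNReal.ofReal_le_ofReal
  rw [integral_fintype_prod_eq_prod (fun i t => Real.exp (-(s * ‖M (v i)‖ ^ 2 * (t + p i) ^ 2)))]
  set r : ℝ := 1 + 2 * s * κ with hr
  have hr1 : 1 ≤ r := by
    have : 0 ≤ 2 * s * κ := by positivity
    linarith
  have h2 : ∀ i, ∫ t, Real.exp (-(s * ‖M (v i)‖ ^ 2 * (t + p i) ^ 2)) ∂gaussianReal 0 1
      ≤ r ^ (-(1 / 2) * (‖M (v i)‖ ^ 2 / κ)) := by
    intro i
    refine (integral_exp_neg_mul_sq_gaussianReal_le (by positivity) (p i)).trans ?_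
    rw [mul_comm (-(1 / 2) : ℝ), Real.rpow_mul (by positivity)]
    apply Real.rpow_le_rpow_of_nonpos (by positivity) _ (by norm_num)
    have hle : ‖M (v i)‖ ^ 2 / κ ≤ 1 := by
      rw [div_le_one hκ]
      simpa [v.norm_eq_one] using hM (v i)
    -- Bernoulli's inequality `(1 + x)^p ≤ 1 + p x` for `p = ‖M (v i)‖² / κ ∈ [0, 1]` gives all
    -- factors the common base `r`, so only the trace matters.
    have := rpow_one_add_le_one_add_mul_self (s := 2 * s * κ)
      (by have : 0 ≤ 2 * s * κ := by positivity
          linarith) (p := ‖M (v i)‖ ^ 2 / κ) (by positivity) hle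
    refine this.trans (le_of_eq ?_)
    field_simp
  calc ∏ i, ∫ t, Real.exp (-(s * ‖M (v i)‖ ^ 2 * (t + p i) ^ 2)) ∂gaussianReal 0 1
      ≤ ∏ i, r ^ (-(1 / 2) * (‖M (v i)‖ ^ 2 / κ)) :=
        Finset.prod_le_prod (fun i _ => integral_nonneg fun x => (Real.exp_pos _).le)
          fun i _ => h2 i
    _ = r ^ (∑ i, -(1 / 2) * (‖M (v i)‖ ^ 2 / κ)) :=
        (Real.rpow_sum_of_pos (by positivity) _ _).symm
    -- Trace at least `4κ` makes the exponent at most `-2`, which is integrable in `s`.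
    _ ≤ r ^ (-2 : ℝ) := by
        apply Real.rpow_le_rpow_of_exponent_le hr1
        rw [← Finset.mul_sum, ← Finset.sum_div, sum_norm_sq_map_eq M v b]
        have : 4 ≤ (∑ i, ‖M (b i)‖ ^ 2) / κ := by rwa [le_div_iff₀ hκ]
        linarith
    _ = (r ^ 2)⁻¹ := by
        rw [Real.rpow_neg (by positivity)]
        norm_num

/-- The formula `1/q = ∫ exp (-s q) ds` reduces inverse moments to Laplace transforms; at `q = 0`
both sides are infinite. -/
theorem inv_ofReal_le_lintegral_exp {q : ℝ} (hq : 0 ≤ q) :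
    (ENNReal.ofReal q)⁻¹ ≤ ∫⁻ s in Set.Ioi (0 : ℝ), ENNReal.ofReal (Real.exp (-(s * q))) := by
  rcases hq.eq_or_lt with h | h
  · subst h; simp
  · rw [← ofReal_integral_eq_lintegral_ofReal]
    · rw [← ENNReal.ofReal_inv_of_pos h]
      apply ENNReal.ofReal_le_ofReal
      have h1 := integral_exp_mul_Ioi (neg_lt_zero.2 h) 0
      simp only [neg_mul, mul_zero, Real.exp_zero, neg_div_neg_eq] at h1
      simp only [mul_comm _ q, h1]
      simp
    · have := integrableOn_exp_mul_Ioi (neg_lt_zero.2 h) 0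
      simpa [mul_comm, IntegrableOn] using this
    · exact Eventually.of_forall fun x => (Real.exp_pos _).le

theorem lintegral_Ioi_inv_sq {κ : ℝ} (hκ : 0 < κ) :
    ∫⁻ s in Set.Ioi (0 : ℝ), ENNReal.ofReal (((1 + 2 * s * κ) ^ 2)⁻¹)
      = ENNReal.ofReal (1 / (2 * κ)) := by
  have hd : ∀ x ∈ Set.Ici (0 : ℝ), HasDerivAt (fun s : ℝ => -(1 / (2 * κ)) * (1 + 2 * s * κ)⁻¹)
      (((1 + 2 * x * κ) ^ 2)⁻¹) x := by
    intro x hx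
    have hx0 : 0 ≤ x := hx
    have hpos : 1 + 2 * x * κ ≠ 0 := by positivity
    have h1 : HasDerivAt (fun s : ℝ => 1 + 2 * s * κ) (2 * κ) x := by
      have := ((hasDerivAt_id x).const_mul 2).mul_const κ |>.const_add 1
      simpa using this
    refine ((h1.inv hpos).const_mul (-(1 / (2 * κ)))).congr_deriv ?_
    field_simp
  have hn : ∀ x ∈ Set.Ioi (0 : ℝ), 0 ≤ ((1 + 2 * x * κ) ^ 2)⁻¹ := fun x _ => by positivity
  have hlim : Tendsto (fun s : ℝ => -(1 / (2 * κ)) * (1 + 2 * s * κ)⁻¹) atTop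
      (𝓝 (-(1 / (2 * κ)) * 0)) := by
    apply Tendsto.const_mul
    apply tendsto_inv_atTop_zero.comp
    apply tendsto_atTop_add_const_left
    exact (tendsto_id.const_mul_atTop (by norm_num : (0 : ℝ) < 2)).atTop_mul_const hκ
  have hI := integrableOn_Ioi_deriv_of_nonneg' hd hn hlim
  rw [← ofReal_integral_eq_lintegral_ofReal hI
    (Eventually.of_forall fun x => by positivity),
    integral_Ioi_of_hasDerivAt_of_nonneg' hd hn hlim]
  simp

/-- The inverse of a quadratic form of a Gaussian vector has bounded mean once its trace is at
least four times its norm. -/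
theorem lintegral_inv_norm_sq_le (M : E →ₗ[ℝ] F) (m : F) {κ : ℝ} (hκ : 0 < κ)
    (hM : ∀ x, ‖M x‖ ^ 2 ≤ κ * ‖x‖ ^ 2) {n : Type*} [Fintype n] (b : OrthonormalBasis n ℝ E)
    (hb : 4 * κ ≤ ∑ i, ‖M (b i)‖ ^ 2) :
    ∫⁻ x, (ENNReal.ofReal (‖M x + m‖ ^ 2))⁻¹ ∂stdGaussian E ≤ ENNReal.ofReal (1 / (2 * κ)) := by
  have hcont : Continuous fun x => M x := M.continuous_of_finiteDimensional
  calc ∫⁻ x, (ENNReal.ofReal (‖M x + m‖ ^ 2))⁻¹ ∂stdGaussian E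
      ≤ ∫⁻ x, (∫⁻ s in Set.Ioi (0 : ℝ), ENNReal.ofReal (Real.exp (-(s * ‖M x + m‖ ^ 2))))
          ∂stdGaussian E := lintegral_mono fun x => inv_ofReal_le_lintegral_exp (by positivity)
    _ = ∫⁻ s in Set.Ioi (0 : ℝ), (∫⁻ x, ENNReal.ofReal (Real.exp (-(s * ‖M x + m‖ ^ 2)))
          ∂stdGaussian E) := by
        apply lintegral_lintegral_swap
        exact (Continuous.measurable (by fun_prop :
          Continuous fun p : E × ℝ => Real.exp (-(p.2 * ‖M p.1 + m‖ ^ 2)))).ennreal_ofReal.aemeasurable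
    _ ≤ ∫⁻ s in Set.Ioi (0 : ℝ), ENNReal.ofReal (((1 + 2 * s * κ) ^ 2)⁻¹) := by
        apply setLIntegral_mono (by fun_prop)
        intro s hs
        exact lintegral_exp_neg_norm_sq_le M m hκ hM b hb (le_of_lt hs)
    _ = ENNReal.ofReal (1 / (2 * κ)) := lintegral_Ioi_inv_sq hκ

end Laplace

end Gaussian

end BandMatrix

end

noncomputable section

namespace BandMatrix

/-! ### Splitting real Gaussian components off the entries -/

section EntryLaw

instance isProbabilityMeasure_entryLaw (σ : SymmetryClass) (v : ℝ≥0) :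
    IsProbabilityMeasure (entryLaw σ v) := by
  cases σ with
  | orthogonal => exact Measure.isProbabilityMeasure_map (by fun_prop)
  | unitary =>
    refine Measure.isProbabilityMeasure_map (Measurable.aemeasurable ?_)
    exact Complex.measurableEquivRealProd.symm.measurable

/-- A real Gaussian component can be split off from the law of an entry. -/
theorem exists_entryLaw_eq_conv (σ : SymmetryClass) (v : ℝ≥0) (c : ℝ≥0) (hc : c ^ 2 ≤ v / 2) :
    ∃ ν : Measure ℂ, IsProbabilityMeasure ν ∧
      entryLaw σ v = ((gaussianReal 0 1).map fun t : ℝ => ((c * t : ℝ) : ℂ)) ∗ ν := by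
  have hm1 : Measurable fun t : ℝ => (t : ℂ) := by fun_prop
  have hscale : ((gaussianReal 0 1).map fun t : ℝ => ((c * t : ℝ) : ℂ))
      = (gaussianReal 0 (c ^ 2)).map fun t : ℝ => (t : ℂ) := by
    have h1 : (gaussianReal 0 1).map (fun t : ℝ => (c : ℝ) * t) = gaussianReal 0 (c ^ 2) := by
      rw [gaussianReal_map_const_mul]
      congr 1
      · simp
      · ext; simp
    rw [← h1, Measure.map_map hm1 (by fun_prop)]
    rfl
  have hcv : c ^ 2 ≤ v := hc.trans (half_le_self zero_le)
  rw [hscale]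
  cases σ with
  | orthogonal =>
    refine ⟨(gaussianReal 0 (v - c ^ 2)).map fun t : ℝ => (t : ℂ),
      Measure.isProbabilityMeasure_map hm1.aemeasurable, ?_⟩
    have := Measure.map_conv_addMonoidHom (μ := gaussianReal 0 (c ^ 2))
      (ν := gaussianReal 0 (v - c ^ 2)) (Complex.ofRealHom : ℝ →+ ℂ) hm1
    rw [gaussianReal_conv_gaussianReal, add_tsub_cancel_of_le hcv, add_zero] at this
    exact this
  | unitary =>
    have hm2 : Measurable fun p : ℝ × ℝ => (⟨p.1, p.2⟩ : ℂ) :=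
      Complex.measurableEquivRealProd.symm.measurable
    have hm4 : Measurable fun q : (ℝ × ℝ) × ℝ => (⟨q.1.1 + q.2, q.1.2⟩ : ℂ) :=
      hm2.comp (g := fun p : ℝ × ℝ => (⟨p.1, p.2⟩ : ℂ))
        (f := fun q : (ℝ × ℝ) × ℝ => (q.1.1 + q.2, q.1.2)) (by fun_prop)
    refine ⟨((gaussianReal 0 (v / 2 - c ^ 2)).prod (gaussianReal 0 (v / 2))).map
      (fun p : ℝ × ℝ => (⟨p.1, p.2⟩ : ℂ)),
      Measure.isProbabilityMeasure_map hm2.aemeasurable, ?_⟩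
    have hp : IsProbabilityMeasure (((gaussianReal 0 (v / 2 - c ^ 2)).prod
        (gaussianReal 0 (v / 2))).map (fun p : ℝ × ℝ => (⟨p.1, p.2⟩ : ℂ))) :=
      Measure.isProbabilityMeasure_map hm2.aemeasurable
    refine Measure.ext_of_lintegral _ fun f hf => ?_
    -- Only the real part, of variance `v / 2`, is decomposed; hence the hypothesis `c² ≤ v / 2`,
    -- which suits both symmetry classes.
    have hgauss : gaussianReal 0 (v / 2)
        = gaussianReal 0 (c ^ 2) ∗ gaussianReal 0 (v / 2 - c ^ 2) := by
      rw [gaussianReal_conv_gaussianReal, add_tsub_cancel_of_le hc, add_zero]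
    rw [entryLaw, lintegral_map hf hm2,
      lintegral_prod_symm (fun p : ℝ × ℝ => f ⟨p.1, p.2⟩) (hf.comp hm2).aemeasurable]
    rw [Measure.lintegral_conv hf, lintegral_map _ hm1]
    · have h1 : ∀ x : ℝ, ∫⁻ y, f ((x : ℂ) + y) ∂(((gaussianReal 0 (v / 2 - c ^ 2)).prod
          (gaussianReal 0 (v / 2))).map (fun p : ℝ × ℝ => (⟨p.1, p.2⟩ : ℂ)))
          = ∫⁻ y, ∫⁻ z, f ⟨x + z, y⟩ ∂gaussianReal 0 (v / 2 - c ^ 2) ∂gaussianReal 0 (v / 2) := by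
        intro x
        have hf' : Measurable fun y : ℂ => f ((x : ℂ) + y) := hf.comp (measurable_const_add _)
        rw [lintegral_map hf' hm2,
          lintegral_prod_symm (fun p : ℝ × ℝ => f ((x : ℂ) + (⟨p.1, p.2⟩ : ℂ)))
            (hf'.comp hm2).aemeasurable]
        refine lintegral_congr fun y => lintegral_congr fun z => ?_
        congr 1
        apply Complex.ext <;> simp
      simp only [h1]
      conv_rhs => rw [lintegral_lintegral_swap (Measurable.lintegral_prod_right'
        (f := fun p : (ℝ × ℝ) × ℝ => f ⟨p.1.1 + p.2, p.1.2⟩) (hf.comp hm4)).aemeasurable]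
      refine lintegral_congr fun y => ?_
      conv_lhs => rw [hgauss]
      rw [Measure.lintegral_conv (f := fun x => f ⟨x, y⟩)
        (hf.comp (hm2.comp (measurable_id.prodMk measurable_const)))]
    · exact Measurable.lintegral_prod_right' (f := fun p : ℂ × ℂ => f (p.1 + p.2))
        (hf.comp measurable_add)

variable {K : Type*} [Fintype K]

/-- Splitting off independent real Gaussian components from a product measure. -/
theorem lintegral_pi_eq_gaussian (μ ν : K → Measure ℂ) [∀ p, IsProbabilityMeasure (μ p)]
    [∀ p, IsProbabilityMeasure (ν p)] (c : K → ℝ)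
    (h : ∀ p, μ p = ((gaussianReal 0 1).map fun t : ℝ => ((c p * t : ℝ) : ℂ)) ∗ ν p)
    {F : (K → ℂ) → ℝ≥0∞} (hF : Measurable F) :
    ∫⁻ Z, F Z ∂Measure.pi μ = ∫⁻ Z, ∫⁻ g, F (fun p => ((c p * g p : ℝ) : ℂ) + Z p)
      ∂stdGaussian (EuclideanSpace ℝ K) ∂Measure.pi ν := by
  have hm : ∀ p, Measurable fun q : ℝ × ℂ => ((c p * q.1 : ℝ) : ℂ) + q.2 := fun p => by fun_prop
  have hμ : ∀ p, μ p = ((gaussianReal 0 1).prod (ν p)).map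
      fun q : ℝ × ℂ => ((c p * q.1 : ℝ) : ℂ) + q.2 := by
    intro p
    have hmt : Measurable fun t : ℝ => ((c p * t : ℝ) : ℂ) := by fun_prop
    refine Measure.ext_of_lintegral _ fun f hf => ?_
    rw [h p, Measure.lintegral_conv hf, lintegral_map _ hmt, lintegral_map hf (hm p),
      lintegral_prod (fun q : ℝ × ℂ => f (((c p * q.1 : ℝ) : ℂ) + q.2))
        (hf.comp (hm p)).aemeasurable]
    · exact Measurable.lintegral_prod_right' (f := fun p : ℂ × ℂ => f (p.1 + p.2))
        (hf.comp measurable_add)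
  have hsf : ∀ p, SigmaFinite (((gaussianReal 0 1).prod (ν p)).map
      fun q : ℝ × ℂ => ((c p * q.1 : ℝ) : ℂ) + q.2) := fun p => by
    rw [← hμ p]; infer_instance
  have hpi : Measure.pi μ = ((Measure.pi fun _ : K => gaussianReal 0 1).prod (Measure.pi ν)).map
      fun q p => ((c p * q.1 p : ℝ) : ℂ) + q.2 p := by
    have h1 := (measurePreserving_arrowProdEquivProdArrow ℝ ℂ K
      (fun _ => gaussianReal 0 1) ν).map_eq
    rw [← h1, Measure.map_map (by fun_prop) (MeasurableEquiv.measurable _)]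
    have h2 := Measure.pi_map_pi (μ := fun p => (gaussianReal 0 1).prod (ν p))
      (f := fun p (q : ℝ × ℂ) => ((c p * q.1 : ℝ) : ℂ) + q.2) (fun p => (hm p).aemeasurable)
    rw [funext hμ, ← h2]
    rfl
  have hmF : Measurable fun q : (K → ℝ) × (K → ℂ) =>
      F fun p => ((c p * q.1 p : ℝ) : ℂ) + q.2 p := hF.comp (by fun_prop)
  rw [hpi, lintegral_map hF (by fun_prop), lintegral_prod_symm _ hmF.aemeasurable]
  refine lintegral_congr fun Z => ?_
  rw [← map_pi_eq_stdGaussian, lintegral_map]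
  · exact hF.comp (by fun_prop)
  · fun_prop

/-- The joint law of a subfamily of independent coordinates. -/
theorem pi_map_comp_injective {J : Type*} [Fintype J] {α : Type*} [MeasurableSpace α]
    (μ : K → Measure α) [∀ p, IsProbabilityMeasure (μ p)] {e : J → K} (he : e.Injective) :
    (Measure.pi μ).map (fun x j => x (e j)) = Measure.pi fun j => μ (e j) := by
  have h1 : iIndepFun (fun j (x : K → α) => x (e j)) (Measure.pi μ) :=
    (iIndepFun_pi (μ := μ) (X := fun _ => id) fun _ => aemeasurable_id).precomp he
  rw [iIndepFun_iff_map_fun_eq_pi_map (fun j => (measurable_pi_apply _).aemeasurable)] at h1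
  refine h1.trans ?_
  congr 1
  ext1 j
  exact (measurePreserving_eval μ (e j)).map_eq

end EntryLaw

end BandMatrix

end

noncomputable section

namespace BandMatrix

/-! ### The estimate for one block -/

section Wegner

set_option linter.unusedSectionVars false

open Matrix

variable {ι : Type*} [Fintype ι] [DecidableEq ι]

theorem measurable_det {α : Type*} [MeasurableSpace α] {A : α → Matrix ι ι ℂ}
    (hA : ∀ i j, Measurable fun a => A a i j) : Measurable fun a => (A a).det := by
  simp only [det_apply]
  refine Finset.measurable_sum _ fun s _ => Measurable.const_smul ?_ _
  exact Finset.measurable_prod _ fun i _ => hA _ _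

theorem measurable_inv_apply {α : Type*} [MeasurableSpace α] {A : α → Matrix ι ι ℂ}
    (hA : ∀ i j, Measurable fun a => A a i j) (i j : ι) : Measurable fun a => (A a)⁻¹ i j := by
  have : (fun a => (A a)⁻¹ i j) = fun a => (A a).det⁻¹ * (A a).adjugate i j := by
    ext a
    rw [inv_def, Ring.inverse_eq_inv', Matrix.smul_apply, smul_eq_mul]
  rw [this]
  refine (measurable_det hA).inv.mul ?_
  simp only [adjugate_apply]
  apply measurable_det
  intro k l
  by_cases hk : k = j
  · subst hk; simp
  · simp [updateRow_ne hk, hA]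

/-- The matrix `(X + X*) / √2 - E`, as a function of the family of entries of `X`. -/
def shiftedH (E : ℝ) (Z : ι × ι → ℂ) : Matrix ι ι ℂ :=
  hermitize (of fun x y => Z (x, y)) - diagonal fun _ => (E : ℂ)

theorem shiftedH_apply (E : ℝ) (Z : ι × ι → ℂ) (x y : ι) :
    shiftedH E Z x y = (1 / √2 : ℝ) * (Z (x, y) + star (Z (y, x)))
      - if x = y then (E : ℂ) else 0 := by
  simp only [shiftedH, hermitize, Matrix.sub_apply, Matrix.smul_apply, Matrix.add_apply,
    conjTranspose_apply, of_apply, diagonal_apply, Complex.real_smul]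

theorem shiftedH_isHermitian (E : ℝ) (Z : ι × ι → ℂ) : (shiftedH E Z).IsHermitian := by
  refine (hermitize_isHermitian _).sub (isHermitian_diagonal_of_self_adjoint _ ?_)
  ext j; simp

theorem measurable_shiftedH (E : ℝ) (x y : ι) : Measurable fun Z : ι × ι → ℂ => shiftedH E Z x y := by
  simp only [shiftedH_apply, Complex.star_def]
  have : Measurable fun Z : ι × ι → ℂ => (starRingEnd ℂ) (Z (y, x)) :=
    Complex.continuous_conj.measurable.comp (measurable_pi_apply _)
  fun_prop

theorem measurable_dissip_inv (E : ℝ) (γ : ι → ℝ) (i j : ι) :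
    Measurable fun Z : ι × ι → ℂ => (dissip (shiftedH E Z) γ)⁻¹ i j :=
  measurable_inv_apply (fun k l => (measurable_shiftedH E k l).sub_const _) i j

theorem measurable_dissip_decouple_inv (E : ℝ) (γ : ι → ℝ) (k i j : ι) :
    Measurable fun Z : ι × ι → ℂ => (dissip (decouple k (shiftedH E Z)) γ)⁻¹ i j := by
  refine measurable_inv_apply (fun a b => Measurable.sub_const ?_ _) i j
  simp only [decouple, of_apply]
  split_ifs
  · exact measurable_shiftedH E a b
  · exact measurable_const

/-- A real diagonal entry is doubled by adding the adjoint and then divided by `√2`, whence the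
factor `√2`. -/
theorem shiftedH_add_diag (E : ℝ) (Z : ι × ι → ℂ) (d : ι × ι → ℝ)
    (hd : ∀ p : ι × ι, p.1 ≠ p.2 → d p = 0) :
    shiftedH E (fun p => (d p : ℂ) + Z p)
      = shiftedH E Z + diagonal fun j => ((√2 * d (j, j) : ℝ) : ℂ) := by
  ext x y
  rw [Matrix.add_apply, shiftedH_apply, shiftedH_apply]
  by_cases h : x = y
  · subst h
    have h2 : (√2 : ℝ) = 2 * (1 / √2) := by
      field_simp
      norm_num
    have h3 : ((√2 : ℝ) : ℂ) = 2 * ((1 / √2 : ℝ) : ℂ) := by exact_mod_cast congrArg (fun r : ℝ => (r : ℂ)) h2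
    simp only [diagonal_apply_eq, star_add, Complex.star_def, Complex.conj_ofReal,
      Complex.ofReal_mul, h3]
    ring
  · simp [diagonal_apply_ne _ h, hd (x, y) h, hd (y, x) (Ne.symm h)]

/-- The standard deviation `(2n)^(-1/2)` at the positions of `S`, zero elsewhere. -/
def gaussCoeff (n : ℕ) (S : Finset (ι × ι)) (p : ι × ι) : ℝ :=
  if p ∈ S then √(1 / (2 * n)) else 0

/-- Splitting off Gaussian components of variance `1 / (2n)` in a set of positions. -/
theorem exists_lintegral_pi_entryLaw (σ : SymmetryClass) (v : ι × ι → ℝ≥0) {n : ℕ}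
    (S : Finset (ι × ι)) (hS : ∀ p ∈ S, 1 / (n : ℝ≥0) ≤ v p) :
    ∃ ν : ι × ι → Measure ℂ, (∀ p, IsProbabilityMeasure (ν p)) ∧
      ∀ F : (ι × ι → ℂ) → ℝ≥0∞, Measurable F →
        ∫⁻ Z, F Z ∂Measure.pi (fun p => entryLaw σ (v p)) =
          ∫⁻ Z, ∫⁻ g, F (fun p => ((gaussCoeff n S p * g p : ℝ) : ℂ) + Z p)
            ∂stdGaussian (EuclideanSpace ℝ (ι × ι)) ∂Measure.pi ν := by
  have h : ∀ p, ∃ ν : Measure ℂ, IsProbabilityMeasure ν ∧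
      entryLaw σ (v p) = ((gaussianReal 0 1).map fun t : ℝ =>
        ((gaussCoeff n S p * t : ℝ) : ℂ)) ∗ ν := by
    intro p
    -- The removed variance `1 / (2n)` is at most half of an entry variance `≥ 1 / n`.
    obtain ⟨ν, h1, h2⟩ := exists_entryLaw_eq_conv σ (v p)
      (if p ∈ S then NNReal.sqrt (1 / (2 * n)) else 0) (by
        split_ifs with hp
        · rw [NNReal.sq_sqrt]
          refine le_trans (le_of_eq ?_) (div_le_div_of_nonneg_right (hS p hp) zero_le)
          rw [div_div, mul_comm]
        · simp)
    refine ⟨ν, h1, ?_⟩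
    rw [h2]
    congr 3
    ext t
    unfold gaussCoeff
    split_ifs <;> simp
  choose ν hν1 hν2 using h
  exact ⟨ν, hν1, fun F hF => lintegral_pi_eq_gaussian _ ν _ hν2 hF⟩

variable (σ : SymmetryClass) (v : ι × ι → ℝ≥0) {B : Finset ι}

/-- The random shift of a diagonal block regularizes the resolvent at scale `1 / |B|`. -/
theorem lintegral_sum_im_inv_le_regularized (hB : B.Nonempty)
    (hv : ∀ x ∈ B, ∀ y ∈ B, 1 / (B.card : ℝ≥0) ≤ v (x, y)) (E : ℝ) {ε : ℝ} (hε : 0 < ε) :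
    ∫⁻ Z, ENNReal.ofReal (∑ i ∈ B, ((dissip (shiftedH E Z) fun _ => ε)⁻¹ i i).im)
        ∂Measure.pi (fun p => entryLaw σ (v p)) ≤
      ENNReal.ofReal (2 * Real.exp (1 / 2) / Real.pi) * ∫⁻ Z, ENNReal.ofReal (2 * Real.pi *
        ∑ i ∈ B, ((dissip (shiftedH E Z) fun j => ε + 1 / B.card * blockInd B j)⁻¹ i i).im)
        ∂Measure.pi (fun p => entryLaw σ (v p)) := by
  have hn : 0 < (B.card : ℝ) := by exact_mod_cast hB.card_pos
  set S : Finset (ι × ι) := B.map ⟨fun i => (i, i), fun i j h => (Prod.mk.inj h).1⟩ with hSdef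
  have hSmem : ∀ x y, (x, y) ∈ S ↔ x ∈ B ∧ x = y := by
    intro x y
    simp only [hSdef, Finset.mem_map]
    constructor
    · rintro ⟨a, ha, h⟩; cases h; exact ⟨ha, rfl⟩
    · rintro ⟨hx, rfl⟩; exact ⟨x, hx, rfl⟩
  obtain ⟨ν, hν, hint⟩ := exists_lintegral_pi_entryLaw σ v (n := B.card) S (by
    rintro ⟨x, y⟩ hp
    obtain ⟨h1, rfl⟩ := (hSmem x y).1 hp
    exact hv x h1 x h1)
  set c : ι × ι → ℝ := gaussCoeff B.card S with hc
  set F : (ι × ι → ℂ) → ℝ≥0∞ := fun Z =>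
    ENNReal.ofReal (∑ i ∈ B, ((dissip (shiftedH E Z) fun _ => ε)⁻¹ i i).im) with hF
  set F' : (ι × ι → ℂ) → ℝ≥0∞ := fun Z => ENNReal.ofReal (2 * Real.pi *
        ∑ i ∈ B, ((dissip (shiftedH E Z) fun j => ε + 1 / B.card * blockInd B j)⁻¹ i i).im) with hF'
  have hFm : Measurable F := by
    refine Measurable.ennreal_ofReal (Finset.measurable_sum _ fun i _ => ?_)
    exact Complex.measurable_im.comp (measurable_dissip_inv _ _ _ _)
  have hFm' : Measurable F' := by
    refine Measurable.ennreal_ofReal (Measurable.const_mul (Finset.measurable_sum _ fun i _ => ?_) _)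
    exact Complex.measurable_im.comp (measurable_dissip_inv _ _ _ _)
  rw [hint F hFm, hint F' hFm']
  -- The unit vector constant on the diagonal of `B`: moving along it shifts the matrix by a
  -- multiple of the identity on `B`.
  set w : EuclideanSpace ℝ (ι × ι) := WithLp.toLp 2 fun p => if p ∈ S then 1 / √B.card else 0
    with hw
  have hwnorm : ‖w‖ = 1 := by
    have : ‖w‖ ^ 2 = 1 := by
      have h1 : ∀ p, ‖w p‖ ^ 2 = if p ∈ S then 1 / (B.card : ℝ) else 0 := by
        intro p
        simp only [hw]
        split_ifs
        · rw [Real.norm_eq_abs, sq_abs, div_pow, Real.sq_sqrt hn.le, one_pow]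
        · simp
      rw [EuclideanSpace.norm_sq_eq, Finset.sum_congr rfl fun p _ => h1 p, Finset.sum_ite_mem,
        Finset.univ_inter, Finset.sum_const, hSdef, Finset.card_map, nsmul_eq_mul]
      field_simp
    exact (pow_eq_one_iff_of_nonneg (norm_nonneg w) two_ne_zero).1 this
  have hmeas : ∀ Z : ι × ι → ℂ, Measurable fun g : EuclideanSpace ℝ (ι × ι) =>
      (fun p => ((c p * g p : ℝ) : ℂ) + Z p : ι × ι → ℂ) := by
    intro Z
    fun_prop
  have hFZ : ∀ Z : ι × ι → ℂ, Measurable fun g : EuclideanSpace ℝ (ι × ι) =>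
      F fun p => ((c p * g p : ℝ) : ℂ) + Z p := fun Z => hFm.comp (hmeas Z)
  have hFZ' : ∀ Z : ι × ι → ℂ, Measurable fun g : EuclideanSpace ℝ (ι × ι) =>
      F' fun p => ((c p * g p : ℝ) : ℂ) + Z p := fun Z => hFm'.comp (hmeas Z)
  rw [← lintegral_const_mul]
  swap
  · have : Measurable fun q : (ι × ι → ℂ) × EuclideanSpace ℝ (ι × ι) =>
        (fun p => ((c p * q.2 p : ℝ) : ℂ) + q.1 p : ι × ι → ℂ) := by fun_prop
    exact Measurable.lintegral_prod_right'
      (f := fun q : (ι × ι → ℂ) × EuclideanSpace ℝ (ι × ι) =>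
        F' fun p => ((c p * q.2 p : ℝ) : ℂ) + q.1 p) (hFm'.comp this)
  refine lintegral_mono fun Z => ?_
  rw [lintegral_stdGaussian_eq hwnorm (hFZ Z), lintegral_stdGaussian_eq hwnorm (hFZ' Z), ← lintegral_const_mul]
  swap
  · have h1 : Measurable fun q : EuclideanSpace ℝ (ι × ι) × ℝ =>
        (q.1 - inner ℝ w q.1 • w) + q.2 • w := by fun_prop
    have h2 := (hFZ' Z).comp h1
    exact h2.lintegral_prod_right'
  refine lintegral_mono fun x => ?_
  set x' := x - inner ℝ w x • w
  refine (lintegral_gaussianReal_le_shift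
    (h := fun t => F fun p => ((c p * (x' + t • w) p : ℝ) : ℂ) + Z p)
    ((hFZ Z).comp (by fun_prop : Measurable fun t : ℝ => x' + t • w))).trans ?_
  refine mul_le_mul' le_rfl (lintegral_mono fun t => ?_)
  have hkey : ∀ θ : ℝ, shiftedH E (fun p => ((c p * (x' + (t - Real.tan (θ / 2)) • w) p : ℝ) : ℂ) + Z p)
      = shiftedH E (fun p => ((c p * (x' + t • w) p : ℝ) : ℂ) + Z p)
        + diagonal fun j => ((-Real.tan (θ / 2) * (1 / B.card * blockInd B j) : ℝ) : ℂ) := by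
    intro θ
    have h1 : (fun p => ((c p * (x' + (t - Real.tan (θ / 2)) • w) p : ℝ) : ℂ) + Z p)
        = fun p => ((c p * (-Real.tan (θ / 2) * w p) : ℝ) : ℂ)
          + (((c p * (x' + t • w) p : ℝ) : ℂ) + Z p) := by
      ext p
      simp only [PiLp.add_apply, PiLp.smul_apply, smul_eq_mul]
      push_cast
      ring
    rw [h1, shiftedH_add_diag]
    · congr 2
      ext j
      congr 1
      simp only [hc, gaussCoeff, hw, hSmem, and_true, blockInd]
      split_ifs with hj
      -- Diagonal factor, standard deviation and normalization of `w` combine to the regularization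
      -- scale `1 / n`.
      · have : √2 * (√(1 / (2 * B.card)) * (1 / √B.card)) = 1 / (B.card : ℝ) := by
          rw [Real.sqrt_div zero_le_one, Real.sqrt_one, Real.sqrt_mul zero_le_two]
          have h5 := Real.sq_sqrt hn.le
          have h6 : √(B.card : ℝ) ≠ 0 := (Real.sqrt_pos.2 hn).ne'
          field_simp
          rw [h5]
        linear_combination (-Real.tan (θ / 2)) * this
      · simp
    · rintro ⟨a, b⟩ hab
      have : (a, b) ∉ S := fun h => hab ((hSmem a b).1 h).2
      simp [hc, gaussCoeff, this]
  simp only [hF, hkey]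
  exact lintegral_im_inv_shift_le (shiftedH_isHermitian _ _) hε (by positivity) B

/-- Averaging over the `i`-th column: the diagonal entry of the resolvent is bounded in mean when
the resolvent of the decoupled matrix has a large trace over the block. -/
theorem lintegral_im_inv_of_decouple_large {i : ι} (hi : i ∈ B)
    (hv : ∀ x ∈ B, ∀ y ∈ B, 1 / (B.card : ℝ≥0) ≤ v (x, y)) (E : ℝ) {γ : ι → ℝ} (hγ : ∀ j, 0 < γ j)
    (hγB : ∀ j ∈ B, 1 / (B.card : ℝ) ≤ γ j) :
    ∫⁻ Z, (if 4 * (B.card : ℝ) ≤ ∑ j ∈ B.erase i, ((dissip (decouple i (shiftedH E Z)) γ)⁻¹ j j).im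
        then ENNReal.ofReal ((dissip (shiftedH E Z) γ)⁻¹ i i).im else 0)
      ∂Measure.pi (fun p => entryLaw σ (v p)) ≤ 2 := by
  have hn : 0 < (B.card : ℝ) := by exact_mod_cast Finset.card_pos.2 ⟨i, hi⟩
  -- Only the entries `X (j, i)` are randomized; the transposed entries `X (i, j)` stay fixed and go
  -- into the offset `m`.
  set S : Finset (ι × ι) := (B.erase i).map ⟨fun j => (j, i), fun j k h => (Prod.mk.inj h).1⟩
    with hSdef
  have hSmem : ∀ x y, (x, y) ∈ S ↔ x ∈ B.erase i ∧ y = i := by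
    intro x y
    simp only [hSdef, Finset.mem_map]
    constructor
    · rintro ⟨a, ha, h⟩; cases h; exact ⟨ha, rfl⟩
    · rintro ⟨hx, rfl⟩; exact ⟨x, hx, rfl⟩
  obtain ⟨ν, hν, hint⟩ := exists_lintegral_pi_entryLaw σ v (n := B.card) S (by
    rintro ⟨x, y⟩ hp
    obtain ⟨h1, rfl⟩ := (hSmem x y).1 hp
    exact hv x (Finset.mem_of_mem_erase h1) y hi)
  have hFm : Measurable fun Z : ι × ι → ℂ =>
      if 4 * (B.card : ℝ) ≤ ∑ j ∈ B.erase i, ((dissip (decouple i (shiftedH E Z)) γ)⁻¹ j j).im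
        then ENNReal.ofReal ((dissip (shiftedH E Z) γ)⁻¹ i i).im else 0 := by
    refine Measurable.ite (measurableSet_le measurable_const
      (Finset.measurable_sum _ fun j _ => ?_)) ?_ measurable_const
    · exact Complex.measurable_im.comp (measurable_dissip_decouple_inv _ _ _ _ _)
    · exact (Complex.measurable_im.comp (measurable_dissip_inv _ _ _ _)).ennreal_ofReal
  rw [hint _ hFm]
  refine (lintegral_mono (g := fun _ => 2) fun Z => ?_).trans_eq (by simp)
  set c : ι × ι → ℝ := gaussCoeff B.card S with hc
  -- Standard deviation in the Hermitian matrix: variance `1 / (2n)`, halved by the factor `1 / √2`.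
  set a : ι → ℝ := fun j => if j ∈ B.erase i then √(1 / (4 * B.card)) else 0 with ha
  have hapos : ∀ j, a j ^ 2 ≤ 1 / (4 * B.card) := by
    intro j
    simp only [ha]
    split_ifs
    · rw [Real.sq_sqrt (by positivity)]
    · simp
  -- The decoupled matrix, and with it the condition in the `if`, does not depend on the Gaussian
  -- vector averaged over.
  have hdec : ∀ g : EuclideanSpace ℝ (ι × ι),
      decouple i (shiftedH E fun p => ((c p * g p : ℝ) : ℂ) + Z p) = decouple i (shiftedH E Z) := by
    intro g
    ext x y
    simp only [decouple, of_apply]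
    split_ifs with h
    · have h1 : ∀ p : ι × ι, (p.1 = i ↔ p.2 = i) → c p = 0 := by
        rintro ⟨x, y⟩ hxy
        have : (x, y) ∉ S := by
          rw [hSmem]
          rintro ⟨h2, h3⟩
          exact Finset.ne_of_mem_erase h2 (hxy.2 h3)
        simp [hc, gaussCoeff, this]
      rw [shiftedH_apply, shiftedH_apply, h1 (x, y) h, h1 (y, x) h.symm]
      simp
    · rfl
  have hoff : ∀ g : EuclideanSpace ℝ (ι × ι),
      offCol i (shiftedH E fun p => ((c p * g p : ℝ) : ℂ) + Z p)
        = (fun j => ((a j * g (j, i) : ℝ) : ℂ)) + offCol i (shiftedH E Z) := by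
    intro g
    ext j
    simp only [offCol, Pi.add_apply]
    by_cases hj : j = i
    · subst hj; simp [ha]
    · have h1 : c (i, j) = 0 := by
        have : (i, j) ∉ S := by rw [hSmem]; simp
        simp [hc, gaussCoeff, this]
      have h2 : (1 / √2) * c (j, i) = a j := by
        simp only [hc, gaussCoeff, ha, hSmem, and_true]
        split_ifs
        · rw [show (1 : ℝ) / (4 * B.card) = 1 / 2 * (1 / (2 * B.card)) by ring,
            Real.sqrt_mul (by norm_num), Real.sqrt_div zero_le_one 2, Real.sqrt_one]
        · simp
      rw [if_neg hj, if_neg hj, shiftedH_apply, shiftedH_apply, if_neg hj, h1, ← h2]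
      push_cast
      simp only [zero_mul, zero_add]
      ring
  simp only [hdec]
  split_ifs with hlarge
  swap
  · simp
  set R := (dissip (decouple i (shiftedH E Z)) γ)⁻¹ with hR
  have hDH := decouple_isHermitian i (shiftedH_isHermitian E Z)
  -- The weights `√γ` make `‖M g + m‖²` equal to `∑ γ |R φ|²`, the imaginary part of the form in
  -- Schur's formula.
  let M : EuclideanSpace ℝ (ι × ι) →ₗ[ℝ] EuclideanSpace ℂ ι :=
    { toFun := fun g => WithLp.toLp 2 fun k => (√(γ k) : ℂ) * (R *ᵥ fun j => ((a j * g (j, i) : ℝ) : ℂ)) k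
      map_add' := by
        intro g h
        ext k
        simp only [PiLp.add_apply, mulVec, dotProduct]
        rw [← mul_add, ← Finset.sum_add_distrib]
        congr 1
        refine Finset.sum_congr rfl fun j _ => ?_
        push_cast
        ring
      map_smul' := by
        intro t g
        ext k
        simp only [PiLp.smul_apply, mulVec, dotProduct, RingHom.id_apply, smul_eq_mul,
          Complex.real_smul]
        have : ∑ j, R k j * ((a j * (t * g (j, i)) : ℝ) : ℂ)
            = t * ∑ j, R k j * ((a j * g (j, i) : ℝ) : ℂ) := by
          rw [Finset.mul_sum]
          refine Finset.sum_congr rfl fun j _ => ?_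
          push_cast
          ring
        rw [this]
        ring }
  let m : EuclideanSpace ℂ ι := WithLp.toLp 2 fun k => (√(γ k) : ℂ) * (R *ᵥ offCol i (shiftedH E Z)) k
  have hnorm : ∀ φ : ι → ℂ, ‖(WithLp.toLp 2 fun k => (√(γ k) : ℂ) * (R *ᵥ φ) k : EuclideanSpace ℂ ι)‖ ^ 2
      = ∑ k, γ k * ‖(R *ᵥ φ) k‖ ^ 2 := by
    intro φ
    rw [EuclideanSpace.norm_sq_eq]
    refine Finset.sum_congr rfl fun k _ => ?_
    rw [norm_mul, mul_pow, Complex.norm_real, Real.norm_eq_abs, sq_abs, Real.sq_sqrt (hγ k).le]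
  have hsum : ∀ g : EuclideanSpace ℝ (ι × ι), M g + m = WithLp.toLp 2 fun k => (√(γ k) : ℂ) *
      (R *ᵥ offCol i (shiftedH E fun p => ((c p * g p : ℝ) : ℂ) + Z p)) k := by
    intro g
    ext k
    rw [hoff, mulVec_add]
    simp [M, m, mul_add]
  have hbound : ∀ g : EuclideanSpace ℝ (ι × ι),
      ENNReal.ofReal ((dissip (shiftedH E fun p => ((c p * g p : ℝ) : ℂ) + Z p) γ)⁻¹ i i).im
        ≤ (ENNReal.ofReal (‖M g + m‖ ^ 2))⁻¹ := by
    intro g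
    have := ofReal_im_inv_apply_self_le
      (shiftedH_isHermitian E fun p => ((c p * g p : ℝ) : ℂ) + Z p) hγ i
    rw [hdec] at this
    rw [hsum, hnorm]
    exact this
  -- Here `κ = 1/4` comes from the resolvent bound `n` on `B` times the variance `1 / (4n)`; the
  -- final bound is `1 / (2κ) = 2`.
  have hM : ∀ g, ‖M g‖ ^ 2 ≤ 1 / 4 * ‖g‖ ^ 2 := by
    intro g
    refine (hnorm _).le.trans ((sum_gamma_norm_sq_inv_mulVec_le hDH hγ
      (show (0 : ℝ) < 1 / B.card by positivity) _ ?_).trans ?_)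
    · intro j hj
      apply hγB
      by_contra hjB
      apply hj
      simp [ha, hjB]
    · rw [EuclideanSpace.norm_sq_eq]
      have h1 : ∑ j : ι, ‖((a j * g (j, i) : ℝ) : ℂ)‖ ^ 2 ≤ 1 / (4 * B.card) * ∑ p : ι × ι, ‖g p‖ ^ 2 := by
        rw [Fintype.sum_prod_type, Finset.mul_sum]
        refine Finset.sum_le_sum fun j _ => ?_
        rw [Complex.norm_real, norm_mul, mul_pow]
        gcongr
        · simpa using hapos j
        · exact Finset.single_le_sum (f := fun k => ‖g (j, k)‖ ^ 2) (fun k _ => by positivity)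
            (Finset.mem_univ i)
      calc _ ≤ (1 / (B.card : ℝ))⁻¹ * (1 / (4 * B.card) * ∑ p : ι × ι, ‖g p‖ ^ 2) := by gcongr
        _ = _ := by field_simp
  -- By the Ward identity the trace is `1 / (4n)` times the decoupled trace over `B` without `i`;
  -- the threshold `4n` is exactly what makes it at least `4κ = 1`.
  have htr : 4 * (1 / 4 : ℝ) ≤ ∑ p, ‖M (EuclideanSpace.basisFun (ι × ι) ℝ p)‖ ^ 2 := by
    have h1 : ∀ j ∈ B.erase i, ‖M (EuclideanSpace.basisFun (ι × ι) ℝ (j, i))‖ ^ 2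
        = 1 / (4 * B.card) * (R j j).im := by
      intro j hj
      refine (hnorm _).trans ?_
      rw [im_inv_apply_self hDH hγ, Finset.mul_sum, ← hR]
      refine Finset.sum_congr rfl fun k _ => ?_
      have h2 : (R *ᵥ fun l => ((a l * (EuclideanSpace.basisFun (ι × ι) ℝ (j, i)) (l, i) : ℝ) : ℂ)) k
          = R k j * (a j : ℂ) := by
        rw [mulVec, dotProduct, Finset.sum_eq_single j]
        · simp
        · intro l _ hl; simp [hl]
        · simp
      rw [h2, norm_mul, mul_pow, Complex.norm_real, Real.norm_eq_abs, sq_abs]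
      have : a j ^ 2 = 1 / (4 * B.card) := by
        simp only [ha, if_pos hj]
        rw [Real.sq_sqrt (by positivity)]
      rw [this]; ring
    calc 4 * (1 / 4 : ℝ) = 1 / (4 * B.card) * (4 * B.card) := by field_simp
      _ ≤ 1 / (4 * B.card) * ∑ j ∈ B.erase i, (R j j).im := by gcongr
      _ = ∑ j ∈ B.erase i, ‖M (EuclideanSpace.basisFun (ι × ι) ℝ (j, i))‖ ^ 2 := by
        rw [Finset.mul_sum, Finset.sum_congr rfl h1]
      _ = ∑ p ∈ S, ‖M (EuclideanSpace.basisFun (ι × ι) ℝ p)‖ ^ 2 := by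
        rw [hSdef, Finset.sum_map]; rfl
      _ ≤ _ := Finset.sum_le_univ_sum_of_nonneg fun p => by positivity
  refine (lintegral_mono hbound).trans ((lintegral_inv_norm_sq_le M m (by norm_num) hM
    (EuclideanSpace.basisFun (ι × ι) ℝ) htr).trans ?_)
  norm_num

/-- Wegner estimate for a block of size `n` on which the variances are at least `1 / n`. -/
theorem lintegral_sum_im_inv_block_le (hB : B.Nonempty)
    (hv : ∀ x ∈ B, ∀ y ∈ B, 1 / (B.card : ℝ≥0) ≤ v (x, y)) (E : ℝ) {ε : ℝ} (hε : 0 < ε) :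
    ∫⁻ Z, ENNReal.ofReal (∑ i ∈ B, ((dissip (shiftedH E Z) fun _ => ε)⁻¹ i i).im)
        ∂Measure.pi (fun p => entryLaw σ (v p)) ≤ 64 * B.card := by
  have hn : 0 < (B.card : ℝ) := by exact_mod_cast hB.card_pos
  refine (lintegral_sum_im_inv_le_regularized σ v hB hv E hε).trans ?_
  set γ : ι → ℝ := fun j => ε + 1 / B.card * blockInd B j with hγdef
  have hγ : ∀ j, 0 < γ j := by
    intro j
    have : 0 ≤ blockInd B j := by unfold blockInd; split_ifs <;> norm_num
    simp only [hγdef]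
    positivity
  have hγB : ∀ j ∈ B, 1 / (B.card : ℝ) ≤ γ j := by
    intro j hj
    simp only [hγdef, blockInd, if_pos hj]
    linarith
  have h8 : ∫⁻ Z, ENNReal.ofReal (∑ i ∈ B, ((dissip (shiftedH E Z) γ)⁻¹ i i).im)
      ∂Measure.pi (fun p => entryLaw σ (v p)) ≤ 8 * B.card := by
    calc ∫⁻ Z, ENNReal.ofReal (∑ i ∈ B, ((dissip (shiftedH E Z) γ)⁻¹ i i).im)
          ∂Measure.pi (fun p => entryLaw σ (v p))
        ≤ ∫⁻ Z, (6 * B.card + ∑ i ∈ B, (if 4 * (B.card : ℝ) ≤ ∑ j ∈ B.erase i,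
              ((dissip (decouple i (shiftedH E Z)) γ)⁻¹ j j).im
            then ENNReal.ofReal ((dissip (shiftedH E Z) γ)⁻¹ i i).im else 0))
          ∂Measure.pi (fun p => entryLaw σ (v p)) := by
          refine lintegral_mono fun Z => ?_
          -- Either every site passes the threshold and the averaged bound serves all of `B`, or one
          -- failing site bounds the full trace by `4n + 2n`.
          by_cases hall : ∀ i ∈ B, 4 * (B.card : ℝ) ≤ ∑ j ∈ B.erase i,
              ((dissip (decouple i (shiftedH E Z)) γ)⁻¹ j j).im
          · rw [ENNReal.ofReal_sum_of_nonneg fun i _ =>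
              im_inv_apply_self_nonneg (shiftedH_isHermitian E Z) hγ i]
            refine le_add_left (Finset.sum_le_sum fun i hi => ?_)
            rw [if_pos (hall i hi)]
          · push Not at hall
            obtain ⟨i, hi, hlt⟩ := hall
            refine le_add_right ?_
            have h1 := sum_im_inv_le_decouple (shiftedH_isHermitian E Z) hγ
              (show (0 : ℝ) < 1 / B.card by positivity) hγB hi
            have h2 : ∑ i ∈ B, ((dissip (shiftedH E Z) γ)⁻¹ i i).im ≤ 6 * B.card := by
              rw [one_div, inv_inv] at h1
              linarith
            refine (ENNReal.ofReal_le_ofReal h2).trans_eq ?_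
            rw [ENNReal.ofReal_mul (by norm_num), ENNReal.ofReal_natCast]
            norm_num
      _ ≤ 6 * B.card + ∑ i ∈ B, 2 := by
          rw [lintegral_add_left measurable_const, lintegral_finsetSum']
          · rw [lintegral_const, measure_univ, mul_one]
            gcongr with i hi
            exact lintegral_im_inv_of_decouple_large σ v hi hv E hγ hγB
          · intro i _
            refine Measurable.aemeasurable (Measurable.ite (measurableSet_le measurable_const
              (Finset.measurable_sum _ fun j _ => ?_)) ?_ measurable_const)
            · exact Complex.measurable_im.comp (measurable_dissip_decouple_inv _ _ _ _ _)
            · exact (Complex.measurable_im.comp (measurable_dissip_inv _ _ _ _)).ennreal_ofReal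
      _ = 8 * B.card := by
          rw [Finset.sum_const, nsmul_eq_mul, mul_comm (B.card : ℝ≥0∞) 2, ← add_mul]
          norm_num
  simp only [ENNReal.ofReal_mul (by positivity : (0 : ℝ) ≤ 2 * Real.pi)]
  have hGm : Measurable fun Z : ι × ι → ℂ =>
      ENNReal.ofReal (∑ i ∈ B, ((dissip (shiftedH E Z) γ)⁻¹ i i).im) :=
    Measurable.ennreal_ofReal (Finset.measurable_sum _ fun i _ =>
      Complex.measurable_im.comp (measurable_dissip_inv _ _ _ _))
  rw [lintegral_const_mul _ hGm, ← mul_assoc,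
    ← ENNReal.ofReal_mul (by positivity)]
  -- The left side is `4 √e`; with the block bound `8n` this produces `64n`.
  have hconst : 2 * Real.exp (1 / 2) / Real.pi * (2 * Real.pi) ≤ 8 := by
    have hpi := Real.pi_pos
    have h1 : Real.exp (1 / 2) ≤ 2 := by
      have h2 : Real.exp (1 / 2) ^ 2 = Real.exp 1 := by
        rw [← Real.exp_nat_mul]; norm_num
      have h3 := Real.exp_one_lt_d9
      nlinarith [Real.exp_pos (1 / 2)]
    field_simp
    linarith
  calc ENNReal.ofReal (2 * Real.exp (1 / 2) / Real.pi * (2 * Real.pi)) *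
        ∫⁻ Z, ENNReal.ofReal (∑ i ∈ B, ((dissip (shiftedH E Z) γ)⁻¹ i i).im)
          ∂Measure.pi (fun p => entryLaw σ (v p))
      ≤ ENNReal.ofReal 8 * (8 * B.card) := by gcongr
    _ = 64 * B.card := by
        rw [← mul_assoc]
        norm_num

end Wegner

end BandMatrix

end

noncomputable section

namespace BandMatrix

/-! ### From the resolvent trace to eigenvalue counts on the box -/

section FiniteVolume

open Matrix

theorem eigenvalueCount_eq {n : Type*} [Fintype n] [DecidableEq n] {A : Matrix n n ℂ}
    (hA : A.IsHermitian) (I : Set ℝ) [DecidablePred fun i => hA.eigenvalues i ∈ I] :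
    eigenvalueCount hA I = (Finset.univ.filter fun i : n => hA.eigenvalues i ∈ I).card := by
  unfold eigenvalueCount
  congr!

theorem eigenvalueCount_mono {n : Type*} [Fintype n] {A : Matrix n n ℂ} (hA : A.IsHermitian)
    {I J : Set ℝ} (h : I ⊆ J) : eigenvalueCount hA I ≤ eigenvalueCount hA J := by
  classical
  rw [eigenvalueCount_eq, eigenvalueCount_eq]
  exact Finset.card_le_card (Finset.monotone_filter_right _ fun i _ hi => h hi)

/-- The trace of the imaginary part of the resolvent in terms of the eigenvalues. -/
theorem sum_im_dissip_inv {n : Type*} [Fintype n] [DecidableEq n] {A : Matrix n n ℂ}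
    (hA : A.IsHermitian) (E : ℝ) {ε : ℝ} (hε : 0 < ε) :
    ∑ i, ((dissip (A - diagonal fun _ => (E : ℂ)) fun _ => ε)⁻¹ i i).im
      = ∑ i, ε / ((hA.eigenvalues i - E) ^ 2 + ε ^ 2) := by
  set U : Matrix n n ℂ := hA.eigenvectorUnitary.1
  set z : ℂ := E + ε * Complex.I with hz
  have hUU : U * star U = 1 := Unitary.coe_mul_star_self hA.eigenvectorUnitary
  have hUU' : star U * U = 1 := Unitary.coe_star_mul_self hA.eigenvectorUnitary
  have hspec : A = U * diagonal (fun i => (hA.eigenvalues i : ℂ)) * star U := by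
    have := hA.spectral_theorem
    rw [Unitary.conjStarAlgAut_apply] at this
    exact this
  have hne : ∀ i, (hA.eigenvalues i : ℂ) - z ≠ 0 := by
    intro i h
    have := congrArg Complex.im h
    simp [hz] at this
    exact hε.ne' this
  have hscal : diagonal (fun _ => z) = U * diagonal (fun _ : n => z) * star U := by
    rw [← smul_one_eq_diagonal, Matrix.mul_smul, Matrix.mul_one, Matrix.smul_mul, hUU]
  have hD : dissip (A - diagonal fun _ => (E : ℂ)) (fun _ => ε)
      = U * diagonal (fun i => (hA.eigenvalues i : ℂ) - z) * star U := by
    have h1 : dissip (A - diagonal fun _ => (E : ℂ)) (fun _ => ε) = A - diagonal fun _ => z := by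
      rw [dissip, sub_sub, diagonal_add]
    rw [h1, hscal]
    conv_lhs => rw [hspec]
    rw [← Matrix.sub_mul, ← Matrix.mul_sub, diagonal_sub]
  have hinv : (dissip (A - diagonal fun _ => (E : ℂ)) (fun _ => ε))⁻¹
      = U * diagonal (fun i => ((hA.eigenvalues i : ℂ) - z)⁻¹) * star U := by
    apply inv_eq_right_inv
    rw [hD]
    calc _ = U * diagonal (fun i => (hA.eigenvalues i : ℂ) - z) * (star U * U)
          * diagonal (fun i => ((hA.eigenvalues i : ℂ) - z)⁻¹) * star U := by
            simp only [Matrix.mul_assoc]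
      _ = U * (diagonal (fun i => (hA.eigenvalues i : ℂ) - z)
          * diagonal (fun i => ((hA.eigenvalues i : ℂ) - z)⁻¹)) * star U := by
            rw [hUU', Matrix.mul_one, Matrix.mul_assoc U]
      _ = 1 := by
            rw [diagonal_mul_diagonal]
            simp only [mul_inv_cancel₀ (hne _), diagonal_one, Matrix.mul_one, hUU]
  have htr : ((dissip (A - diagonal fun _ => (E : ℂ)) fun _ => ε)⁻¹).trace
      = ∑ i, ((hA.eigenvalues i : ℂ) - z)⁻¹ := by
    rw [hinv, trace_mul_comm, ← Matrix.mul_assoc, hUU', Matrix.one_mul, trace_diagonal]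
  rw [← Complex.im_sum]
  change ((dissip (A - diagonal fun _ => (E : ℂ)) fun _ => ε)⁻¹).trace.im = _
  rw [htr, Complex.im_sum]
  refine Finset.sum_congr rfl fun i _ => ?_
  rw [Complex.inv_im, Complex.normSq_apply]
  simp [hz]
  ring_nf

/-- For `|λ - E| ≤ ε` the Poisson kernel satisfies `2ε · ε / ((λ - E)² + ε²) ≥ 1`. -/
theorem eigenvalueCount_Icc_le {n : Type*} [Fintype n] [DecidableEq n] {A : Matrix n n ℂ}
    (hA : A.IsHermitian) (E : ℝ) {ε : ℝ} (hε : 0 < ε) :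
    (eigenvalueCount hA (Set.Icc (E - ε) (E + ε)) : ℝ≥0∞) ≤ ENNReal.ofReal (2 * ε *
      ∑ i, ((dissip (A - diagonal fun _ => (E : ℂ)) fun _ => ε)⁻¹ i i).im) := by
  classical
  rw [sum_im_dissip_inv hA E hε, eigenvalueCount_eq, ← ENNReal.ofReal_natCast]
  apply ENNReal.ofReal_le_ofReal
  rw [Finset.card_filter, Finset.mul_sum, Nat.cast_sum]
  refine Finset.sum_le_sum fun i _ => ?_
  split_ifs with h
  · have h1 : (hA.eigenvalues i - E) ^ 2 ≤ ε ^ 2 := by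
      apply sq_le_sq'
      · linarith [h.1]
      · linarith [h.2]
    rw [Nat.cast_one, ← mul_div_assoc, le_div_iff₀ (by positivity)]
    nlinarith
  · rw [Nat.cast_zero]; positivity

/-- Wegner estimate for a matrix partitioned into blocks. -/
theorem lintegral_sum_im_inv_le {ι α : Type*} [Fintype ι] [DecidableEq ι] [DecidableEq α]
    (σ : SymmetryClass) (v : ι × ι → ℝ≥0) (κ : ι → α)
    (hv : ∀ x y, κ x = κ y →
      1 / ((Finset.univ.filter fun z => κ z = κ x).card : ℝ≥0) ≤ v (x, y))
    (E : ℝ) {ε : ℝ} (hε : 0 < ε) :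
    ∫⁻ Z, ENNReal.ofReal (∑ i, ((dissip (shiftedH E Z) fun _ => ε)⁻¹ i i).im)
        ∂Measure.pi (fun p => entryLaw σ (v p)) ≤ 64 * Fintype.card ι := by
  set t : Finset α := Finset.univ.image κ
  have hfib : ∀ f : ι → ℝ, ∑ i, f i = ∑ k ∈ t, ∑ i with κ i = k, f i := fun f =>
    (Finset.sum_fiberwise_of_maps_to (fun i _ => Finset.mem_image_of_mem κ (Finset.mem_univ i))
      f).symm
  have hcard : Fintype.card ι = ∑ k ∈ t, (Finset.univ.filter fun i => κ i = k).card :=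
    Finset.card_eq_sum_card_fiberwise
      (fun i _ => Finset.mem_image_of_mem κ (Finset.mem_univ i))
  have hm : ∀ k, Measurable fun Z : ι × ι → ℂ => ENNReal.ofReal
      (∑ i with κ i = k, ((dissip (shiftedH E Z) fun _ => ε)⁻¹ i i).im) := fun k =>
    Measurable.ennreal_ofReal (Finset.measurable_sum _ fun i _ =>
      Complex.measurable_im.comp (measurable_dissip_inv _ _ _ _))
  calc ∫⁻ Z, ENNReal.ofReal (∑ i, ((dissip (shiftedH E Z) fun _ => ε)⁻¹ i i).im)
        ∂Measure.pi (fun p => entryLaw σ (v p))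
      = ∫⁻ Z, ∑ k ∈ t, ENNReal.ofReal
          (∑ i with κ i = k, ((dissip (shiftedH E Z) fun _ => ε)⁻¹ i i).im)
          ∂Measure.pi (fun p => entryLaw σ (v p)) := by
        refine lintegral_congr fun Z => ?_
        rw [hfib, ENNReal.ofReal_sum_of_nonneg]
        intro k _
        exact Finset.sum_nonneg fun i _ =>
          im_inv_apply_self_nonneg (shiftedH_isHermitian E Z) (fun _ => hε) i
    _ = ∑ k ∈ t, ∫⁻ Z, ENNReal.ofReal
          (∑ i with κ i = k, ((dissip (shiftedH E Z) fun _ => ε)⁻¹ i i).im)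
          ∂Measure.pi (fun p => entryLaw σ (v p)) :=
        lintegral_finsetSum _ fun k _ => hm k
    _ ≤ ∑ k ∈ t, 64 * ((Finset.univ.filter fun i => κ i = k).card : ℝ≥0∞) := by
        refine Finset.sum_le_sum fun k hk => ?_
        obtain ⟨i, -, rfl⟩ := Finset.mem_image.1 hk
        refine lintegral_sum_im_inv_block_le σ v ⟨i, by simp⟩ ?_ E hε
        intro x hx y hy
        simp only [Finset.mem_filter, Finset.mem_univ, true_and] at hx hy
        rw [← hx]
        exact hv x y (hx.trans hy.symm)
    _ = 64 * Fintype.card ι := by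
        rw [← Finset.mul_sum, hcard, Nat.cast_sum]

variable {d : ℕ}

theorem mem_box {L : ℕ} {x : Fin d → ℤ} : x ∈ box d L ↔ ∀ c, -(L : ℤ) ≤ x c ∧ x c ≤ L := by
  simp [box, Fintype.mem_piFinset]

theorem card_box (d L : ℕ) : (box d L).card = (2 * L + 1) ^ d := by
  rw [box, Fintype.card_piFinset]
  simp only [Int.card_Icc, Finset.prod_const, Finset.card_univ, Fintype.card_fin]
  congr 1
  omega

/-- The block containing a coordinate, for a partition of `{-L, …, L}` into intervals of lengths
between `W + 1` and `2 W + 1`. -/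
def coordBlock (W L : ℕ) (t : ℤ) : ℤ := min ((t + L) / (W + 1)) ((2 * L + 1) / (W + 1) - 1)

/-- The truncation in `coordBlock` merges the incomplete last interval, of at most `W` points, with
the full one before it. A block therefore has at most `2W + 1` points, and its diameter meets the
range of the variance hypothesis. -/
theorem abs_sub_le_of_coordBlock_eq {W L : ℕ} {s t : ℤ}
    (hs : -(L : ℤ) ≤ s ∧ s ≤ L) (ht : -(L : ℤ) ≤ t ∧ t ≤ L)
    (h : coordBlock W L s = coordBlock W L t) : |s - t| ≤ 2 * (min W L : ℕ) := by
  have hW : (0 : ℤ) < W + 1 := by positivity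
  unfold coordBlock at h
  have h1 := Int.mul_ediv_add_emod (s + L) (W + 1)
  have h2 := Int.mul_ediv_add_emod (t + L) (W + 1)
  have h3 := Int.mul_ediv_add_emod (2 * L + 1) (W + 1)
  have h1' := Int.emod_nonneg (s + L) hW.ne'
  have h2' := Int.emod_nonneg (t + L) hW.ne'
  have h1'' := Int.emod_lt_of_pos (s + L) hW
  have h2'' := Int.emod_lt_of_pos (t + L) hW
  have h3'' := Int.emod_lt_of_pos (2 * L + 1 : ℤ) hW
  set a := (s + L) / (W + 1 : ℤ)
  set b := (t + L) / (W + 1 : ℤ)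
  set m := (2 * L + 1) / (W + 1 : ℤ)
  have hA : |s - t| ≤ 2 * W := by
    rcases le_or_gt (m - 1) a with ha | ha
    · have hb : m - 1 ≤ b := by
        rw [min_eq_right ha] at h
        by_contra! hb
        rw [min_eq_left hb.le] at h
        omega
      have e1 : (W + 1 : ℤ) * (m - 1) ≤ (W + 1) * a := mul_le_mul_of_nonneg_left ha hW.le
      have e2 : (W + 1 : ℤ) * (m - 1) ≤ (W + 1) * b := mul_le_mul_of_nonneg_left hb hW.le
      rw [mul_sub, mul_one] at e1 e2
      rw [abs_le]
      constructor <;> omega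
    · have hb : a = b := by
        rw [min_eq_left ha.le] at h
        rcases le_total b (m - 1) with hb | hb
        · rw [min_eq_left hb] at h; exact h
        · rw [min_eq_right hb] at h; omega
      rw [hb] at h1
      rw [abs_le]
      constructor <;> omega
  have hB : |s - t| ≤ 2 * L := by
    rw [abs_le]
    constructor <;> omega
  rcases le_total W L with h | h
  · rwa [min_eq_left h]
  · rwa [min_eq_right h]

/-- Each block contains `W + 1` explicit consecutive points. The condition `W ≤ 2L` guarantees one
full interval, so the truncated label is non-negative. -/
theorem coordBlock_mul_add {W L : ℕ} (hWL : W ≤ 2 * L) {s : ℤ}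
    (hs : -(L : ℤ) ≤ s ∧ s ≤ L) {r : ℤ} (hr : 0 ≤ r ∧ r ≤ W) :
    (-(L : ℤ) ≤ coordBlock W L s * (W + 1) + r - L ∧ coordBlock W L s * (W + 1) + r - L ≤ L) ∧
      coordBlock W L (coordBlock W L s * (W + 1) + r - L) = coordBlock W L s := by
  have hW : (0 : ℤ) < W + 1 := by positivity
  have h3 := Int.mul_ediv_add_emod (2 * L + 1) (W + 1)
  have h3' := Int.emod_nonneg (2 * L + 1 : ℤ) hW.ne'
  have hm : (1 : ℤ) ≤ (2 * L + 1) / (W + 1) := by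
    rw [Int.le_ediv_iff_mul_le hW]; omega
  have hs0 : 0 ≤ (s + L) / (W + 1 : ℤ) := Int.ediv_nonneg (by omega) hW.le
  have hk0 : 0 ≤ coordBlock W L s := le_min hs0 (by omega)
  have hk1 : coordBlock W L s ≤ (2 * L + 1) / (W + 1) - 1 := min_le_right _ _
  set k := coordBlock W L s
  have e1 : k * (W + 1 : ℤ) ≤ ((2 * L + 1) / (W + 1) - 1) * (W + 1) :=
    mul_le_mul_of_nonneg_right hk1 hW.le
  rw [sub_mul, one_mul, mul_comm ((2 * L + 1) / (W + 1) : ℤ)] at e1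
  have e0 : 0 ≤ k * (W + 1 : ℤ) := mul_nonneg hk0 hW.le
  refine ⟨⟨by omega, by omega⟩, ?_⟩
  have : (k * (W + 1 : ℤ) + r - L + L) / (W + 1) = k := by
    rw [sub_add_cancel, add_comm, Int.add_mul_ediv_right _ _ hW.ne',
      Int.ediv_eq_zero_of_lt hr.1 (by omega), zero_add]
  rw [coordBlock, this, min_eq_left hk1]

/-- The law of the entries of a Gaussian matrix. -/
def entriesLaw (σ : SymmetryClass) (ψ : (Fin d → ℤ) → ℝ≥0) (L : ℕ) :
    Measure (box d L × box d L → ℂ) :=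
  Measure.pi fun p => entryLaw σ (ψ ((p.1 : Fin d → ℤ) - (p.2 : Fin d → ℤ)))

instance (σ : SymmetryClass) (ψ : (Fin d → ℤ) → ℝ≥0) (L : ℕ) :
    IsProbabilityMeasure (entriesLaw σ ψ L) := by
  unfold entriesLaw; infer_instance

theorem IsGaussianMatrix.map_eq {σ : SymmetryClass} {ψ : (Fin d → ℤ) → ℝ≥0} {L : ℕ} {Ω : Type*}
    [MeasurableSpace Ω] {P : Measure Ω} [IsProbabilityMeasure P]
    {X : Ω → Matrix (box d L) (box d L) ℂ} (h : IsGaussianMatrix σ ψ P X) :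
    P.map (fun ω (p : box d L × box d L) => X ω p.1 p.2) = entriesLaw σ ψ L := by
  have := (iIndepFun_iff_map_fun_eq_pi_map (f := fun (p : box d L × box d L) ω => X ω p.1 p.2)
    fun p => (h.hasLaw p.1 p.2).aemeasurable).1 h.indep
  refine this.trans ?_
  rw [entriesLaw]
  congr 1
  ext1 p
  exact (h.hasLaw p.1 p.2).map_eq

theorem IsGaussianMatrix.lintegral_eq {σ : SymmetryClass} {ψ : (Fin d → ℤ) → ℝ≥0} {L : ℕ}
    {Ω : Type*} [MeasurableSpace Ω] {P : Measure Ω} [IsProbabilityMeasure P]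
    {X : Ω → Matrix (box d L) (box d L) ℂ} (h : IsGaussianMatrix σ ψ P X)
    {F : (box d L × box d L → ℂ) → ℝ≥0∞} (hF : Measurable F) :
    ∫⁻ ω, F (fun p => X ω p.1 p.2) ∂P = ∫⁻ Z, F Z ∂entriesLaw σ ψ L := by
  rw [← h.map_eq, lintegral_map' hF.aemeasurable]
  exact aemeasurable_pi_lambda _ fun p => (h.hasLaw p.1 p.2).aemeasurable

/-- The mean number of eigenvalues in a short interval. -/
theorem meanCount_Icc_le {σ : SymmetryClass} {ψ : (Fin d → ℤ) → ℝ≥0} {W L : ℕ}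
    (hWL : W ≤ 2 * L) (hψ : LowerBound ψ W L) {Ω : Type*} [MeasurableSpace Ω] {P : Measure Ω}
    [IsProbabilityMeasure P] {X : Ω → Matrix (box d L) (box d L) ℂ}
    (h : IsGaussianMatrix σ ψ P X) (E : ℝ) {ε : ℝ} (hε : 0 < ε) :
    meanCount P X (Set.Icc (E - ε) (E + ε))
      ≤ 64 * (2 * (L : ℝ≥0∞) + 1) ^ d * ENNReal.ofReal (2 * ε) := by
  have hm : Measurable fun Z : box d L × box d L → ℂ => ENNReal.ofReal (2 * ε *
      ∑ i, ((dissip (shiftedH E Z) fun _ => ε)⁻¹ i i).im) :=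
    Measurable.ennreal_ofReal (Measurable.const_mul (Finset.measurable_sum _ fun i _ =>
      Complex.measurable_im.comp (measurable_dissip_inv _ _ _ _)) _)
  have hm' : Measurable fun Z : box d L × box d L → ℂ => ENNReal.ofReal
      (∑ i, ((dissip (shiftedH E Z) fun _ => ε)⁻¹ i i).im) :=
    Measurable.ennreal_ofReal (Finset.measurable_sum _ fun i _ =>
      Complex.measurable_im.comp (measurable_dissip_inv _ _ _ _))
  have h1 : meanCount P X (Set.Icc (E - ε) (E + ε)) ≤ ∫⁻ ω, ENNReal.ofReal (2 * ε *
      ∑ i, ((dissip (shiftedH E fun p => X ω p.1 p.2) fun _ => ε)⁻¹ i i).im) ∂P :=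
    lintegral_mono fun ω => eigenvalueCount_Icc_le (hermitize_isHermitian (X ω)) E hε
  rw [h.lintegral_eq hm] at h1
  refine h1.trans ?_
  simp only [ENNReal.ofReal_mul (by positivity : 0 ≤ 2 * ε)]
  rw [lintegral_const_mul _ hm', mul_comm]
  gcongr
  refine (lintegral_sum_im_inv_le σ _ (fun (x : box d L) c => coordBlock W L ((x : Fin d → ℤ) c))
    ?_ E hε).trans_eq ?_
  · intro x y hxy
    have hx := mem_box.1 x.2
    have hy := mem_box.1 y.2
    -- The lower bound on the block size converts the variance bound `(W + 1)^(-d)` into `1 / n`.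
    have hcard : (W + 1) ^ d ≤ (Finset.univ.filter fun z : box d L =>
        (fun c => coordBlock W L ((z : Fin d → ℤ) c))
          = fun c => coordBlock W L ((x : Fin d → ℤ) c)).card := by
      have : (W + 1) ^ d = (Finset.univ : Finset (Fin d → Fin (W + 1))).card := by simp
      rw [this]
      have hb : ∀ (t : Fin d → Fin (W + 1)) (c : Fin d), (0 : ℤ) ≤ t c ∧ ((t c : ℕ) : ℤ) ≤ W :=
        fun t c => ⟨by positivity, by exact_mod_cast Nat.lt_succ_iff.1 (t c).2⟩
      refine Finset.card_le_card_of_injOn (fun t => ⟨fun c =>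
        coordBlock W L ((x : Fin d → ℤ) c) * (W + 1) + t c - L,
        mem_box.2 fun c => (coordBlock_mul_add hWL (hx c) (hb t c)).1⟩) ?_ ?_
      · intro t _
        simp only [Finset.coe_filter, Finset.mem_univ, true_and, Set.mem_ofPred_eq]
        ext c
        exact (coordBlock_mul_add hWL (hx c) (hb t c)).2
      · intro s _ t _ hst
        ext c
        have := congrFun (Subtype.ext_iff.1 hst) c
        simp only at this
        omega
    have hnorm : ‖(x : Fin d → ℤ) - y‖ ≤ ((2 * min W L : ℕ) : ℝ) := by
      rw [pi_norm_le_iff_of_nonneg (by positivity)]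
      intro c
      have := abs_sub_le_of_coordBlock_eq (hx c) (hy c) (congrFun hxy c)
      rw [Pi.sub_apply, Int.norm_eq_abs]
      exact_mod_cast this
    refine le_trans ?_ (hψ _ hnorm)
    apply one_div_le_one_div_of_le (by positivity)
    exact_mod_cast hcard
  · rw [Fintype.card_coe, card_box]
    push_cast
    ring

/-- Two points of an interval are no further apart than its length, so finite length forces
boundedness. -/
theorem subset_Icc_of_ordConnected {I : Set ℝ} (hI : I.OrdConnected) (hne : I.Nonempty)
    (hv : volume I ≠ ⊤) : I ⊆ Set.Icc (sInf I) (sInf I + (volume I).toReal) := by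
  have key : ∀ x ∈ I, ∀ y ∈ I, y ≤ x + (volume I).toReal := by
    intro x hx y hy
    rcases le_total y x with h | h
    · linarith [ENNReal.toReal_nonneg (a := volume I)]
    · have h1 : volume (Set.Icc x y) ≤ volume I := measure_mono (hI.out hx hy)
      rw [Real.volume_Icc, ENNReal.ofReal_le_iff_le_toReal hv] at h1
      linarith
  obtain ⟨x₀, hx₀⟩ := hne
  have hbdd : BddBelow I := ⟨x₀ - (volume I).toReal, fun y hy => by linarith [key y hy x₀ hx₀]⟩
  intro y hy
  refine ⟨csInf_le hbdd hy, ?_⟩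
  have : y - (volume I).toReal ≤ sInf I :=
    le_csInf ⟨x₀, hx₀⟩ fun x hx => by linarith [key x hx y hy]
  linarith

theorem meanCount_mono {n Ω : Type*} [Fintype n] [MeasurableSpace Ω] (P : Measure Ω)
    (X : Ω → Matrix n n ℂ) {I J : Set ℝ} (h : I ⊆ J) : meanCount P X I ≤ meanCount P X J :=
  lintegral_mono fun ω => by
    exact Nat.cast_le.2 (eigenvalueCount_mono (hermitize_isHermitian (X ω)) h)

/-- The finite-volume estimate. -/
theorem meanCount_le {σ : SymmetryClass} {ψ : (Fin d → ℤ) → ℝ≥0} {W L : ℕ}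
    (hWL : W ≤ 2 * L) (hψ : LowerBound ψ W L) {Ω : Type*} [MeasurableSpace Ω] {P : Measure Ω}
    [IsProbabilityMeasure P] {X : Ω → Matrix (box d L) (box d L) ℂ}
    (h : IsGaussianMatrix σ ψ P X) {I : Set ℝ} (hI : I.OrdConnected) :
    meanCount P X I ≤ 64 * (2 * (L : ℝ≥0∞) + 1) ^ d * volume I := by
  rcases I.eq_empty_or_nonempty with rfl | hne
  · simp [meanCount, eigenvalueCount]
  by_cases hv : volume I = ⊤
  · rw [hv, ENNReal.mul_top]
    · exact le_top
    · simp
  have hsub := subset_Icc_of_ordConnected hI hne hv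
  set ℓ := (volume I).toReal with hℓ
  have hℓ0 : 0 ≤ ℓ := ENNReal.toReal_nonneg
  have hvol : volume I = ENNReal.ofReal ℓ := (ENNReal.ofReal_toReal hv).symm
  -- The enlargement by `δ` keeps the half-width positive for degenerate intervals and is removed in
  -- the limit.
  have hδ : ∀ δ : ℝ, 0 < δ → meanCount P X I
      ≤ 64 * (2 * (L : ℝ≥0∞) + 1) ^ d * ENNReal.ofReal (ℓ + δ) := by
    intro δ hδ
    have h1 := meanCount_Icc_le hWL hψ h (sInf I + ℓ / 2) (ε := (ℓ + δ) / 2) (by positivity)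
    rw [mul_div_cancel₀ _ two_ne_zero] at h1
    refine (meanCount_mono P X (hsub.trans (Set.Icc_subset_Icc ?_ ?_))).trans h1 <;> linarith
  have hlim : Tendsto (fun δ : ℝ => 64 * (2 * (L : ℝ≥0∞) + 1) ^ d * ENNReal.ofReal (ℓ + δ))
      (𝓝[>] 0) (𝓝 (64 * (2 * (L : ℝ≥0∞) + 1) ^ d * ENNReal.ofReal (ℓ + 0))) := by
    apply ENNReal.Tendsto.const_mul
    · apply (ENNReal.continuous_ofReal.tendsto _).comp
      exact ((continuous_const.add continuous_id).tendsto 0).mono_left nhdsWithin_le_nhds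
    · right
      exact ENNReal.mul_ne_top (by norm_num) (ENNReal.pow_ne_top (by finiteness))
  rw [add_zero, ← hvol] at hlim
  exact ge_of_tendsto hlim (eventually_nhdsWithin_of_forall fun δ hδ' => hδ δ hδ')

end FiniteVolume

end BandMatrix

end

noncomputable section

namespace BandMatrix

/-! ### Densities and convergence of measures on the line -/

section LimitingMeasures

theorem dense_measure_singleton_eq_zero (ρ : Measure ℝ) [IsLocallyFiniteMeasure ρ] :
    Dense {a : ℝ | ρ {a} = 0} := by
  have hc : {a : ℝ | 0 < ρ {a}}.Countable :=
    Measure.countable_meas_pos_of_disjoint_iUnion (μ := ρ) (As := fun a : ℝ => {a})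
      (fun a => measurableSet_singleton a) fun a b hab => by simpa using hab
  have := hc.dense_compl ℝ
  refine this.mono fun a ha => ?_
  simpa using ha

/-- A locally finite measure is absolutely continuous with density at most `C` if this is true on
compact intervals with non-atomic endpoints. -/
theorem exists_density_of_measure_Icc_le {ρ : Measure ℝ} [IsLocallyFiniteMeasure ρ] {C : ℝ≥0}
    (h : ∀ a b : ℝ, a ≤ b → ρ {a} = 0 → ρ {b} = 0 →
      ρ (Set.Icc a b) ≤ C * ENNReal.ofReal (b - a)) :
    ∃ f : ℝ → ℝ≥0∞, Measurable f ∧ (∀ t, f t ≤ C) ∧ ρ = volume.withDensity f := by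
  -- Non-atoms are dense, so arbitrary endpoints are approximated from outside by admissible ones.
  have hIcc : ∀ a b : ℝ, a ≤ b → ρ (Set.Icc a b) ≤ C * ENNReal.ofReal (b - a) := by
    intro a b hab
    have hδ : ∀ δ : ℝ, 0 < δ → ρ (Set.Icc a b) ≤ C * ENNReal.ofReal (b - a + 2 * δ) := by
      intro δ hδ
      obtain ⟨a', ha', ha1, ha2⟩ := (dense_measure_singleton_eq_zero ρ).exists_between
        (show a - δ < a by linarith)
      obtain ⟨b', hb', hb1, hb2⟩ := (dense_measure_singleton_eq_zero ρ).exists_between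
        (show b < b + δ by linarith)
      refine (measure_mono (Set.Icc_subset_Icc ha2.le hb1.le)).trans
        ((h a' b' (by linarith) ha' hb').trans ?_)
      gcongr
      linarith
    have hlim : Tendsto (fun δ : ℝ => C * ENNReal.ofReal (b - a + 2 * δ)) (𝓝[>] 0)
        (𝓝 (C * ENNReal.ofReal (b - a + 2 * 0))) := by
      apply ENNReal.Tendsto.const_mul
      · apply (ENNReal.continuous_ofReal.tendsto _).comp
        exact (Continuous.tendsto (by fun_prop) 0).mono_left nhdsWithin_le_nhds
      · right
        exact ENNReal.coe_ne_top
    rw [mul_zero, add_zero] at hlim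
    exact ge_of_tendsto hlim (eventually_nhdsWithin_of_forall fun δ hδ' => hδ δ hδ')
  have hle : ρ ≤ C • (volume : Measure ℝ) := by
    rw [Real.volume_eq_stieltjes_id, ← StieltjesFunction.measure_smul]
    -- The outer measure built from interval lengths is the largest one below those lengths, so it
    -- suffices to test sets covered by a half-open interval.
    have hout : ρ.toOuterMeasure ≤ (C • StieltjesFunction.id).outer := by
      refine OuterMeasure.le_ofFunction.2 fun s => ?_
      rw [StieltjesFunction.length_eq]
      refine le_iInf fun a => le_iInf fun b => le_iInf fun hs => ?_
      have hs' : s ⊆ Set.Ioc a b := by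
        intro x hx
        refine hs ⟨hx, fun hb => ?_⟩
        -- The covering condition exempts a least element, and the real line has none.
        exact absurd (hb (x - 1)) (by simp)
      rcases le_or_gt a b with hab | hab
      · refine (measure_mono (hs'.trans Set.Ioc_subset_Icc_self)).trans
          ((hIcc a b hab).trans_eq ?_)
        change _ = ENNReal.ofReal ((C : ℝ) * b - (C : ℝ) * a)
        rw [← mul_sub, ENNReal.ofReal_mul (NNReal.coe_nonneg C), ENNReal.ofReal_coe_nnreal]
      · rw [Set.Ioc_eq_empty (not_lt.2 hab.le)] at hs'
        rw [Set.subset_empty_iff.1 hs']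
        simp
    refine Measure.le_iff.2 fun s hs => ?_
    rw [StieltjesFunction.measure]
    exact hout s
  have hac : ρ ≪ volume :=
    (Measure.absolutelyContinuous_of_le hle).trans
      (Measure.smul_absolutelyContinuous (c := C) (μ := (volume : Measure ℝ)))
  have hwd := Measure.withDensity_rnDeriv_eq ρ volume hac
  have hae : ρ.rnDeriv volume ≤ᵐ[volume] fun _ => (C : ℝ≥0∞) := by
    refine ae_le_of_forall_setLIntegral_le_of_sigmaFinite (Measure.measurable_rnDeriv _ _) ?_
    intro s hs _
    rw [← withDensity_apply _ hs, hwd, setLIntegral_const]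
    exact hle s
  -- Truncation upgrades the almost everywhere bound to one at every point.
  refine ⟨fun t => min (ρ.rnDeriv volume t) C,
    (Measure.measurable_rnDeriv _ _).min measurable_const, fun t => min_le_right _ _, ?_⟩
  rw [← hwd]
  refine withDensity_congr_ae ?_
  filter_upwards [hae] with t ht
  rw [hwd, min_eq_left ht]

/-- Prokhorov's theorem for a sequence with bounded second moments whose integrals against bounded
Lipschitz functions converge. -/
theorem exists_tendsto_probabilityMeasure {μ : ℕ → ProbabilityMeasure ℝ} {K : ℝ≥0}
    (hK : ∀ n, ∫⁻ x, ENNReal.ofReal (x ^ 2) ∂(μ n : Measure ℝ) ≤ K)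
    (hcauchy : ∀ f : ℝ → ℝ, (∃ C : ℝ, ∀ x y, dist (f x) (f y) ≤ C) →
      (∃ L, LipschitzWith L f) → CauchySeq fun n => ∫ x, f x ∂(μ n : Measure ℝ)) :
    ∃ ρ : ProbabilityMeasure ℝ, Tendsto μ atTop (𝓝 ρ) := by
  have htight : IsTightMeasureSet
      {((ν : ProbabilityMeasure ℝ) : Measure ℝ) | ν ∈ Set.range μ} := by
    rw [isTightMeasureSet_iff_exists_isCompact_measure_compl_le]
    intro ε hε
    rcases eq_or_ne ε ⊤ with rfl | hεt
    · exact ⟨∅, isCompact_empty, by simp⟩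
    set e := ε.toReal with he
    have he0 : 0 < e := ENNReal.toReal_pos hε.ne' hεt
    have heε : ε = ENNReal.ofReal e := (ENNReal.ofReal_toReal hεt).symm
    -- Chebyshev's inequality leaves mass at most `K / R² ≤ e` outside; `K + 1` keeps `R` positive
    -- when `K = 0`.
    set R : ℝ := Real.sqrt ((K + 1) / e) with hR
    have hR2 : R ^ 2 = (K + 1) / e := Real.sq_sqrt (by positivity)
    refine ⟨Set.Icc (-R) R, isCompact_Icc, ?_⟩
    rintro _ ⟨_, ⟨n, rfl⟩, rfl⟩
    have hsub : (Set.Icc (-R) R)ᶜ ⊆ {x : ℝ | ENNReal.ofReal (R ^ 2) ≤ ENNReal.ofReal (x ^ 2)} := by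
      intro x hx
      apply ENNReal.ofReal_le_ofReal
      by_contra! hlt
      exact hx (abs_le.1 (abs_le_of_sq_le_sq hlt.le (Real.sqrt_nonneg _)))
    refine (measure_mono hsub).trans ?_
    have hRpos : 0 < R ^ 2 := by rw [hR2]; positivity
    refine (meas_ge_le_lintegral_div (by fun_prop) (ENNReal.ofReal_pos.2 hRpos).ne'
      ENNReal.ofReal_ne_top).trans ?_
    rw [ENNReal.div_le_iff (ENNReal.ofReal_pos.2 hRpos).ne' ENNReal.ofReal_ne_top, heε,
      ← ENNReal.ofReal_mul he0.le, hR2, mul_div_cancel₀ _ he0.ne']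
    refine (hK n).trans ?_
    rw [← ENNReal.ofReal_coe_nnreal]
    exact ENNReal.ofReal_le_ofReal (by linarith)
  obtain ⟨ρ, -, φ, hφ, hlim⟩ := (isCompact_closure_of_isTightMeasureSet htight).tendsto_subseq
    (fun n => subset_closure ⟨n, rfl⟩)
  -- A Cauchy sequence converges as soon as a subsequence does, so the subsequential limit is the
  -- limit.
  refine ⟨ρ, tendsto_iff_forall_lipschitz_integral_tendsto.2 fun f hf hL => ?_⟩
  exact tendsto_nhds_of_cauchySeq_of_subseq (hcauchy f hf hL) hφ.tendsto_atTop
    (tendsto_iff_forall_lipschitz_integral_tendsto.1 hlim f hf hL)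

/-- If the approximating measures have uniformly bounded densities, weak convergence implies
convergence on all intervals. -/
theorem tendsto_measure_ordConnected {μ : ℕ → ProbabilityMeasure ℝ} {ρ : ProbabilityMeasure ℝ}
    (h : Tendsto μ atTop (𝓝 ρ)) {C : ℝ≥0}
    (hμ : ∀ᶠ n in atTop, ∀ I : Set ℝ, I.OrdConnected → (μ n : Measure ℝ) I ≤ C * volume I)
    {I : Set ℝ} (hI : I.OrdConnected) :
    Tendsto (fun n => (μ n : Measure ℝ) I) atTop (𝓝 ((ρ : Measure ℝ) I)) := by
  -- The portmanteau inequality on shrinking open intervals transfers the density bound to the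
  -- limit.
  have hatom : ∀ a : ℝ, (ρ : Measure ℝ) {a} = 0 := by
    intro a
    have hδ : ∀ δ : ℝ, 0 < δ → (ρ : Measure ℝ) {a} ≤ C * ENNReal.ofReal (2 * δ) := by
      intro δ hδ
      calc (ρ : Measure ℝ) {a} ≤ (ρ : Measure ℝ) (Set.Ioo (a - δ) (a + δ)) :=
            measure_mono (Set.singleton_subset_iff.2 ⟨by linarith, by linarith⟩)
        _ ≤ liminf (fun n => (μ n : Measure ℝ) (Set.Ioo (a - δ) (a + δ))) atTop :=
            ProbabilityMeasure.le_liminf_measure_open_of_tendsto h isOpen_Ioo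
        _ ≤ C * ENNReal.ofReal (2 * δ) := by
            refine liminf_le_of_frequently_le' (Eventually.frequently ?_)
            filter_upwards [hμ] with n hn
            refine (hn _ Set.ordConnected_Ioo).trans_eq ?_
            rw [Real.volume_Ioo]
            ring_nf
    have hlim : Tendsto (fun δ : ℝ => C * ENNReal.ofReal (2 * δ)) (𝓝[>] 0)
        (𝓝 (C * ENNReal.ofReal (2 * 0))) := by
      apply ENNReal.Tendsto.const_mul
      · apply (ENNReal.continuous_ofReal.tendsto _).comp
        exact (Continuous.tendsto (by fun_prop) 0).mono_left nhdsWithin_le_nhds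
      · right
        exact ENNReal.coe_ne_top
    rw [mul_zero, ENNReal.ofReal_zero, mul_zero] at hlim
    exact le_antisymm
      (ge_of_tendsto hlim (eventually_nhdsWithin_of_forall fun δ hδ' => hδ δ hδ')) bot_le
  have : NullSingletonClass (ρ : Measure ℝ) := ⟨hatom⟩
  refine ProbabilityMeasure.tendsto_measure_of_null_frontier_of_tendsto' h ?_
  have hsub : (frontier I) ⊆ {sInf I, sSup I} := by
    intro x hx
    have hxc : x ∈ closure I := hx.1
    by_cases h1 : ∃ y ∈ I, y < x
    · obtain ⟨y, hy, hyx⟩ := h1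
      by_cases h2 : ∃ z ∈ I, x < z
      · obtain ⟨z, hz, hxz⟩ := h2
        refine absurd ?_ hx.2
        exact mem_interior.2
          ⟨Set.Ioo y z, Set.Ioo_subset_Icc_self.trans (hI.out hy hz), isOpen_Ioo, hyx, hxz⟩
      · push Not at h2
        exact Or.inr ((isLUB_of_mem_closure h2 hxc).csSup_eq ⟨y, hy⟩).symm
    · push Not at h1
      exact Or.inl ((isGLB_of_mem_closure h1 hxc).csInf_eq
        (closure_nonempty_iff.1 ⟨x, hxc⟩)).symm
  exact measure_mono_null hsub ((Set.toFinite _).measure_zero _)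

end LimitingMeasures

end BandMatrix

end

noncomputable section

namespace BandMatrix

/-! ### Linear spectral statistics and Hilbert–Schmidt perturbation -/

section SpectralSums

open Matrix

set_option linter.unusedSectionVars false

variable {n m : Type*} [Fintype n] [DecidableEq n] [Fintype m] [DecidableEq m]

/-- The squared Hilbert–Schmidt norm. -/
def hsSq (A : Matrix n m ℂ) : ℝ := ∑ i, ∑ j, ‖A i j‖ ^ 2

theorem hsSq_nonneg (A : Matrix n m ℂ) : 0 ≤ hsSq A := by
  unfold hsSq; positivity

theorem hsSq_eq_trace (A : Matrix n m ℂ) : (hsSq A : ℂ) = (Aᴴ * A).trace := by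
  simp only [hsSq, trace, diag_apply, mul_apply, conjTranspose_apply]
  rw [Finset.sum_comm]
  push_cast
  refine Finset.sum_congr rfl fun j _ => Finset.sum_congr rfl fun i _ => ?_
  rw [Complex.star_def, ← Complex.normSq_eq_conj_mul_self, Complex.normSq_eq_norm_sq]
  push_cast
  rfl

theorem hsSq_unitary_mul_mul {U V : Matrix n n ℂ} (hU : U * star U = 1) (hV : V * star V = 1)
    (A : Matrix n n ℂ) : hsSq (star U * A * V) = hsSq A := by
  have h : (hsSq (star U * A * V) : ℂ) = hsSq A := by
    rw [hsSq_eq_trace, hsSq_eq_trace]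
    simp only [conjTranspose_mul, star_eq_conjTranspose, conjTranspose_conjTranspose] at hU hV ⊢
    rw [Matrix.mul_assoc, trace_mul_comm]
    calc ((Aᴴ * U) * (Uᴴ * A * V) * Vᴴ).trace = (Aᴴ * (U * Uᴴ) * A * (V * Vᴴ)).trace := by
          simp only [Matrix.mul_assoc]
      _ = (Aᴴ * A).trace := by rw [hU, hV, Matrix.mul_one, Matrix.mul_one]
  exact_mod_cast h

/-- The sum of `f` over the eigenvalues (more precisely over their real parts). -/
def specSum (f : ℝ → ℝ) (A : Matrix n n ℂ) : ℝ := (A.charpoly.roots.map fun z => f z.re).sum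

/-- Defining spectral sums by characteristic polynomial roots makes reindexing and block
factorization immediate and requires no Hermitian proof; this is the way back to eigenvalues. -/
theorem specSum_eq (f : ℝ → ℝ) {A : Matrix n n ℂ} (hA : A.IsHermitian) :
    specSum f A = ∑ i, f (hA.eigenvalues i) := by
  rw [specSum, hA.roots_charpoly_eq_eigenvalues, Multiset.map_map]
  simp [Function.comp_def]

theorem specSum_submatrix_equiv (f : ℝ → ℝ) (A : Matrix n n ℂ) (e : m ≃ n) :
    specSum f (A.submatrix e e) = specSum f A := by
  have : A.submatrix e e = reindex e.symm e.symm A := rfl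
  rw [specSum, specSum, this, charpoly_reindex]

theorem specSum_eq_sum_toSquareBlock {α : Type*} [LinearOrder α] (f : ℝ → ℝ) {A : Matrix n n ℂ}
    {κ : n → α} (h : A.BlockTriangular κ) :
    specSum f A = ∑ a ∈ Finset.univ.image κ, specSum f (A.toSquareBlock κ a) := by
  rw [specSum, h.charpoly, Polynomial.roots_prod]
  · rw [Multiset.map_bind, Multiset.sum_bind]
    rfl
  · exact Finset.prod_ne_zero_iff.2 fun a _ => (charpoly_monic _).ne_zero

theorem abs_specSum_le {f : ℝ → ℝ} {F : ℝ} (hf : ∀ x, |f x| ≤ F) {A : Matrix n n ℂ}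
    (hA : A.IsHermitian) : |specSum f A| ≤ F * Fintype.card n := by
  rw [specSum_eq f hA]
  refine (Finset.abs_sum_le_sum_abs _ _).trans ((Finset.sum_le_sum fun i _ => hf _).trans_eq ?_)
  simp [mul_comm]

theorem spectral_eq {A : Matrix n n ℂ} (hA : A.IsHermitian) :
    star hA.eigenvectorUnitary.1 * A
      = diagonal (fun i => (hA.eigenvalues i : ℂ)) * star hA.eigenvectorUnitary.1 ∧
    A * hA.eigenvectorUnitary.1
      = hA.eigenvectorUnitary.1 * diagonal (fun i => (hA.eigenvalues i : ℂ)) := by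
  set U : Matrix n n ℂ := hA.eigenvectorUnitary.1
  have hUU' : star U * U = 1 := Unitary.coe_star_mul_self hA.eigenvectorUnitary
  have hspec : A = U * diagonal (fun i => (hA.eigenvalues i : ℂ)) * star U := by
    have := hA.spectral_theorem
    rw [Unitary.conjStarAlgAut_apply] at this
    exact this
  constructor
  · conv_lhs => rw [hspec]
    rw [← Matrix.mul_assoc, ← Matrix.mul_assoc, hUU', Matrix.one_mul]
  · conv_lhs => rw [hspec]
    rw [Matrix.mul_assoc, hUU', Matrix.mul_one]

theorem sum_eigenvalues_sq {A : Matrix n n ℂ} (hA : A.IsHermitian) :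
    ∑ i, hA.eigenvalues i ^ 2 = hsSq A := by
  have hUU : hA.eigenvectorUnitary.1 * star hA.eigenvectorUnitary.1 = 1 :=
    Unitary.coe_mul_star_self hA.eigenvectorUnitary
  have hUU' : star hA.eigenvectorUnitary.1 * hA.eigenvectorUnitary.1 = 1 :=
    Unitary.coe_star_mul_self hA.eigenvectorUnitary
  rw [← hsSq_unitary_mul_mul hUU hUU A, (spectral_eq hA).1, Matrix.mul_assoc, hUU',
    Matrix.mul_one, hsSq]
  refine Finset.sum_congr rfl fun i _ => ?_
  rw [Finset.sum_eq_single i]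
  · simp
  · intro j _ hj
    simp [diagonal_apply_ne' _ hj]
  · simp

theorem sum_norm_sq_row_eq_one {U : Matrix n n ℂ} (hU : U * star U = 1) (i : n) :
    ∑ j, ‖U i j‖ ^ 2 = 1 := by
  have h := congrFun (congrFun hU i) i
  rw [mul_apply, one_apply_eq] at h
  have h' : ((∑ j, ‖U i j‖ ^ 2 : ℝ) : ℂ) = 1 := by
    rw [← h]
    push_cast
    refine Finset.sum_congr rfl fun j _ => ?_
    rw [star_apply, Complex.star_def, Complex.mul_conj, Complex.normSq_eq_norm_sq]
    push_cast
    rfl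
  exact_mod_cast h'

/-- A trace inequality for Lipschitz functions of Hermitian matrices. -/
theorem abs_specSum_sub_le {f : ℝ → ℝ} {K : ℝ≥0} (hf : LipschitzWith K f) {A B : Matrix n n ℂ}
    (hA : A.IsHermitian) (hB : B.IsHermitian) {η : ℝ} (hη : 0 < η) :
    |specSum f A - specSum f B| ≤ K * (η * Fintype.card n + hsSq (A - B) / η) := by
  set U : Matrix n n ℂ := hA.eigenvectorUnitary.1 with hUdef
  set V : Matrix n n ℂ := hB.eigenvectorUnitary.1 with hVdef
  have hUU : U * star U = 1 := Unitary.coe_mul_star_self hA.eigenvectorUnitary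
  have hUU' : star U * U = 1 := Unitary.coe_star_mul_self hA.eigenvectorUnitary
  have hVV : V * star V = 1 := Unitary.coe_mul_star_self hB.eigenvectorUnitary
  have hVV' : star V * V = 1 := Unitary.coe_star_mul_self hB.eigenvectorUnitary
  -- The change of eigenbasis is unitary, so `|S i j|²` is doubly stochastic and couples the two
  -- spectra.
  set S : Matrix n n ℂ := star U * V with hS
  have hSS : S * star S = 1 := by
    rw [hS, star_mul, star_star]
    calc star U * V * (star V * U) = star U * (V * star V) * U := by
          simp only [Matrix.mul_assoc]
      _ = 1 := by rw [hVV, Matrix.mul_one, hUU']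
  have hSS' : star S * S = 1 := by
    rw [hS, star_mul, star_star]
    calc star V * U * (star U * V) = star V * (U * star U) * V := by
          simp only [Matrix.mul_assoc]
      _ = 1 := by rw [hUU, Matrix.mul_one, hVV']
  have hrow : ∀ i, ∑ j, ‖S i j‖ ^ 2 = 1 := sum_norm_sq_row_eq_one hSS
  have hcol : ∀ j, ∑ i, ‖S i j‖ ^ 2 = 1 := by
    intro j
    have := sum_norm_sq_row_eq_one (U := star S) (by rwa [star_star]) j
    simpa [star_apply] using this
  set a := hA.eigenvalues
  set b := hB.eigenvalues
  -- Written between the two eigenbases, `A - B` has entries `(a i - b j) S i j`.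
  have hhs : hsSq (A - B) = ∑ i, ∑ j, ‖S i j‖ ^ 2 * (a i - b j) ^ 2 := by
    rw [← hsSq_unitary_mul_mul hUU hVV, Matrix.mul_sub, Matrix.sub_mul, (spectral_eq hA).1,
      Matrix.mul_assoc (star U) B, (spectral_eq hB).2, Matrix.mul_assoc, ← Matrix.mul_assoc (star U),
      ← hUdef, ← hVdef, ← hS, hsSq]
    refine Finset.sum_congr rfl fun i _ => Finset.sum_congr rfl fun j _ => ?_
    rw [Matrix.sub_apply, diagonal_mul, mul_diagonal, mul_comm (S i j), ← sub_mul, norm_mul,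
      mul_pow, mul_comm, ← Complex.ofReal_sub, Complex.norm_real, Real.norm_eq_abs, sq_abs]
  have hfA : specSum f A = ∑ i, ∑ j, ‖S i j‖ ^ 2 * f (a i) := by
    rw [specSum_eq f hA]
    refine Finset.sum_congr rfl fun i _ => ?_
    rw [← Finset.sum_mul, hrow, one_mul]
  have hfB : specSum f B = ∑ i, ∑ j, ‖S i j‖ ^ 2 * f (b j) := by
    rw [specSum_eq f hB, Finset.sum_comm]
    refine Finset.sum_congr rfl fun i _ => ?_
    rw [← Finset.sum_mul, hcol, one_mul]
  have hcard : (Fintype.card n : ℝ) = ∑ i, ∑ j, ‖S i j‖ ^ 2 := by simp [hrow]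
  rw [hfA, hfB, hhs, hcard, ← Finset.sum_sub_distrib, Finset.mul_sum, Finset.sum_div,
    ← Finset.sum_add_distrib, Finset.mul_sum]
  refine (Finset.abs_sum_le_sum_abs _ _).trans (Finset.sum_le_sum fun i _ => ?_)
  rw [← Finset.sum_sub_distrib, Finset.mul_sum, Finset.sum_div,
    ← Finset.sum_add_distrib, Finset.mul_sum]
  refine (Finset.abs_sum_le_sum_abs _ _).trans (Finset.sum_le_sum fun j _ => ?_)
  rw [← mul_sub, abs_mul, abs_of_nonneg (by positivity : 0 ≤ ‖S i j‖ ^ 2)]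
  have h1 : |f (a i) - f (b j)| ≤ K * |a i - b j| := by
    simpa [Real.dist_eq] using hf.dist_le_mul (a i) (b j)
  -- This trades the first moment of the coupling for the second, with `η` left free for later
  -- optimization.
  have h2 : |a i - b j| ≤ η + (a i - b j) ^ 2 / η := by
    rw [← sub_nonneg]
    have : η + (a i - b j) ^ 2 / η - |a i - b j|
        = (η ^ 2 + |a i - b j| ^ 2 - η * |a i - b j|) / η := by
      rw [sq_abs]; field_simp
    rw [this]
    apply div_nonneg _ hη.le
    nlinarith [sq_nonneg (η - |a i - b j|), abs_nonneg (a i - b j), sq_nonneg (η + |a i - b j|)]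
  calc ‖S i j‖ ^ 2 * |f (a i) - f (b j)|
      ≤ ‖S i j‖ ^ 2 * (K * (η + (a i - b j) ^ 2 / η)) := by
        refine mul_le_mul_of_nonneg_left (h1.trans ?_) (by positivity)
        exact mul_le_mul_of_nonneg_left h2 K.2
    _ = K * (η * ‖S i j‖ ^ 2 + ‖S i j‖ ^ 2 * (a i - b j) ^ 2 / η) := by ring

theorem continuous_hsSq : Continuous (hsSq : Matrix n m ℂ → ℝ) := by
  unfold hsSq
  fun_prop

/-- Spectral sums of Lipschitz functions are continuous on Hermitian matrices. -/
theorem continuous_specSum {Y : Type*} [TopologicalSpace Y] {f : ℝ → ℝ} {K : ℝ≥0}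
    (hf : LipschitzWith K f) {A : Y → Matrix n n ℂ} (hA : Continuous A)
    (hH : ∀ y, (A y).IsHermitian) : Continuous fun y => specSum f (A y) := by
  rw [continuous_iff_continuousAt]
  intro y₀
  rw [ContinuousAt, Metric.tendsto_nhds]
  intro ε hε
  -- Chosen so that `(K + 1) (η N + η) = ε / 2`, where `N` is the matrix size.
  set η : ℝ := ε / (2 * (K + 1) * (Fintype.card n + 1)) with hη
  have hη0 : 0 < η := by positivity
  have hc : Tendsto (fun y => hsSq (A y - A y₀)) (𝓝 y₀) (𝓝 0) := by
    have h : Continuous fun y => hsSq (A y - A y₀) :=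
      continuous_hsSq.comp (hA.sub continuous_const)
    have h0 : hsSq (A y₀ - A y₀) = 0 := by simp [hsSq]
    rw [← h0]
    exact h.tendsto y₀
  filter_upwards [hc.eventually_lt_const (show (0 : ℝ) < η ^ 2 by positivity)] with y hy
  rw [Real.dist_eq]
  refine (abs_specSum_sub_le hf (hH y) (hH y₀) hη0).trans_lt ?_
  have h1 : hsSq (A y - A y₀) / η < η := by
    rw [div_lt_iff₀ hη0, ← sq]; exact hy
  calc (K : ℝ) * (η * Fintype.card n + hsSq (A y - A y₀) / η)
      ≤ (K + 1) * (η * Fintype.card n + η) := by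
        have := hsSq_nonneg (A y - A y₀)
        apply mul_le_mul (by linarith) (by linarith) (by positivity) (by positivity)
    _ = ε / 2 := by rw [hη]; field_simp
    _ < ε := by linarith

end SpectralSums

end BandMatrix

end

noncomputable section

namespace BandMatrix

/-! ### The mean eigenvalue distribution as a probability measure -/

section EmpiricalMeasure

open Matrix

set_option linter.unusedSectionVars false

variable {ι : Type*} [Fintype ι] [DecidableEq ι]

/-- The matrix `(X + X*) / √2`, as a function of the family of entries of `X`. -/
def matrixOf {ι : Type*} (Z : ι × ι → ℂ) : Matrix ι ι ℂ := hermitize (of fun x y => Z (x, y))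

theorem matrixOf_isHermitian {ι : Type*} (Z : ι × ι → ℂ) : (matrixOf Z).IsHermitian :=
  hermitize_isHermitian _

theorem matrixOf_apply {ι : Type*} (Z : ι × ι → ℂ) (x y : ι) :
    matrixOf Z x y = (1 / √2 : ℝ) * (Z (x, y) + star (Z (y, x))) := by
  simp only [matrixOf, hermitize, Matrix.smul_apply, Matrix.add_apply, conjTranspose_apply,
    of_apply, Complex.real_smul]

theorem continuous_matrixOf {ι : Type*} : Continuous (matrixOf : (ι × ι → ℂ) → Matrix ι ι ℂ) := by
  refine continuous_matrix fun x y => ?_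
  simp only [matrixOf_apply, Complex.star_def]
  fun_prop

theorem norm_sq_matrixOf_apply_le {ι : Type*} (Z : ι × ι → ℂ) (x y : ι) :
    ‖matrixOf Z x y‖ ^ 2 ≤ ‖Z (x, y)‖ ^ 2 + ‖Z (y, x)‖ ^ 2 := by
  have h2 : (1 / √2 : ℝ) ^ 2 = 1 / 2 := by rw [div_pow, Real.sq_sqrt (by norm_num)]; norm_num
  rw [matrixOf_apply, norm_mul, mul_pow, Complex.norm_real, Real.norm_eq_abs, sq_abs, h2]
  have h := norm_add_le (Z (x, y)) (star (Z (y, x)))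
  rw [norm_star] at h
  have h' : ‖Z (x, y) + star (Z (y, x))‖ ^ 2 ≤ (‖Z (x, y)‖ + ‖Z (y, x)‖) ^ 2 :=
    pow_le_pow_left₀ (norm_nonneg _) h 2
  nlinarith [sq_nonneg (‖Z (x, y)‖ - ‖Z (y, x)‖)]

theorem continuous_specSum_matrixOf {f : ℝ → ℝ} {K : ℝ≥0} (hf : LipschitzWith K f) :
    Continuous fun Z : ι × ι → ℂ => specSum f (matrixOf Z) :=
  continuous_specSum hf continuous_matrixOf matrixOf_isHermitian

/-- A piecewise linear approximation of the indicator function of `(-∞, t]`. -/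
def ramp (t : ℝ) (k : ℕ) (x : ℝ) : ℝ := max (1 - (k + 1) * max (x - t) 0) 0

theorem lipschitzWith_ramp (t : ℝ) (k : ℕ) : LipschitzWith (k + 1) (ramp t k) := by
  refine LipschitzWith.of_dist_le_mul fun x y => ?_
  rw [Real.dist_eq, Real.dist_eq]
  refine (abs_max_sub_max_le_abs _ _ _).trans ?_
  have h : 1 - ((k : ℝ) + 1) * max (x - t) 0 - (1 - ((k : ℝ) + 1) * max (y - t) 0)
      = (k + 1) * (max (y - t) 0 - max (x - t) 0) := by ring
  rw [h, abs_mul, abs_of_nonneg (by positivity : (0 : ℝ) ≤ k + 1)]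
  push_cast
  refine mul_le_mul_of_nonneg_left ((abs_max_sub_max_le_abs _ _ _).trans_eq ?_) (by positivity)
  rw [abs_sub_comm]
  congr 1
  ring

theorem tendsto_ramp (t x : ℝ) :
    Tendsto (fun k => ramp t k x) atTop (𝓝 ((Set.Iic t).indicator 1 x)) := by
  rcases le_or_gt x t with h | h
  · have : (fun k => ramp t k x) = fun _ => 1 := by
      ext k
      rw [ramp, max_eq_right (by linarith : x - t ≤ 0)]
      simp
    rw [this, Set.indicator_of_mem (show x ∈ Set.Iic t from h)]
    exact tendsto_const_nhds
  · rw [Set.indicator_of_notMem (show x ∉ Set.Iic t from not_le.2 h)]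
    refine tendsto_const_nhds.congr' ?_
    obtain ⟨N, hN⟩ := exists_nat_gt (1 / (x - t))
    filter_upwards [eventually_ge_atTop N] with k hk
    have hxt : 0 < x - t := by linarith
    rw [div_lt_iff₀ hxt] at hN
    have hk' : (N : ℝ) ≤ k := by exact_mod_cast hk
    rw [ramp, max_eq_left hxt.le, max_eq_right]
    nlinarith

variable [Nonempty ι]

/-- The normalised eigenvalue counting measure. -/
def empiricalMeasure (Z : ι × ι → ℂ) : Measure ℝ :=
  (Fintype.card ι : ℝ≥0∞)⁻¹ • ∑ i, Measure.dirac ((matrixOf_isHermitian Z).eigenvalues i)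

theorem empiricalMeasure_apply (Z : ι × ι → ℂ) {s : Set ℝ} (hs : MeasurableSet s) :
    empiricalMeasure Z s = eigenvalueCount (matrixOf_isHermitian Z) s / Fintype.card ι := by
  classical
  rw [empiricalMeasure, Measure.smul_apply, Measure.finsetSum_apply, smul_eq_mul, mul_comm,
    ← div_eq_mul_inv, eigenvalueCount_eq, Finset.card_filter]
  congr 1
  push_cast
  refine Finset.sum_congr rfl fun i _ => ?_
  rw [Measure.dirac_apply' _ hs, Set.indicator_apply]
  simp

instance (Z : ι × ι → ℂ) : IsProbabilityMeasure (empiricalMeasure Z) := by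
  refine ⟨?_⟩
  classical
  rw [empiricalMeasure_apply _ MeasurableSet.univ, eigenvalueCount_eq]
  simp only [Set.mem_univ, Finset.filter_true, Finset.card_univ]
  exact ENNReal.div_self (by simp) (by simp)

theorem lintegral_empiricalMeasure (Z : ι × ι → ℂ) (f : ℝ → ℝ≥0∞) :
    ∫⁻ x, f x ∂empiricalMeasure Z
      = (∑ i, f ((matrixOf_isHermitian Z).eigenvalues i)) / Fintype.card ι := by
  rw [empiricalMeasure, lintegral_smul_measure, lintegral_finsetSum_measure]
  simp only [lintegral_dirac, smul_eq_mul]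
  rw [mul_comm, ← div_eq_mul_inv]

theorem integral_empiricalMeasure (Z : ι × ι → ℂ) (f : ℝ → ℝ) :
    ∫ x, f x ∂empiricalMeasure Z = specSum f (matrixOf Z) / Fintype.card ι := by
  rw [empiricalMeasure, integral_smul_measure, integral_finsetSum_measure,
    specSum_eq f (matrixOf_isHermitian Z)]
  · simp only [integral_dirac, smul_eq_mul]
    rw [ENNReal.toReal_inv, ENNReal.toReal_natCast, div_eq_inv_mul]
  · intro i _
    exact integrable_dirac (by simp)

/-- Half-lines form a generating π-system, and the count on `(-∞, t]` is a pointwise limit of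
Lipschitz spectral sums, which are continuous in the entries. No measurable choice of eigenvalues is
needed. -/
theorem measurable_empiricalMeasure :
    Measurable (empiricalMeasure : (ι × ι → ℂ) → Measure ℝ) := by
  refine .measure_of_isPiSystem_of_isProbabilityMeasure (borel_eq_generateFrom_Iic ℝ)
    isPiSystem_Iic ?_
  rintro _ ⟨t, rfl⟩
  have hlim : Measurable fun Z : ι × ι → ℂ =>
      ∑ i, (Set.Iic t).indicator (1 : ℝ → ℝ) ((matrixOf_isHermitian Z).eigenvalues i) := by
    refine measurable_of_tendsto_metrizable (f := fun k Z => specSum (ramp t k) (matrixOf Z))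
      (fun k => (continuous_specSum_matrixOf (lipschitzWith_ramp t k)).measurable) ?_
    rw [tendsto_pi_nhds]
    intro Z
    simp only [specSum_eq _ (matrixOf_isHermitian Z)]
    exact tendsto_finsetSum _ fun i _ => tendsto_ramp t _
  have h : (fun Z : ι × ι → ℂ => empiricalMeasure Z (Set.Iic t)) = fun Z => ENNReal.ofReal
      (∑ i, (Set.Iic t).indicator (1 : ℝ → ℝ) ((matrixOf_isHermitian Z).eigenvalues i))
        / Fintype.card ι := by
    classical
    ext Z
    rw [empiricalMeasure_apply _ measurableSet_Iic, eigenvalueCount_eq, Finset.card_filter,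
      ← ENNReal.ofReal_natCast]
    push_cast
    congr 2
  rw [h]
  exact hlim.ennreal_ofReal.div_const _

/-- The normalised eigenvalue counting measure as a kernel. -/
def empiricalKernel : Kernel (ι × ι → ℂ) ℝ := ⟨empiricalMeasure, measurable_empiricalMeasure⟩

/-- The mean of the normalised eigenvalue counting measure. -/
def meanSpectral (μ : Measure (ι × ι → ℂ)) : Measure ℝ := μ.bind empiricalKernel

instance (μ : Measure (ι × ι → ℂ)) [IsProbabilityMeasure μ] :
    IsProbabilityMeasure (meanSpectral μ) := by
  refine ⟨?_⟩
  rw [meanSpectral, Measure.bind_apply MeasurableSet.univ empiricalKernel.measurable.aemeasurable]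
  have : ∀ Z : ι × ι → ℂ, empiricalKernel Z Set.univ = 1 := fun Z =>
    measure_univ (μ := empiricalMeasure Z)
  simp [this]

theorem meanSpectral_apply (μ : Measure (ι × ι → ℂ)) {s : Set ℝ} (hs : MeasurableSet s) :
    meanSpectral μ s
      = (∫⁻ Z, eigenvalueCount (matrixOf_isHermitian Z) s ∂μ) / Fintype.card ι := by
  rw [meanSpectral, Measure.bind_apply hs empiricalKernel.measurable.aemeasurable]
  have : ∀ Z : ι × ι → ℂ, empiricalKernel Z s
      = eigenvalueCount (matrixOf_isHermitian Z) s / Fintype.card ι := fun Z =>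
    empiricalMeasure_apply Z hs
  simp only [this, div_eq_mul_inv]
  rw [lintegral_mul_const']
  simp

theorem measurable_eigenvalueCount {s : Set ℝ} (hs : MeasurableSet s) :
    Measurable fun Z : ι × ι → ℂ => (eigenvalueCount (matrixOf_isHermitian Z) s : ℝ≥0∞) := by
  have h : (fun Z : ι × ι → ℂ => (eigenvalueCount (matrixOf_isHermitian Z) s : ℝ≥0∞))
      = fun Z => empiricalMeasure Z s * Fintype.card ι := by
    ext Z
    rw [empiricalMeasure_apply Z hs, ENNReal.div_mul_cancel (by simp) (by simp)]
  rw [h]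
  exact ((Measure.measurable_coe hs).comp measurable_empiricalMeasure).mul_const _

theorem lintegral_sq_meanSpectral (μ : Measure (ι × ι → ℂ)) :
    ∫⁻ x, ENNReal.ofReal (x ^ 2) ∂meanSpectral μ
      = (∫⁻ Z, ENNReal.ofReal (hsSq (matrixOf Z)) ∂μ) / Fintype.card ι := by
  rw [meanSpectral, Measure.lintegral_bind empiricalKernel.measurable.aemeasurable (by fun_prop)]
  have : ∀ Z : ι × ι → ℂ, ∫⁻ x, ENNReal.ofReal (x ^ 2) ∂empiricalKernel Z
      = ENNReal.ofReal (hsSq (matrixOf Z)) / Fintype.card ι := by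
    intro Z
    refine (lintegral_empiricalMeasure Z _).trans ?_
    rw [← sum_eigenvalues_sq (matrixOf_isHermitian Z), ENNReal.ofReal_sum_of_nonneg]
    exact fun i _ => sq_nonneg _
  simp only [this, div_eq_mul_inv]
  rw [lintegral_mul_const']
  simp

theorem integral_meanSpectral (μ : Measure (ι × ι → ℂ)) [IsProbabilityMeasure μ] {f : ℝ → ℝ}
    {F : ℝ} (hF : ∀ x, |f x| ≤ F) (hf : Measurable f) :
    ∫ x, f x ∂meanSpectral μ = (∫ Z, specSum f (matrixOf Z) ∂μ) / Fintype.card ι := by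
  have hc : (empiricalKernel ∘ₖ Kernel.const Unit μ) () = meanSpectral μ := by
    rw [Kernel.comp_apply, Kernel.const_apply, meanSpectral]
  have hint : Integrable f (meanSpectral μ) :=
    Integrable.of_bound hf.aestronglyMeasurable F (ae_of_all _ hF)
  rw [← hc, Kernel.integral_comp (by rwa [hc]), Kernel.const_apply, ← integral_div]
  exact integral_congr_ae (ae_of_all _ fun Z => integral_empiricalMeasure Z f)

end EmpiricalMeasure

end BandMatrix

end

noncomputable section

namespace BandMatrix

/-! ### Dropping off-diagonal blocks of a Gaussian matrix -/

section BlockComparison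

open Matrix

set_option linter.unusedSectionVars false

theorem integral_sq_gaussianReal (v : ℝ≥0) :
    Integrable (fun x : ℝ => x ^ 2) (gaussianReal 0 v) ∧ ∫ x, x ^ 2 ∂gaussianReal 0 v = v := by
  have hm : MemLp id 2 (gaussianReal 0 v) := memLp_id_gaussianReal 2
  refine ⟨hm.integrable_sq, ?_⟩
  have h := variance_id_gaussianReal (μ := 0) (v := v)
  rw [variance_eq_integral aemeasurable_id] at h
  simpa using h

theorem integral_norm_sq_entryLaw (σ : SymmetryClass) (v : ℝ≥0) :
    Integrable (fun z : ℂ => ‖z‖ ^ 2) (entryLaw σ v) ∧ ∫ z, ‖z‖ ^ 2 ∂entryLaw σ v = v := by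
  cases σ with
  | orthogonal =>
    have hm : Measurable (fun t : ℝ => (t : ℂ)) := Complex.measurable_ofReal
    have hs : AEStronglyMeasurable (fun z : ℂ => ‖z‖ ^ 2)
        ((gaussianReal 0 v).map (fun t : ℝ => (t : ℂ))) :=
      (Continuous.aestronglyMeasurable (by fun_prop))
    obtain ⟨h1, h2⟩ := integral_sq_gaussianReal v
    constructor
    · refine (integrable_map_measure hs hm.aemeasurable).2 ?_
      simpa [Function.comp_def] using h1
    · rw [entryLaw, integral_map hm.aemeasurable hs]
      simpa using h2
  | unitary =>
    have hm : Measurable (fun p : ℝ × ℝ => (⟨p.1, p.2⟩ : ℂ)) :=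
      Complex.measurableEquivRealProd.symm.measurable
    have hs : AEStronglyMeasurable (fun z : ℂ => ‖z‖ ^ 2)
        (((gaussianReal 0 (v / 2)).prod (gaussianReal 0 (v / 2))).map
          (fun p : ℝ × ℝ => (⟨p.1, p.2⟩ : ℂ))) :=
      (Continuous.aestronglyMeasurable (by fun_prop))
    obtain ⟨h1, h2⟩ := integral_sq_gaussianReal (v / 2)
    have hn : ∀ p : ℝ × ℝ, ‖(⟨p.1, p.2⟩ : ℂ)‖ ^ 2 = p.1 ^ 2 + p.2 ^ 2 := by
      intro p
      rw [← Complex.normSq_eq_norm_sq, Complex.normSq_apply, sq, sq]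
    have i1 : Integrable (fun p : ℝ × ℝ => p.1 ^ 2)
        ((gaussianReal 0 (v / 2)).prod (gaussianReal 0 (v / 2))) := h1.comp_fst _
    have i2 : Integrable (fun p : ℝ × ℝ => p.2 ^ 2)
        ((gaussianReal 0 (v / 2)).prod (gaussianReal 0 (v / 2))) := h1.comp_snd _
    constructor
    · refine (integrable_map_measure hs hm.aemeasurable).2 ?_
      simp only [Function.comp_def, hn]
      exact i1.add i2
    · rw [entryLaw, integral_map hm.aemeasurable hs]
      simp only [hn]
      rw [integral_add i1 i2, integral_fun_fst (fun x : ℝ => x ^ 2),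
        integral_fun_snd (fun x : ℝ => x ^ 2), h2]
      simp

variable {ι : Type*} [Fintype ι] [DecidableEq ι]

theorem integral_norm_sq_apply (σ : SymmetryClass) (v : ι × ι → ℝ≥0) (p : ι × ι) :
    Integrable (fun Z : ι × ι → ℂ => ‖Z p‖ ^ 2) (Measure.pi fun p => entryLaw σ (v p)) ∧
      ∫ Z, ‖Z p‖ ^ 2 ∂(Measure.pi fun p => entryLaw σ (v p)) = v p := by
  have hmp := measurePreserving_eval (fun p => entryLaw σ (v p)) p
  obtain ⟨h1, h2⟩ := integral_norm_sq_entryLaw σ (v p)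
  constructor
  · exact hmp.integrable_comp_of_integrable h1
  · rw [← h2, ← hmp.map_eq, integral_map hmp.measurable.aemeasurable
      (Continuous.aestronglyMeasurable (by fun_prop))]

variable {α : Type*} [LinearOrder α]

/-- The block-diagonal part of a matrix. -/
def blockPart (κ : ι → α) (A : Matrix ι ι ℂ) : Matrix ι ι ℂ :=
  of fun x y => if κ x = κ y then A x y else 0

theorem blockPart_isHermitian (κ : ι → α) {A : Matrix ι ι ℂ} (hA : A.IsHermitian) :
    (blockPart κ A).IsHermitian := by
  ext x y
  rw [conjTranspose_apply, blockPart, of_apply, of_apply]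
  by_cases h : κ x = κ y
  · rw [if_pos h, if_pos h.symm]; exact hA.apply x y
  · rw [if_neg h, if_neg (Ne.symm h), star_zero]

theorem continuous_blockPart (κ : ι → α) :
    Continuous (blockPart κ : Matrix ι ι ℂ → Matrix ι ι ℂ) := by
  refine continuous_matrix fun x y => ?_
  simp only [blockPart, of_apply]
  split_ifs
  · fun_prop
  · exact continuous_const

theorem specSum_blockPart (f : ℝ → ℝ) (κ : ι → α) (A : Matrix ι ι ℂ) :
    specSum f (blockPart κ A)
      = ∑ a ∈ Finset.univ.image κ, specSum f (A.toSquareBlock κ a) := by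
  rw [specSum_eq_sum_toSquareBlock f (κ := κ)]
  · refine Finset.sum_congr rfl fun a _ => ?_
    congr 1
    ext x y
    simp [toSquareBlock, toSquareBlockProp, blockPart, x.2, y.2]
  · intro x y h
    simp [blockPart, h.ne']

/-- Each Hermitian entry is bounded by the two entries of `X` it is made of, and the symmetry of `r`
identifies the two resulting sums. Same-block `r` handles the discarded part, empty `r` the whole
matrix. -/
theorem integral_sum_norm_sq_matrixOf_le (σ : SymmetryClass) (v : ι × ι → ℝ≥0)
    (r : ι → ι → Prop) [DecidableRel r] (hr : ∀ x y, r x y → r y x) :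
    Integrable (fun Z => ∑ x, ∑ y, if r x y then 0 else ‖matrixOf Z x y‖ ^ 2)
      (Measure.pi fun p => entryLaw σ (v p)) ∧
    ∫ Z, (∑ x, ∑ y, if r x y then 0 else ‖matrixOf Z x y‖ ^ 2)
        ∂(Measure.pi fun p => entryLaw σ (v p))
      ≤ 2 * ∑ x, ∑ y, if r x y then 0 else (v (x, y) : ℝ) := by
  set g : (ι × ι → ℂ) → ℝ := fun Z =>
    ∑ x, ∑ y, if r x y then 0 else (‖Z (x, y)‖ ^ 2 + ‖Z (y, x)‖ ^ 2) with hg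
  have hle : ∀ Z, (∑ x, ∑ y, if r x y then 0 else ‖matrixOf Z x y‖ ^ 2) ≤ g Z := by
    intro Z
    refine Finset.sum_le_sum fun x _ => Finset.sum_le_sum fun y _ => ?_
    split_ifs
    · exact le_rfl
    · exact norm_sq_matrixOf_apply_le Z x y
  have hterm : ∀ x y, Integrable (fun Z : ι × ι → ℂ =>
      if r x y then 0 else (‖Z (x, y)‖ ^ 2 + ‖Z (y, x)‖ ^ 2))
      (Measure.pi fun p => entryLaw σ (v p)) := by
    intro x y
    split_ifs
    · exact integrable_zero _ _ _
    · exact (integral_norm_sq_apply σ v _).1.add (integral_norm_sq_apply σ v _).1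
  have hgint : Integrable g (Measure.pi fun p => entryLaw σ (v p)) :=
    integrable_finsetSum _ fun x _ => integrable_finsetSum _ fun y _ => hterm x y
  have hint : Integrable (fun Z => ∑ x, ∑ y, if r x y then 0 else ‖matrixOf Z x y‖ ^ 2)
      (Measure.pi fun p => entryLaw σ (v p)) := by
    refine hgint.mono' (Continuous.aestronglyMeasurable ?_) (ae_of_all _ fun Z => ?_)
    · refine continuous_finsetSum _ fun x _ => continuous_finsetSum _ fun y _ => ?_
      split_ifs
      · exact continuous_const
      · exact ((continuous_matrixOf.matrix_elem x y).norm).pow 2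
    · rw [Real.norm_eq_abs, abs_of_nonneg]
      · exact hle Z
      · exact Finset.sum_nonneg fun x _ => Finset.sum_nonneg fun y _ => by positivity
  refine ⟨hint, (integral_mono hint hgint hle).trans_eq ?_⟩
  rw [hg, integral_finsetSum _ fun x _ => integrable_finsetSum _ fun y _ => hterm x y]
  have h1 : ∀ x, ∫ Z : ι × ι → ℂ, (∑ y, if r x y then 0 else
      (‖Z (x, y)‖ ^ 2 + ‖Z (y, x)‖ ^ 2)) ∂(Measure.pi fun p => entryLaw σ (v p))
      = ∑ y, ((if r x y then 0 else (v (x, y) : ℝ)) +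
        (if r y x then 0 else (v (y, x) : ℝ))) := by
    intro x
    rw [integral_finsetSum _ fun y _ => hterm x y]
    refine Finset.sum_congr rfl fun y _ => ?_
    by_cases h : r x y
    · simp [h, hr x y h]
    · simp only [if_neg h, if_neg fun h' => h (hr y x h')]
      rw [integral_add (integral_norm_sq_apply σ v _).1 (integral_norm_sq_apply σ v _).1,
        (integral_norm_sq_apply σ v _).2, (integral_norm_sq_apply σ v _).2]
  simp only [h1, Finset.sum_add_distrib]
  rw [Finset.sum_comm (f := fun x y => if r y x then 0 else (v (y, x) : ℝ)), two_mul]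

theorem integral_hsSq_sub_blockPart_le (σ : SymmetryClass) (v : ι × ι → ℝ≥0) (κ : ι → α) :
    Integrable (fun Z => hsSq (matrixOf Z - blockPart κ (matrixOf Z)))
      (Measure.pi fun p => entryLaw σ (v p)) ∧
    ∫ Z, hsSq (matrixOf Z - blockPart κ (matrixOf Z)) ∂(Measure.pi fun p => entryLaw σ (v p))
      ≤ 2 * ∑ x, ∑ y, if κ x = κ y then 0 else (v (x, y) : ℝ) := by
  have h : ∀ Z : ι × ι → ℂ, hsSq (matrixOf Z - blockPart κ (matrixOf Z))
      = ∑ x, ∑ y, if κ x = κ y then 0 else ‖matrixOf Z x y‖ ^ 2 := by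
    intro Z
    refine Finset.sum_congr rfl fun x _ => Finset.sum_congr rfl fun y _ => ?_
    rw [Matrix.sub_apply, blockPart, of_apply]
    split_ifs <;> simp
  simp only [h]
  exact integral_sum_norm_sq_matrixOf_le σ v (fun x y => κ x = κ y) fun x y h => h.symm

theorem lintegral_hsSq_matrixOf_le (σ : SymmetryClass) (v : ι × ι → ℝ≥0) :
    ∫⁻ Z, ENNReal.ofReal (hsSq (matrixOf Z)) ∂(Measure.pi fun p => entryLaw σ (v p))
      ≤ ENNReal.ofReal (2 * ∑ x, ∑ y, (v (x, y) : ℝ)) := by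
  have h := integral_sum_norm_sq_matrixOf_le σ v (fun _ _ => False) fun _ _ h => h
  simp only [if_false] at h
  simp only [hsSq]
  rw [← ofReal_integral_eq_lintegral_ofReal h.1 (ae_of_all _ fun Z => hsSq_nonneg (matrixOf Z))]
  exact ENNReal.ofReal_le_ofReal h.2

theorem integrable_specSum_of_continuous {f : ℝ → ℝ} {F : ℝ} (hF : ∀ x, |f x| ≤ F)
    {Y : Type*} [TopologicalSpace Y] [MeasurableSpace Y] [OpensMeasurableSpace Y]
    (μ : Measure Y) [IsProbabilityMeasure μ] {A : Y → Matrix ι ι ℂ}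
    (hA : ∀ y, (A y).IsHermitian) (hc : Continuous fun y => specSum f (A y)) :
    Integrable (fun y => specSum f (A y)) μ :=
  Integrable.of_bound hc.aestronglyMeasurable _ (ae_of_all _ fun y => abs_specSum_le hF (hA y))

/-- The effect of dropping the off-diagonal blocks of a Gaussian matrix. -/
theorem abs_integral_specSum_sub_blockPart_le (σ : SymmetryClass) (v : ι × ι → ℝ≥0) (κ : ι → α)
    {f : ℝ → ℝ} {F : ℝ} (hF : ∀ x, |f x| ≤ F) {K : ℝ≥0} (hf : LipschitzWith K f) {η : ℝ}
    (hη : 0 < η) :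
    |∫ Z, specSum f (matrixOf Z) ∂(Measure.pi fun p => entryLaw σ (v p))
        - ∫ Z, specSum f (blockPart κ (matrixOf Z)) ∂(Measure.pi fun p => entryLaw σ (v p))|
      ≤ K * (η * Fintype.card ι
        + 2 * (∑ x, ∑ y, if κ x = κ y then 0 else (v (x, y) : ℝ)) / η) := by
  obtain ⟨hint, hle⟩ := integral_hsSq_sub_blockPart_le σ v κ
  have i1 := integrable_specSum_of_continuous hF (Measure.pi fun p => entryLaw σ (v p))
    (fun Z => matrixOf_isHermitian Z) (continuous_specSum_matrixOf hf)
  have i2 := integrable_specSum_of_continuous hF (Measure.pi fun p => entryLaw σ (v p))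
    (fun Z => blockPart_isHermitian κ (matrixOf_isHermitian Z))
    (continuous_specSum hf ((continuous_blockPart κ).comp continuous_matrixOf)
      fun Z => blockPart_isHermitian κ (matrixOf_isHermitian Z))
  rw [← integral_sub i1 i2, ← Real.norm_eq_abs]
  have i3 : Integrable (fun Z => (K : ℝ) * (η * Fintype.card ι
      + hsSq (matrixOf Z - blockPart κ (matrixOf Z)) / η))
      (Measure.pi fun p => entryLaw σ (v p)) :=
    ((integrable_const _).add (hint.div_const _)).const_mul _
  refine (norm_integral_le_of_norm_le i3 (ae_of_all _ fun Z => ?_)).trans ?_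
  · exact abs_specSum_sub_le hf (matrixOf_isHermitian Z)
      (blockPart_isHermitian κ (matrixOf_isHermitian Z)) hη
  · rw [integral_const_mul, integral_add (integrable_const _) (hint.div_const _), integral_div]
    simp only [integral_const, probReal_univ, one_smul]
    gcongr

/-- The spectral sum of a diagonal block in terms of a copy of the block. -/
theorem integral_specSum_toSquareBlock (σ : SymmetryClass) (v : ι × ι → ℝ≥0) (κ : ι → α) (a : α)
    {β : Type*} [Fintype β] [DecidableEq β] (e : β ≃ {x // κ x = a}) (f : ℝ → ℝ) {K : ℝ≥0}
    (hf : LipschitzWith K f) :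
    ∫ Z, specSum f ((matrixOf Z).toSquareBlock κ a) ∂(Measure.pi fun p => entryLaw σ (v p))
      = ∫ Z, specSum f (matrixOf Z)
        ∂(Measure.pi fun q : β × β => entryLaw σ (v (e q.1, e q.2))) := by
  have hinj : Function.Injective fun q : β × β => ((e q.1 : ι), (e q.2 : ι)) := by
    rintro ⟨x, y⟩ ⟨x', y'⟩ h
    simp only [Prod.mk.injEq] at h
    have h1 := e.injective (Subtype.ext h.1)
    have h2 := e.injective (Subtype.ext h.2)
    rw [h1, h2]
  have hmap := pi_map_comp_injective (fun p => entryLaw σ (v p)) hinj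
  have hmeas : Measurable fun (Z : ι × ι → ℂ) (q : β × β) => Z ((e q.1 : ι), (e q.2 : ι)) := by
    fun_prop
  rw [← hmap, integral_map hmeas.aemeasurable
    (continuous_specSum_matrixOf hf).aestronglyMeasurable]
  refine integral_congr_ae (ae_of_all _ fun Z => ?_)
  change specSum f ((matrixOf Z).toSquareBlock κ a) = _
  rw [← specSum_submatrix_equiv f _ e]
  congr 1

/-- The blocks of `G` contribute exactly `J` each. Any other block contributes at most `F` times its
size, and these sizes sum to the number of sites not covered by `G`. -/
theorem abs_integral_specSum_blockPart_sub_le (σ : SymmetryClass) (v : ι × ι → ℝ≥0) (κ : ι → α)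
    {f : ℝ → ℝ} {F : ℝ} (hF : ∀ x, |f x| ≤ F) {K : ℝ≥0} (hf : LipschitzWith K f)
    {G : Finset α} (hG : G ⊆ Finset.univ.image κ) {m : ℕ} {J : ℝ}
    (hcard : ∀ a ∈ G, (Finset.univ.filter fun x => κ x = a).card = m)
    (hJ : ∀ a ∈ G, ∫ Z, specSum f ((matrixOf Z).toSquareBlock κ a)
      ∂(Measure.pi fun p => entryLaw σ (v p)) = J) :
    |∫ Z, specSum f (blockPart κ (matrixOf Z)) ∂(Measure.pi fun p => entryLaw σ (v p)) - G.card * J|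
      ≤ F * (Fintype.card ι - G.card * m) := by
  have hH : ∀ (a : α) (Z : ι × ι → ℂ), ((matrixOf Z).toSquareBlock κ a).IsHermitian :=
    fun a Z => (matrixOf_isHermitian Z).submatrix _
  have hcont : ∀ a : α, Continuous fun Z : ι × ι → ℂ =>
      specSum f ((matrixOf Z).toSquareBlock κ a) := fun a =>
    continuous_specSum hf (continuous_matrixOf.matrix_submatrix _ _) (hH a)
  have hint : ∀ a : α, Integrable (fun Z => specSum f ((matrixOf Z).toSquareBlock κ a))
      (Measure.pi fun p => entryLaw σ (v p)) := fun a =>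
    integrable_specSum_of_continuous hF _ (hH a) (hcont a)
  have hbd : ∀ a : α, |∫ Z, specSum f ((matrixOf Z).toSquareBlock κ a)
      ∂(Measure.pi fun p => entryLaw σ (v p))|
        ≤ F * (Finset.univ.filter fun x => κ x = a).card := by
    intro a
    rw [← Real.norm_eq_abs]
    refine (norm_integral_le_of_norm_le (integrable_const _)
      (ae_of_all _ fun Z => abs_specSum_le hF (hH a Z))).trans_eq ?_
    rw [integral_const, probReal_univ, one_smul, Fintype.card_subtype]
  have htot : (Fintype.card ι : ℝ)
      = ∑ a ∈ Finset.univ.image κ, ((Finset.univ.filter fun x => κ x = a).card : ℝ) := by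
    have := Finset.card_eq_sum_card_fiberwise (s := (Finset.univ : Finset ι)) (f := κ)
      (t := Finset.univ.image κ) (fun i _ => Finset.mem_coe.2 (Finset.mem_image_of_mem κ (Finset.mem_univ i)))
    rw [← Finset.card_univ, this]
    push_cast
    rfl
  simp only [specSum_blockPart]
  rw [integral_finsetSum _ fun a _ => hint a, htot, ← Finset.sum_sdiff hG,
    ← Finset.sum_sdiff (f := fun a => ((Finset.univ.filter fun x => κ x = a).card : ℝ)) hG,
    Finset.sum_congr rfl hJ, Finset.sum_const, nsmul_eq_mul, add_sub_cancel_right,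
    Finset.sum_congr (s₁ := G) rfl fun a ha => congrArg (Nat.cast (R := ℝ)) (hcard a ha),
    Finset.sum_const, nsmul_eq_mul, add_sub_cancel_right, Finset.mul_sum]
  exact (Finset.abs_sum_le_sum_abs _ _).trans (Finset.sum_le_sum fun a _ => hbd a)

end BlockComparison

end BandMatrix

end

noncomputable section

namespace BandMatrix

/-! ### Tilings of the box by cubes -/

section BoxCounting

variable {d : ℕ}

/-- A point of a fixed residue class is determined by its quotient, which takes at most `⌊2L / s⌋ +
1` values; `s ≤ 2L + 1` absorbs the extra one into the factor `2`. -/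
theorem mul_card_filter_dvd_le (L : ℕ) {s : ℕ} (hs : 0 < s) (hsL : s ≤ 2 * L + 1) (j : ℤ) :
    s * ((Finset.Icc (-(L : ℤ)) L).filter fun t => (s : ℤ) ∣ t + L - j).card
      ≤ 2 * (2 * L + 1) := by
  have hs' : (0 : ℤ) < s := by exact_mod_cast hs
  have h : ((Finset.Icc (-(L : ℤ)) L).filter fun t => (s : ℤ) ∣ t + L - j).card
      ≤ (Finset.range ((2 * L) / s + 1)).card := by
    refine Finset.card_le_card_of_injOn (fun t => ((t + L) / s).toNat) ?_ ?_
    · intro t ht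
      simp only [Finset.coe_filter, Finset.mem_Icc, Set.mem_ofPred_eq] at ht
      simp only [Finset.coe_range, Set.mem_Iio]
      have h1 : (t + L) / (s : ℤ) ≤ (2 * L) / s := Int.ediv_le_ediv hs' (by omega)
      refine Nat.lt_succ_of_le (Int.toNat_le.2 ?_)
      push_cast
      exact h1
    · intro t ht u hu htu
      simp only [Finset.coe_filter, Finset.mem_Icc, Set.mem_ofPred_eq] at ht hu
      simp only at htu
      have ht0 : 0 ≤ (t + L) / (s : ℤ) := Int.ediv_nonneg (by omega) hs'.le
      have hu0 : 0 ≤ (u + L) / (s : ℤ) := Int.ediv_nonneg (by omega) hs'.le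
      have hq : (t + L) / (s : ℤ) = (u + L) / s := by omega
      have hmod : (t + L) % (s : ℤ) = (u + L) % s := by
        have h3 : (s : ℤ) ∣ (t + L) - (u + L) := by
          have := dvd_sub ht.2 hu.2
          ring_nf at this ⊢
          exact this
        exact (Int.emod_emod_of_dvd _ dvd_rfl).symm.trans
          (by rw [Int.emod_emod_of_dvd _ dvd_rfl]; exact Int.emod_eq_emod_iff_emod_sub_eq_zero.2 (Int.emod_eq_zero_of_dvd h3))
      have e1 := Int.mul_ediv_add_emod (t + L) s
      have e2 := Int.mul_ediv_add_emod (u + L) s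
      rw [hq, hmod] at e1
      omega
  rw [Finset.card_range] at h
  calc _ ≤ s * ((2 * L) / s + 1) := Nat.mul_le_mul_left _ h
    _ = s * ((2 * L) / s) + s := by ring
    _ ≤ 2 * L + s := Nat.add_le_add_right (Nat.mul_div_le _ _) _
    _ ≤ _ := by omega

/-- A shift by `z` changes the quotient only by crossing a multiple of `s`, which confines `t + L`
to at most `|z|` residue classes. -/
theorem mul_card_filter_ediv_ne_le (L : ℕ) {s : ℕ} (hs : 0 < s) (hsL : s ≤ 2 * L + 1) (z : ℤ) :
    s * ((Finset.Icc (-(L : ℤ)) L).filter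
      fun t => (t + L) / (s : ℤ) ≠ (t - z + L) / s).card ≤ z.natAbs * (2 * (2 * L + 1)) := by
  have hs' : (0 : ℤ) < s := by exact_mod_cast hs
  have hsub : ((Finset.Icc (-(L : ℤ)) L).filter
      fun t => (t + L) / (s : ℤ) ≠ (t - z + L) / s) ⊆
      (Finset.Ico (min 0 z) (max 0 z)).biUnion fun j =>
        (Finset.Icc (-(L : ℤ)) L).filter fun t => (s : ℤ) ∣ t + L - j := by
    intro t ht
    simp only [Finset.mem_filter] at ht
    simp only [Finset.mem_biUnion, Finset.mem_filter, Finset.mem_Ico]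
    have e1 := Int.mul_ediv_add_emod (t + L) s
    have e2 := Int.mul_ediv_add_emod (t - z + L) s
    have f1 := Int.emod_nonneg (t + L) hs'.ne'
    have f2 := Int.emod_nonneg (t - z + L) hs'.ne'
    have g1 := Int.emod_lt_of_pos (t + L) hs'
    have g2 := Int.emod_lt_of_pos (t - z + L) hs'
    rcases le_total 0 z with hz | hz
    · refine ⟨t + L - s * ((t + L) / s), ⟨?_, ?_⟩, ht.1, ?_⟩
      · rw [min_eq_left hz]; omega
      · rw [max_eq_right hz]
        have hle : (t - z + L) / (s : ℤ) ≤ (t + L) / s := Int.ediv_le_ediv hs' (by omega)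
        have hlt : (t - z + L) / (s : ℤ) + 1 ≤ (t + L) / s := by
          have := ht.2; omega
        have := mul_le_mul_of_nonneg_left hlt hs'.le
        rw [mul_add, mul_one] at this
        omega
      · rw [sub_sub_cancel]; exact dvd_mul_right _ _
    · refine ⟨t + L - s * ((t - z + L) / s), ⟨?_, ?_⟩, ht.1, ?_⟩
      · rw [min_eq_right hz]; omega
      · rw [max_eq_left hz]
        have hle : (t + L) / (s : ℤ) ≤ (t - z + L) / s := Int.ediv_le_ediv hs' (by omega)
        have hlt : (t + L) / (s : ℤ) + 1 ≤ (t - z + L) / s := by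
          have := ht.2; omega
        have := mul_le_mul_of_nonneg_left hlt hs'.le
        rw [mul_add, mul_one] at this
        omega
      · rw [sub_sub_cancel]; exact dvd_mul_right _ _
  have hcard : (Finset.Ico (min 0 z) (max 0 z)).card = z.natAbs := by
    rw [Int.card_Ico]; omega
  calc _ ≤ s * ∑ j ∈ Finset.Ico (min 0 z) (max 0 z),
        ((Finset.Icc (-(L : ℤ)) L).filter fun t => (s : ℤ) ∣ t + L - j).card :=
        Nat.mul_le_mul_left _ ((Finset.card_le_card hsub).trans Finset.card_biUnion_le)
    _ = ∑ j ∈ Finset.Ico (min 0 z) (max 0 z),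
        s * ((Finset.Icc (-(L : ℤ)) L).filter fun t => (s : ℤ) ∣ t + L - j).card :=
        Finset.mul_sum _ _ _
    _ ≤ ∑ j ∈ Finset.Ico (min 0 z) (max 0 z), 2 * (2 * L + 1) :=
        Finset.sum_le_sum fun j _ => mul_card_filter_dvd_le L hs hsL j
    _ = z.natAbs * (2 * (2 * L + 1)) := by rw [Finset.sum_const, hcard, smul_eq_mul]

/-- The filtered box is still a product of one-dimensional sets. Multiplying by one side length
avoids the exponent `d - 1`. -/
theorem card_filter_box_mul (L : ℕ) (c : Fin d) (p : ℤ → Prop) [DecidablePred p] :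
    ((box d L).filter fun x => p (x c)).card * (2 * L + 1)
      = ((Finset.Icc (-(L : ℤ)) L).filter p).card * (2 * L + 1) ^ d := by
  have h : (box d L).filter (fun x => p (x c)) = Fintype.piFinset fun c' =>
      if c' = c then (Finset.Icc (-(L : ℤ)) L).filter p else Finset.Icc (-(L : ℤ)) L := by
    ext x
    simp only [Finset.mem_filter, box, Fintype.mem_piFinset]
    constructor
    · rintro ⟨h1, h2⟩ c'
      split_ifs with hc
      · subst hc; exact Finset.mem_filter.2 ⟨h1 _, h2⟩
      · exact h1 _
    · intro h1
      refine ⟨fun c' => ?_, ?_⟩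
      · have := h1 c'
        split_ifs at this with hc
        · exact (Finset.mem_filter.1 this).1
        · exact this
      · have := h1 c
        rw [if_pos rfl] at this
        exact (Finset.mem_filter.1 this).2
  have hI : (Finset.Icc (-(L : ℤ)) L).card = 2 * L + 1 := by rw [Int.card_Icc]; omega
  rw [h, Fintype.card_piFinset, ← Finset.mul_prod_erase _ _ (Finset.mem_univ c), if_pos rfl]
  have h2 : ∏ x ∈ Finset.univ.erase c, (if x = c then (Finset.Icc (-(L : ℤ)) L).filter p
      else Finset.Icc (-(L : ℤ)) L).card = (2 * L + 1) ^ (d - 1) := by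
    rw [Finset.prod_congr rfl (g := fun _ => 2 * L + 1), Finset.prod_const,
      Finset.card_erase_of_mem (Finset.mem_univ c), Finset.card_univ, Fintype.card_fin]
    intro x hx
    rw [if_neg (Finset.ne_of_mem_erase hx), hI]
  rw [h2, mul_assoc, ← pow_succ, Nat.sub_add_cancel c.pos]

/-- The labels of the cells of a partition of the lattice into cubes, with an arbitrary linear
order. -/
def Cell (d : ℕ) : Type := Lex (Fin d → ℤ)

instance : LinearOrder (Cell d) := inferInstanceAs (LinearOrder (Lex (Fin d → ℤ)))

/-- The label of a cell as a lattice point. -/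
def cellEquiv : (Fin d → ℤ) ≃ Cell d := toLex

/-- The cell of a point in the partition of the lattice into cubes of side `s`. -/
def cell (L s : ℕ) (x : Fin d → ℤ) : Cell d := cellEquiv fun c => (x c + L) / (s : ℤ)

/-- The `ℓ¹` norm. -/
def l1Norm (z : Fin d → ℤ) : ℝ := ∑ c, (|z c| : ℤ)

theorem l1Norm_nonneg (z : Fin d → ℤ) : 0 ≤ l1Norm z :=
  Finset.sum_nonneg fun c _ => by exact_mod_cast abs_nonneg _

/-- Leaving a cell means changing the quotient in some coordinate, so a union bound gives the `ℓ¹`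
norm. The minimum with `1` prepares dominated convergence for merely summable `ψ`. -/
theorem card_filter_cell_ne_le (L : ℕ) {s : ℕ} (hs : 0 < s) (hsL : s ≤ 2 * L + 1)
    (z : Fin d → ℤ) :
    (((box d L).filter fun x => cell L s x ≠ cell L s (x - z)).card : ℝ)
      ≤ (2 * L + 1) ^ d * min 1 (2 * l1Norm z / s) := by
  have hs' : (0 : ℝ) < s := by exact_mod_cast hs
  rw [mul_min_of_nonneg _ _ (by positivity), mul_one]
  refine le_min ?_ ?_
  · have := (Finset.card_filter_le (box d L) fun x => cell L s x ≠ cell L s (x - z)).trans_eq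
      (card_box d L)
    exact_mod_cast this
  have hsub : ((box d L).filter fun x => cell L s x ≠ cell L s (x - z)) ⊆
      Finset.univ.biUnion fun c : Fin d => (box d L).filter fun x =>
        (fun t : ℤ => (t + L) / (s : ℤ) ≠ (t - z c + L) / s) (x c) := by
    intro x hx
    rw [Finset.mem_filter] at hx
    simp only [Finset.mem_biUnion, Finset.mem_filter, Finset.mem_univ, true_and]
    by_contra! hcon
    exact hx.2 (congrArg cellEquiv (funext fun c => hcon c hx.1))
  have hone : ∀ c : Fin d, (((box d L).filter fun x =>
      (fun t : ℤ => (t + L) / (s : ℤ) ≠ (t - z c + L) / s) (x c)).card : ℝ)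
      ≤ (2 * L + 1) ^ d * (2 * (|z c| : ℤ) / s) := by
    intro c
    have h1 := card_filter_box_mul L c fun t : ℤ => (t + L) / (s : ℤ) ≠ (t - z c + L) / s
    have h2 := mul_card_filter_ediv_ne_le L hs hsL (z c)
    rw [← mul_div_assoc, le_div_iff₀ hs']
    have h3 : (0 : ℝ) < 2 * L + 1 := by positivity
    have h1' : (((box d L).filter fun x =>
        (fun t : ℤ => (t + L) / (s : ℤ) ≠ (t - z c + L) / s) (x c)).card : ℝ) * (2 * L + 1)
        = (((Finset.Icc (-(L : ℤ)) L).filter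
          fun t => (t + L) / (s : ℤ) ≠ (t - z c + L) / s).card : ℝ) * (2 * L + 1) ^ d := by
      exact_mod_cast h1
    have h2' : (s : ℝ) * (((Finset.Icc (-(L : ℤ)) L).filter
          fun t => (t + L) / (s : ℤ) ≠ (t - z c + L) / s).card : ℝ)
        ≤ (|z c| : ℤ) * (2 * (2 * L + 1)) := by
      rw [← Int.natCast_natAbs]
      exact_mod_cast h2
    refine le_of_mul_le_mul_right ?_ h3
    calc _ = (((box d L).filter fun x =>
        (fun t : ℤ => (t + L) / (s : ℤ) ≠ (t - z c + L) / s) (x c)).card : ℝ)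
          * (2 * L + 1) * s := by ring
      _ = (s : ℝ) * (((Finset.Icc (-(L : ℤ)) L).filter
          fun t => (t + L) / (s : ℤ) ≠ (t - z c + L) / s).card : ℝ) * (2 * L + 1) ^ d := by
          rw [h1']; ring
      _ ≤ (|z c| : ℤ) * (2 * (2 * L + 1)) * (2 * L + 1) ^ d :=
          mul_le_mul_of_nonneg_right h2' (by positivity)
      _ = _ := by ring
  calc (((box d L).filter fun x => cell L s x ≠ cell L s (x - z)).card : ℝ)
      ≤ ∑ c : Fin d, (((box d L).filter fun x =>
        (fun t : ℤ => (t + L) / (s : ℤ) ≠ (t - z c + L) / s) (x c)).card : ℝ) := by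
        exact_mod_cast (Finset.card_le_card hsub).trans Finset.card_biUnion_le
    _ ≤ ∑ c : Fin d, ((2 * L + 1) ^ d * (2 * (|z c| : ℤ) / s) : ℝ) :=
        Finset.sum_le_sum fun c _ => hone c
    _ = _ := by
        rw [← Finset.mul_sum, ← Finset.sum_div, ← Finset.mul_sum]
        rfl

theorem sum_box_sub_le {h : (Fin d → ℤ) → ℝ} (h0 : ∀ z, 0 ≤ h z) (hs : Summable h) {L : ℕ}
    (x : Fin d → ℤ) : ∑ y : box d L, h (x - y) ≤ ∑' z, h z := by
  have hinj : Function.Injective fun y : box d L => x - (y : Fin d → ℤ) := fun y y' hy =>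
    Subtype.ext (sub_right_injective hy)
  have := hs.sum_le_tsum (Finset.univ.map ⟨_, hinj⟩) fun z _ => h0 z
  rwa [Finset.sum_map] at this

/-- The total weight of the pairs of points of the box which lie in different cells. -/
theorem sum_cell_ne_le {ψ : (Fin d → ℤ) → ℝ≥0} (hψ : Summable ψ) (L : ℕ) {s : ℕ} (hs : 0 < s)
    (hsL : s ≤ 2 * L + 1) :
    (∑ x : box d L, ∑ y : box d L,
      if cell L s (x : Fin d → ℤ) = cell L s (y : Fin d → ℤ) then 0
      else (ψ ((x : Fin d → ℤ) - y) : ℝ))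
      ≤ (2 * L + 1) ^ d * ∑' z, (ψ z : ℝ) * min 1 (2 * l1Norm z / s) := by
  have hψ' : Summable fun z => (ψ z : ℝ) := NNReal.summable_coe.2 hψ
  -- Pairs are reorganized by their difference `z`, which is allowed to range over the whole
  -- lattice.
  set h : (Fin d → ℤ) → (Fin d → ℤ) → ℝ := fun x z =>
    if cell L s x = cell L s (x - z) then 0 else (ψ z : ℝ) with hh
  have h0 : ∀ x z, 0 ≤ h x z := fun x z => by simp only [hh]; positivity
  have hsum : ∀ x, Summable (h x) := fun x =>
    hψ'.of_nonneg_of_le (h0 x) fun z => by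
      simp only [hh]
      split_ifs
      · exact (ψ z).2
      · exact le_rfl
  have hsum' : Summable fun z => (ψ z : ℝ) * min 1 (2 * l1Norm z / s) :=
    hψ'.of_nonneg_of_le (fun z => mul_nonneg (ψ z).2 (le_min zero_le_one
      (by have := l1Norm_nonneg z; positivity)))
      fun z => mul_le_of_le_one_right (ψ z).2 (min_le_left _ _)
  have h1 : ∀ x : box d L, (∑ y : box d L,
      if cell L s (x : Fin d → ℤ) = cell L s (y : Fin d → ℤ) then 0
      else (ψ ((x : Fin d → ℤ) - y) : ℝ)) ≤ ∑' z, h x z := by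
    intro x
    refine le_of_eq_of_le ?_ (sum_box_sub_le (h0 x) (hsum x) (L := L) x)
    refine Finset.sum_congr rfl fun y _ => ?_
    simp only [hh, sub_sub_cancel]
  refine (Finset.sum_le_sum fun x _ => h1 x).trans ?_
  rw [← Summable.tsum_finsetSum fun (x : box d L) _ => hsum x, ← tsum_mul_left]
  refine Summable.tsum_le_tsum (fun z => ?_) (summable_sum fun (x : box d L) _ => hsum x)
    (hsum'.mul_left _)
  have h2 : ∑ x : box d L, h x z
      = (ψ z : ℝ) * ((box d L).filter fun x => cell L s x ≠ cell L s (x - z)).card := by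
    rw [Finset.sum_coe_sort (box d L) fun x => h x z, Finset.card_filter, Nat.cast_sum,
      Finset.mul_sum]
    refine Finset.sum_congr rfl fun x _ => ?_
    simp only [hh]
    split_ifs with h3 h4 <;> simp_all
  rw [h2, mul_left_comm]
  exact mul_le_mul_of_nonneg_left (card_filter_cell_ne_le L hs hsL z) (ψ z).2

/-- Dominated convergence with majorant `ψ`: no decay rate is needed for the weight across cell
boundaries to become negligible. -/
theorem tendsto_tsum_min_l1Norm {ψ : (Fin d → ℤ) → ℝ≥0} (hψ : Summable ψ) :
    Tendsto (fun l : ℕ => ∑' z, (ψ z : ℝ) * min 1 (2 * l1Norm z / (2 * l + 1 : ℕ))) atTop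
      (𝓝 0) := by
  have hψ' : Summable fun z => (ψ z : ℝ) := NNReal.summable_coe.2 hψ
  have h0 : (0 : ℝ) = ∑' z : Fin d → ℤ, (ψ z : ℝ) * 0 := by simp
  rw [h0]
  refine tendsto_tsum_of_dominated_convergence hψ' (fun z => ?_) (Eventually.of_forall fun l z => ?_)
  · apply Tendsto.const_mul
    have h1 : Tendsto (fun l : ℕ => 2 * l1Norm z / ((2 * l + 1 : ℕ) : ℝ)) atTop (𝓝 0) :=
      tendsto_const_nhds.div_atTop (tendsto_natCast_atTop_atTop.comp
        (tendsto_atTop_mono (fun l => by simp only [id]; omega) tendsto_id))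
    have h2 := (tendsto_const_nhds (x := (1 : ℝ))).min h1
    rwa [min_eq_right zero_le_one] at h2
  · have := l1Norm_nonneg z
    have hm : 0 ≤ min 1 (2 * l1Norm z / ((2 * l + 1 : ℕ) : ℝ)) := le_min zero_le_one (by positivity)
    rw [Real.norm_eq_abs, abs_of_nonneg (mul_nonneg (ψ z).coe_nonneg hm)]
    exact mul_le_of_le_one_right (ψ z).2 (min_le_left _ _)

/-- The cells contained in the box. -/
def fullCells (d q : ℕ) : Finset (Cell d) :=
  (Fintype.piFinset fun _ : Fin d => Finset.Ico (0 : ℤ) q).map cellEquiv.toEmbedding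

theorem card_fullCells (d q : ℕ) : (fullCells d q).card = q ^ d := by
  simp [fullCells, Fintype.card_piFinset]

theorem mem_fullCells {q : ℕ} {a : Cell d} :
    a ∈ fullCells d q ↔ ∀ c, 0 ≤ cellEquiv.symm a c ∧ cellEquiv.symm a c < q := by
  simp only [fullCells, Finset.mem_map, Fintype.mem_piFinset, Finset.mem_Ico]
  constructor
  · rintro ⟨b, hb, rfl⟩ c
    exact hb c
  · intro h
    exact ⟨cellEquiv.symm a, h, cellEquiv.apply_symm_apply a⟩

/-- A full cell is a translate of a box. -/
theorem exists_cell_equiv {L l : ℕ} {a : Cell d}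
    (ha : a ∈ fullCells d ((2 * L + 1) / (2 * l + 1))) :
    ∃ e : box d l ≃ {x : box d L // cell L (2 * l + 1) (x : Fin d → ℤ) = a},
      ∀ y y' : box d l, ((e y : box d L) : Fin d → ℤ) - ((e y' : box d L) : Fin d → ℤ)
        = (y : Fin d → ℤ) - y' := by
  rw [mem_fullCells] at ha
  set q := (2 * L + 1) / (2 * l + 1) with hq
  have hqs : (q : ℤ) * (2 * l + 1) ≤ 2 * L + 1 := by exact_mod_cast Nat.div_mul_le_self _ _
  have hs : (0 : ℤ) < 2 * l + 1 := by positivity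
  have hub : ∀ c, (cellEquiv.symm a c + 1) * (2 * l + 1) ≤ (2 * L + 1 : ℤ) := fun c =>
    (mul_le_mul_of_nonneg_right (by have := (ha c).2; omega) hs.le).trans hqs
  have hlb : ∀ c, 0 ≤ cellEquiv.symm a c * (2 * l + 1 : ℤ) := fun c => mul_nonneg (ha c).1 hs.le
  -- A pure translation preserves differences, hence variances, which is why a full cell carries the
  -- law of the smaller box.
  refine ⟨⟨fun y => ⟨⟨fun c => (y : Fin d → ℤ) c + l + cellEquiv.symm a c * (2 * l + 1) - L, ?_⟩, ?_⟩,
    fun x => ⟨fun c => (x.1 : Fin d → ℤ) c + L - cellEquiv.symm a c * (2 * l + 1) - l, ?_⟩, ?_, ?_⟩, ?_⟩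
  · rw [mem_box]
    intro c
    have h1 := mem_box.1 y.2 c
    have h2 := hub c
    have h3 := hlb c
    rw [add_mul, one_mul] at h2
    constructor <;> linarith [h1.1, h1.2]
  · apply cellEquiv.symm.injective
    ext c
    have h1 := mem_box.1 y.2 c
    simp only [cell, Equiv.symm_apply_apply]
    push_cast
    rw [sub_add_cancel, Int.add_mul_ediv_right _ _ hs.ne',
      Int.ediv_eq_zero_of_lt (by linarith [h1.1]) (by linarith [h1.2]), zero_add]
  · rw [mem_box]
    intro c
    have h1 : ((x.1 : Fin d → ℤ) c + L) / (2 * l + 1 : ℤ) = cellEquiv.symm a c := by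
      have := congrFun (congrArg cellEquiv.symm x.2) c
      simpa [cell] using this
    have e1 := Int.mul_ediv_add_emod ((x.1 : Fin d → ℤ) c + L) (2 * l + 1)
    have f1 := Int.emod_nonneg ((x.1 : Fin d → ℤ) c + L) hs.ne'
    have g1 := Int.emod_lt_of_pos ((x.1 : Fin d → ℤ) c + L) hs
    rw [h1, mul_comm] at e1
    constructor <;> linarith
  · intro y
    ext c
    simp
  · intro x
    ext c
    simp
  · intro y y'
    ext c
    simp

end BoxCounting

end BandMatrix

end

noncomputable section

namespace BandMatrix

/-! ### Existence of the limiting spectral measure -/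

section DensityOfStates

variable {d : ℕ}

instance (L : ℕ) : Nonempty (box d L) := ⟨⟨0, mem_box.2 fun c => by simp⟩⟩

theorem card_box_eq (d L : ℕ) : (Fintype.card (box d L) : ℝ) = (2 * L + 1) ^ d := by
  rw [Fintype.card_coe, card_box]
  push_cast
  rfl

/-- Comparison of the normalised spectral sums on boxes of two different sizes. -/
theorem abs_integral_specSum_box_sub_le (σ : SymmetryClass) {ψ : (Fin d → ℤ) → ℝ≥0}
    (hψ : Summable ψ) {f : ℝ → ℝ} {F : ℝ} (hF : ∀ x, |f x| ≤ F) {K : ℝ≥0}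
    (hf : LipschitzWith K f) {η : ℝ} (hη : 0 < η) {l L : ℕ} (hlL : l ≤ L) :
    |(∫ Z, specSum f (matrixOf Z) ∂entriesLaw σ ψ L) / Fintype.card (box d L)
        - (∫ Z, specSum f (matrixOf Z) ∂entriesLaw σ ψ l) / Fintype.card (box d l)|
      ≤ K * (η + 2 * (∑' z, (ψ z : ℝ) * min 1 (2 * l1Norm z / (2 * l + 1 : ℕ))) / η)
        + 2 * F * (1 - ((((2 * L + 1) / (2 * l + 1) : ℕ) : ℝ) * (2 * l + 1) / (2 * L + 1)) ^ d)
    := by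
  set q := (2 * L + 1) / (2 * l + 1) with hq
  set κ : box d L → Cell d := fun x => cell L (2 * l + 1) (x : Fin d → ℤ) with hκ
  set v : box d L × box d L → ℝ≥0 := fun p => ψ ((p.1 : Fin d → ℤ) - (p.2 : Fin d → ℤ)) with hv
  set J := ∫ Z, specSum f (matrixOf Z) ∂entriesLaw σ ψ l with hJ
  set A := ∫ Z, specSum f (matrixOf Z) ∂entriesLaw σ ψ L with hA
  set D := ∑' z, (ψ z : ℝ) * min 1 (2 * l1Norm z / (2 * l + 1 : ℕ)) with hD
  have hT : (0 : ℝ) < 2 * L + 1 := by positivity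
  have hs : (0 : ℝ) < 2 * l + 1 := by positivity
  have hF0 : 0 ≤ F := (abs_nonneg _).trans (hF 0)
  have hqT : (q : ℝ) * (2 * l + 1) ≤ 2 * L + 1 := by
    have : q * (2 * l + 1) ≤ 2 * L + 1 := Nat.div_mul_le_self _ _
    exact_mod_cast this
  -- The fraction of sites lying in full cells. The error `1 - r` enters twice: through the
  -- uncovered sites and through the weight `r` on the small-box average.
  set r : ℝ := ((q : ℝ) * (2 * l + 1) / (2 * L + 1)) ^ d with hr
  have hr1 : r ≤ 1 := pow_le_one₀ (by positivity) ((div_le_one hT).2 hqT)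
  have hrq : (q : ℝ) ^ d * (2 * l + 1) ^ d = r * (2 * L + 1) ^ d := by
    rw [hr, div_pow, mul_pow, div_mul_cancel₀ _ (by positivity)]
  -- the off-diagonal blocks
  have h1 := abs_integral_specSum_sub_blockPart_le σ v κ hF hf hη
  have hV := sum_cell_ne_le hψ L (s := 2 * l + 1) (by omega) (by omega)
  -- the diagonal blocks
  have hfib : ∀ a ∈ fullCells d q, (Finset.univ.filter fun x => κ x = a).card = (2 * l + 1) ^ d := by
    intro a ha
    obtain ⟨e, -⟩ := exists_cell_equiv ha
    rw [← Fintype.card_subtype, ← card_box, ← Fintype.card_coe]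
    exact (Fintype.card_congr e).symm
  have h2 := abs_integral_specSum_blockPart_sub_le σ v κ hF hf (G := fullCells d q)
    (m := (2 * l + 1) ^ d) (J := J) ?_ hfib ?_
  rotate_left
  · intro a ha
    obtain ⟨e, -⟩ := exists_cell_equiv ha
    obtain ⟨y⟩ := (inferInstance : Nonempty (box d l))
    exact Finset.mem_image.2 ⟨_, Finset.mem_univ _, (e y).2⟩
  · intro a ha
    obtain ⟨e, he⟩ := exists_cell_equiv ha
    rw [integral_specSum_toSquareBlock σ v κ a e f hf, hJ, entriesLaw]
    simp only [hv, he]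
  rw [card_fullCells] at h2
  have hA' : A = ∫ Z, specSum f (matrixOf Z) ∂(Measure.pi fun p => entryLaw σ (v p)) := rfl
  rw [← hA'] at h1
  rw [card_box_eq, card_box_eq]
  rw [card_box_eq] at h1 h2
  push_cast at h2
  rw [hrq] at h2
  have hJF : |J / (2 * l + 1) ^ d| ≤ F := by
    rw [abs_div, abs_of_pos (by positivity : (0 : ℝ) < (2 * l + 1) ^ d), div_le_iff₀ (by positivity),
      ← card_box_eq, hJ, ← Real.norm_eq_abs]
    refine (norm_integral_le_of_norm_le (integrable_const _)
      (ae_of_all _ fun Z => abs_specSum_le hF (matrixOf_isHermitian Z))).trans_eq ?_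
    rw [integral_const, probReal_univ, one_smul]
  have h3 : |A - r * (2 * L + 1) ^ d * (J / (2 * l + 1) ^ d)| ≤
      (2 * L + 1) ^ d * (K * (η + 2 * D / η) + F * (1 - r)) := by
    have e1 : (q : ℝ) ^ d * J = r * (2 * L + 1) ^ d * (J / (2 * l + 1) ^ d) := by
      rw [← hrq]; field_simp
    rw [← e1]
    refine (abs_sub_le _ _ _).trans ((add_le_add h1 h2).trans ?_)
    have e2 : 2 * (∑ x, ∑ y, if κ x = κ y then 0 else (v (x, y) : ℝ)) / η
        ≤ 2 * ((2 * L + 1) ^ d * D) / η := by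
      have := hV
      gcongr
    calc _ ≤ K * (η * (2 * L + 1) ^ d + 2 * ((2 * L + 1) ^ d * D) / η)
          + F * ((2 * L + 1) ^ d - r * (2 * L + 1) ^ d) :=
          add_le_add (mul_le_mul_of_nonneg_left (add_le_add le_rfl e2) K.coe_nonneg) le_rfl
      _ = _ := by ring
  have h4 : |A / (2 * L + 1) ^ d - r * (J / (2 * l + 1) ^ d)|
      ≤ K * (η + 2 * D / η) + F * (1 - r) := by
    have e3 : A / (2 * L + 1) ^ d - r * (J / (2 * l + 1) ^ d)
        = (A - r * (2 * L + 1) ^ d * (J / (2 * l + 1) ^ d)) / (2 * L + 1) ^ d := by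
      field_simp
    rw [e3, abs_div, abs_of_pos (by positivity : (0 : ℝ) < (2 * L + 1) ^ d),
      div_le_iff₀ (by positivity)]
    exact h3.trans_eq (mul_comm _ _)
  have h5 : |r * (J / (2 * l + 1) ^ d) - J / (2 * l + 1) ^ d| ≤ F * (1 - r) := by
    have e4 : r * (J / (2 * l + 1) ^ d) - J / (2 * l + 1) ^ d
        = -((1 - r) * (J / (2 * l + 1) ^ d)) := by ring
    rw [e4, abs_neg, abs_mul, abs_of_nonneg (by linarith), mul_comm]
    exact mul_le_mul_of_nonneg_right hJF (by linarith)
  refine (abs_sub_le _ _ _).trans ((add_le_add h4 h5).trans_eq ?_)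
  ring

/-- In each direction the uncovered remainder is shorter than one cell side, which is fixed while
`L` grows. -/
theorem tendsto_covered_fraction (d l : ℕ) :
    Tendsto (fun L : ℕ => ((((2 * L + 1) / (2 * l + 1) : ℕ) : ℝ) * (2 * l + 1) / (2 * L + 1)) ^ d)
      atTop (𝓝 1) := by
  have hT : Tendsto (fun L : ℕ => (2 * (L : ℝ) + 1)) atTop atTop :=
    tendsto_atTop_add_const_right _ _
      (tendsto_natCast_atTop_atTop.const_mul_atTop (by norm_num))
  have h1 : Tendsto (fun L : ℕ => (((2 * L + 1) / (2 * l + 1) : ℕ) : ℝ) * (2 * l + 1)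
      / (2 * L + 1)) atTop (𝓝 1) := by
    have hlow : Tendsto (fun L : ℕ => 1 - (2 * (l : ℝ) + 1) / (2 * (L : ℝ) + 1)) atTop (𝓝 1) := by
      have := (tendsto_const_nhds (x := (1 : ℝ))).sub
        ((tendsto_const_nhds (x := 2 * (l : ℝ) + 1)).div_atTop hT)
      rwa [sub_zero] at this
    refine tendsto_of_tendsto_of_tendsto_of_le_of_le hlow tendsto_const_nhds ?_ ?_
    · intro L
      have hpos : (0 : ℝ) < 2 * L + 1 := by positivity
      have h2 : (2 * L + 1 : ℕ) ≤ (2 * L + 1) / (2 * l + 1) * (2 * l + 1) + (2 * l + 1) :=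
        (Nat.lt_div_mul_add (by omega)).le
      have h2' : (2 * L + 1 : ℝ)
          ≤ (((2 * L + 1) / (2 * l + 1) : ℕ) : ℝ) * (2 * l + 1) + (2 * l + 1) := by
        exact_mod_cast h2
      simp only
      rw [sub_le_iff_le_add, ← add_div, le_div_iff₀ hpos, one_mul]
      exact h2'
    · intro L
      have hpos : (0 : ℝ) < 2 * L + 1 := by positivity
      have h2 : (2 * L + 1) / (2 * l + 1) * (2 * l + 1) ≤ 2 * L + 1 := Nat.div_mul_le_self _ _
      simp only
      rw [div_le_one hpos]
      exact_mod_cast h2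
  simpa using h1.pow d

theorem cauchySeq_integral_meanSpectral (σ : SymmetryClass) {ψ : (Fin d → ℤ) → ℝ≥0}
    (hψ : Summable ψ) {f : ℝ → ℝ} {F : ℝ} (hF : ∀ x, |f x| ≤ F) {K : ℝ≥0}
    (hf : LipschitzWith K f) :
    CauchySeq fun L => ∫ x, f x ∂meanSpectral (entriesLaw σ ψ L) := by
  have hF0 : 0 ≤ F := (abs_nonneg _).trans (hF 0)
  simp only [integral_meanSpectral _ hF hf.continuous.measurable]
  rw [Metric.cauchySeq_iff']
  intro ε hε
  -- It is enough that all large boxes agree with one fixed box `l`, which need not be large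
  -- compared with them.
  suffices h : ∃ l : ℕ, ∀ᶠ L : ℕ in atTop,
      |(∫ Z, specSum f (matrixOf Z) ∂entriesLaw σ ψ L) / Fintype.card (box d L)
        - (∫ Z, specSum f (matrixOf Z) ∂entriesLaw σ ψ l) / Fintype.card (box d l)| < ε / 2 by
    obtain ⟨l, hl⟩ := h
    obtain ⟨N, hN⟩ := eventually_atTop.1 hl
    refine ⟨N, fun n hn => ?_⟩
    have h1 := hN n hn
    have h2 := hN N le_rfl
    rw [Real.dist_eq]
    rw [abs_sub_comm] at h2
    exact (abs_sub_le _ _ _).trans_lt ((add_lt_add h1 h2).trans_eq (by ring))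
  -- The order of choice is `η`, then `l` making the boundary weight less than `η² / 2`, then `L`:
  -- dropping blocks costs at most `2Kη ≤ ε / 4`, uncovered sites less than `ε / 4`.
  set η : ℝ := ε / (8 * (K + 1)) with hη
  have hη0 : 0 < η := by positivity
  have hD := (tendsto_tsum_min_l1Norm hψ).eventually_lt_const (show 0 < η ^ 2 / 2 by positivity)
  obtain ⟨l, hl⟩ := hD.exists
  refine ⟨l, ?_⟩
  have hc : Tendsto (fun L : ℕ => 2 * F * (1 -
      ((((2 * L + 1) / (2 * l + 1) : ℕ) : ℝ) * (2 * l + 1) / (2 * L + 1)) ^ d)) atTop (𝓝 0) := by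
    have := ((tendsto_const_nhds (x := (1 : ℝ))).sub (tendsto_covered_fraction d l)).const_mul
      (2 * F)
    rwa [sub_self, mul_zero] at this
  filter_upwards [hc.eventually_lt_const (show (0 : ℝ) < ε / 4 by positivity),
    eventually_ge_atTop l] with L hL hlL
  refine (abs_integral_specSum_box_sub_le σ hψ hF hf hη0 hlL).trans_lt ?_
  have h3 : 2 * (∑' z, (ψ z : ℝ) * min 1 (2 * l1Norm z / (2 * l + 1 : ℕ))) / η ≤ η := by
    rw [div_le_iff₀ hη0]
    nlinarith
  have h4 : K * (η + 2 * (∑' z, (ψ z : ℝ) * min 1 (2 * l1Norm z / (2 * l + 1 : ℕ))) / η)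
      ≤ ε / 4 := by
    calc _ ≤ K * (η + η) := mul_le_mul_of_nonneg_left (add_le_add le_rfl h3) K.coe_nonneg
      _ ≤ (K + 1) * (η + η) := by gcongr; linarith
      _ = ε / 4 := by rw [hη]; field_simp; ring
  linarith

/-- The second moment is the normalized mean Hilbert–Schmidt norm, and each row of variances sums to
at most `∑ ψ`. This supplies tightness. -/
theorem lintegral_sq_meanSpectral_le (σ : SymmetryClass) {ψ : (Fin d → ℤ) → ℝ≥0}
    (hψ : Summable ψ) (L : ℕ) :
    ∫⁻ x, ENNReal.ofReal (x ^ 2) ∂meanSpectral (entriesLaw σ ψ L)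
      ≤ ((2 * ∑' z, ψ z : ℝ≥0) : ℝ≥0∞) := by
  have hψ' : Summable fun z => (ψ z : ℝ) := NNReal.summable_coe.2 hψ
  rw [lintegral_sq_meanSpectral]
  refine ENNReal.div_le_of_le_mul ((lintegral_hsSq_matrixOf_le σ _).trans ?_)
  have h : 2 * ∑ x : box d L, ∑ y : box d L, (ψ ((x : Fin d → ℤ) - y) : ℝ)
      ≤ ((2 * ∑' z, ψ z : ℝ≥0) : ℝ) * Fintype.card (box d L) := by
    have := Finset.sum_le_sum fun (x : box d L) (_ : x ∈ Finset.univ) =>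
      sum_box_sub_le (fun z => (ψ z).coe_nonneg) hψ' (L := L) (x : Fin d → ℤ)
    rw [Finset.sum_const, Finset.card_univ, nsmul_eq_mul] at this
    push_cast
    linarith
  refine (ENNReal.ofReal_le_ofReal h).trans_eq ?_
  rw [ENNReal.ofReal_mul (NNReal.coe_nonneg _), ENNReal.ofReal_coe_nnreal, ENNReal.ofReal_natCast]

theorem meanSpectral_entriesLaw_apply {σ : SymmetryClass} {ψ : (Fin d → ℤ) → ℝ≥0} {L : ℕ}
    {Ω : Type*} [MeasurableSpace Ω] {P : Measure Ω} [IsProbabilityMeasure P]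
    {X : Ω → Matrix (box d L) (box d L) ℂ} (h : IsGaussianMatrix σ ψ P X) {I : Set ℝ}
    (hI : MeasurableSet I) :
    meanSpectral (entriesLaw σ ψ L) I = meanCount P X I / (2 * (L : ℝ≥0∞) + 1) ^ d := by
  rw [meanSpectral_apply _ hI, ← h.lintegral_eq (measurable_eigenvalueCount hI), Fintype.card_coe,
    card_box]
  push_cast
  rfl

theorem meanCount_div_le {σ : SymmetryClass} {ψ : (Fin d → ℤ) → ℝ≥0} {W L : ℕ}
    (hWL : W ≤ 2 * L) (hψ : LowerBound ψ W L) {Ω : Type*} [MeasurableSpace Ω] {P : Measure Ω}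
    [IsProbabilityMeasure P] {X : Ω → Matrix (box d L) (box d L) ℂ}
    (h : IsGaussianMatrix σ ψ P X) {I : Set ℝ} (hI : I.OrdConnected) :
    meanCount P X I / (2 * (L : ℝ≥0∞) + 1) ^ d ≤ (64 : ℝ≥0) * volume I := by
  refine ENNReal.div_le_of_le_mul ((meanCount_le hWL hψ h hI).trans_eq ?_)
  push_cast
  ring

end DensityOfStates

end BandMatrix

end

theorem mainTheorem7 :
    ∃ C : ℝ≥0, 0 < C ∧
      -- the finite-volume estimate
      (∀ (σ : BandMatrix.SymmetryClass) (d L W : ℕ) (ψ : (Fin d → ℤ) → ℝ≥0),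
        1 ≤ d → (∀ r, ψ (-r) = ψ r) → W ≤ 2 * L → BandMatrix.LowerBound ψ W L →
        ∀ (Ω : Type*) [MeasurableSpace Ω] (P : Measure Ω) [IsProbabilityMeasure P]
          (X : Ω → Matrix (BandMatrix.box d L) (BandMatrix.box d L) ℂ),
          BandMatrix.IsGaussianMatrix σ ψ P X →
          ∀ I : Set ℝ, I.OrdConnected →
            BandMatrix.meanCount P X I ≤ (C : ℝ≥0∞) * (2 * (L : ℝ≥0∞) + 1) ^ d * volume I) ∧
      -- the density of states
      (∀ (σ : BandMatrix.SymmetryClass) (d W : ℕ) (ψ : (Fin d → ℤ) → ℝ≥0),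
        1 ≤ d → (∀ r, ψ (-r) = ψ r) → (∀ L : ℕ, BandMatrix.LowerBound ψ W L) →
        ∀ (Ω : ℕ → Type*) [∀ L, MeasurableSpace (Ω L)] (P : ∀ L, Measure (Ω L))
          [∀ L, IsProbabilityMeasure (P L)]
          (X : ∀ L, Ω L → Matrix (BandMatrix.box d L) (BandMatrix.box d L) ℂ),
          (∀ L, BandMatrix.IsGaussianMatrix σ ψ (P L) (X L)) →
          -- every limiting measure has a density bounded by `C`
          (∀ (ρ : Measure ℝ) [IsLocallyFiniteMeasure ρ],
            BandMatrix.VagueLimit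
              (fun L I => BandMatrix.meanCount (P L) (X L) I / (2 * (L : ℝ≥0∞) + 1) ^ d) ρ →
            ∃ f : ℝ → ℝ≥0∞, Measurable f ∧ (∀ t, f t ≤ C) ∧ ρ = volume.withDensity f) ∧
          -- for summable shape functions the limiting measure exists
          (Summable ψ →
            ∃ ρ : Measure ℝ, IsProbabilityMeasure ρ ∧
              ∀ I : Set ℝ, I.OrdConnected →
                Tendsto
                  (fun L : ℕ =>
                    BandMatrix.meanCount (P L) (X L) I / (2 * (L : ℝ≥0∞) + 1) ^ d)
                  atTop (𝓝 (ρ I)))) := by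
  refine ⟨64, by norm_num, ?_, ?_⟩
  · intro σ d L W ψ _ _ hWL hψ Ω _ P _ X hX I hI
    exact BandMatrix.meanCount_le hWL hψ hX hI
  · intro σ d W ψ _ _ hψ Ω _ P _ X hX
    have hbound : ∀ᶠ L : ℕ in atTop, ∀ I : Set ℝ, I.OrdConnected →
        BandMatrix.meanCount (P L) (X L) I / (2 * (L : ℝ≥0∞) + 1) ^ d
          ≤ (64 : ℝ≥0) * volume I := by
      -- The finite-volume bound needs `W ≤ 2L`, which holds as soon as `L ≥ W`.
      filter_upwards [eventually_ge_atTop W] with L hL I hI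
      exact BandMatrix.meanCount_div_le (by omega) (hψ L) (hX L) hI
    refine ⟨fun ρ _ hρ => ?_, fun hsum => ?_⟩
    · refine BandMatrix.exists_density_of_measure_Icc_le fun a b hab ha hb => ?_
      refine le_of_tendsto (hρ a b hab ha hb) ?_
      filter_upwards [hbound] with L hL
      exact (hL _ Set.ordConnected_Icc).trans_eq (by rw [Real.volume_Icc])
    · let μ : ℕ → ProbabilityMeasure ℝ := fun L =>
        ⟨BandMatrix.meanSpectral (BandMatrix.entriesLaw σ ψ L), inferInstance⟩
      have hμ : ∀ (L : ℕ) (I : Set ℝ), I.OrdConnected → (μ L : Measure ℝ) I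
          = BandMatrix.meanCount (P L) (X L) I / (2 * (L : ℝ≥0∞) + 1) ^ d := fun L I hI =>
        BandMatrix.meanSpectral_entriesLaw_apply (hX L) hI.measurableSet
      obtain ⟨ρ, hρ⟩ := BandMatrix.exists_tendsto_probabilityMeasure (μ := μ)
        (fun L => BandMatrix.lintegral_sq_meanSpectral_le σ hsum L) (by
          rintro f ⟨C, hC⟩ ⟨K, hK⟩
          -- Boundedness is given as a bound `C` on the oscillation, which becomes a sup bound after
          -- adding `|f 0|`.
          refine BandMatrix.cauchySeq_integral_meanSpectral σ hsum (F := |f 0| + C)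
            (fun x => ?_) hK
          have h1 := hC x 0
          rw [Real.dist_eq] at h1
          have h2 := abs_sub_abs_le_abs_sub (f x) (f 0)
          linarith)
      refine ⟨ρ, inferInstance, fun I hI => ?_⟩
      have hlim := BandMatrix.tendsto_measure_ordConnected hρ (C := 64) (by
        filter_upwards [hbound] with L hL J hJ
        rw [hμ L J hJ]
        exact hL J hJ) hI
      simpa only [hμ _ I hI] using hlim
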